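/- Let $d\ge 1$ and let $Y=\prod_{j=1}^d(0,\ell_j)$ with $\ell_j>0$, $|Y|=1$. Let $G',\rho'$ be smooth functions on $\mathbb R^d$, let $G'',\rho''$ be bounded measurable $Y$-periodic functions (possibly discontinuous), and let either $G(x,y)=G'(x)+G''(y)$, $\rho(x,y)=\rho'(x)+\rho''(y)$ (additive separation) or $G(x,y)=G'(x)G''(y)$, $\rho(x,y)=\rho'(x)\rho''(y)$ (multiplicative separation). Assume that for every $x$ one has $\rho(x,\cdot)>0$ a.e. and $G(x,\cdot)\ge c(x)>0$ a.e. Write $\langle f\rangle=\int_Y f\,dy$, let $H^1_{\rm per}(Y)$ be the space of $Y$-periodic functions that, together with their weak gradients (taken against smooth periodic test functions), lie in $L^2(Y)$; two-scale fields $u(x,y)$ are maps $x\mapsto u(x,\cdot)\in H^1_{\rm per}(Y)$, smooth in $x$. All equations in $y$ are understood weakly against smooth $Y$-periodic test functions (so continuity and periodicity of the fields and of the normal fluxes are included). Repeated indices are summed; $\partial_i=\partial/\partial x_i$, $\partial_{y_i}=\partial/\partial y_i$; the divergence of a tensor contracts its first index. **Cell functions.** There is exactly one family $P_j,Q_{jk},R_{jkl},\tilde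 P_j,\tilde Q_{jk},\tilde R_j$ of two-scale fields with zero mean over $Y$ that solves, for all $x$, $$\begin{aligned} &\partial_{y_i}[G(\delta_{ij}+\partial_{y_i}P_j)]=0,\\ &\partial_{y_i}[G(\delta_{ij}P_k+\partial_{y_i}Q_{jk})]=\tfrac{\rho}{\varrho^{(0)}}\mu^{(0)}_{jk}-G(\delta_{jk}+\partial_{y_j}P_k),\\ &\partial_{y_i}[G(\partial_iP_j+\partial_{y_i}\tilde P_j)]=\tfrac{\rho}{\varrho^{(0)}}\partial_i\mu^{(0)}_{ij}-\partial_i[G(\delta_{ij}+\partial_{y_i}P_j)],\\ &\partial_{y_i}[G(\delta_{ij}\tilde P_k+\partial_iQ_{jk}+\partial_{y_i}\tilde Q_{jk})]=\tfrac{\rho}{\varrho^{(0)}}(\eta_{jk}+\partial_i\mu^{(1)}_{ijk})-\partial_i[G(\delta_{ij}P_k+\partial_{y_i}Q_{jk})]\\ &\qquad\qquad-G(\partial_jP_k+\partial_{y_j}\tilde P_k)+s_j\tfrac{\partial_i\mu^{(0)}_{ik}}{\varrho^{(0)}}+s_m\,\partial_m\big[\tfrac{\mu^{(0)}_{jk}}{\varrho^{(0)}}\big],\\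 &\partial_{y_i}[G(\delta_{ij}Q_{kl}+\partial_{y_i}R_{jkl})]=\tfrac{\rho}{\varrho^{(0)}}\mu^{(1)}_{jkl}-G(\delta_{jk}P_l+\partial_{y_j}Q_{kl})+\tfrac{\mu^{(0)}_{jk}}{\varrho^{(0)}}s_l,\\ &\partial_{y_i}[G(\partial_i\tilde P_j+\partial_{y_i}\tilde R_j)]=\tfrac{\rho}{\varrho^{(0)}}\partial_i\eta_{ij}-\partial_i[G(\partial_iP_j+\partial_{y_i}\tilde P_j)]+s_m\,\partial_m\big[\tfrac{\partial_i\mu^{(0)}_{ij}}{\varrho^{(0)}}\big], \end{aligned}$$ where $s_j=\rho\,(P_j-\varrho^{(1)}_j/\varrho^{(0)})$ and $$\begin{aligned} &\mu^{(0)}_{ij}=\langle G(\delta_{ij}+\partial_{y_i}P_j)\rangle,\quad \mu^{(1)}_{ijk}=\langle G(\delta_{ij}P_k+\partial_{y_i}Q_{jk})\rangle,\quad \mu^{(2)}_{ijkl}=\langle G(\delta_{ij}Q_{kl}+\partial_{y_i}R_{jkl})\rangle,\\ &\varrho^{(0)}=\langle\rho\rangle>0,\quad \varrho^{(1)}_j=\langle\rho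 P_j\rangle,\quad \varrho^{(2)}_{jk}=\langle\rho Q_{jk}\rangle,\quad \tilde\varrho^{(2)}_j=\langle\rho\tilde P_j\rangle,\quad \eta_{ij}=\langle G(\partial_iP_j+\partial_{y_i}\tilde P_j)\rangle,\\ &\phi_{ij}=\langle G(\partial_i\tilde P_j+\partial_{y_i}\tilde R_j)\rangle,\quad \psi_{ijk}=\langle G(\partial_iQ_{jk}+\delta_{ij}\tilde P_k+\partial_{y_i}\tilde Q_{jk})\rangle . \end{aligned}$$ All these effective coefficients are smooth functions of $x$ and do not depend on $\omega$. **Mean-field equations.** Let $\omega\in\mathbb R$ and let $u=\sum_k\epsilon^ku_k(x,y)$, with two-scale fields $u_k$, satisfy $$\epsilon^{-2}\nabla_y\!\cdot(G\nabla_yu)+\epsilon^{-1}[\nabla_x\!\cdot(G\nabla_yu)+\nabla_y\!\cdot(G\nabla_xu)]+[\rho\omega^2u+\nabla_x\!\cdot(G\nabla_xu)]=0$$ formally at the orders $\epsilon^{-2},\dots,\epsilon^{2}$. Then the means $\langle u_k\rangle$, $k\le4$, are smooth, $u_0=\langle u_0\rangle$, $u_1=\langle u_1\rangle+P\cdot\nabla\langle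 u_0\rangle$, $u_2=\langle u_2\rangle+P\cdot\nabla\langle u_1\rangle+Q:\nabla\nabla\langle u_0\rangle+\tilde P\cdot\nabla\langle u_0\rangle$, $u_3=\langle u_3\rangle+P\cdot\nabla\langle u_2\rangle+\tilde P\cdot\nabla\langle u_1\rangle+Q:\nabla\nabla\langle u_1\rangle+\tilde R\cdot\nabla\langle u_0\rangle+\tilde Q:\nabla\nabla\langle u_0\rangle+R:\nabla\nabla\nabla\langle u_0\rangle$, and, with $$\begin{aligned} L_0v&=\nabla\!\cdot[\mu^{(0)}\!\cdot\nabla v]+\varrho^{(0)}\omega^2v,\\ L_1v&=[\nabla\!\cdot\eta+\varrho^{(1)}\omega^2]\cdot\nabla v+[\eta+\nabla\!\cdot\mu^{(1)}]:\nabla\nabla v+\mu^{(1)}:\nabla\nabla\nabla v,\\ L_2v&=[\nabla\!\cdot\phi+\tilde\varrho^{(2)}\omega^2]\cdot\nabla v+[\nabla\!\cdot\psi+\phi+\varrho^{(2)}\omega^2]:\nabla\nabla v+[\psi+\nabla\!\cdot\mu^{(2)}]:\nabla\nabla\nabla v+\mu^{(2)}:\nabla\nabla\nabla\nabla v, \end{aligned}$$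 one has $L_0\langle u_0\rangle=0$, $\;L_0\langle u_1\rangle=-L_1\langle u_0\rangle$, $\;L_0\langle u_2\rangle=-L_1\langle u_1\rangle-L_2\langle u_0\rangle$. **Effective equation.** Consequently $\langle u\rangle$ satisfies $$L_0\langle u\rangle=-\epsilon L_1\langle u\rangle-\epsilon^2L_2\langle u\rangle+O(\epsilon^3)\qquad(\epsilon\to0^+),$$ in the sense that for every compact $K\subset\mathbb R^d$ the remainder is $O(\epsilon^3)$ uniformly on $K$, for every family $\langle u\rangle=\langle u\rangle_\epsilon$ of $C^4$ functions with $\langle u\rangle_\epsilon=\langle u_0\rangle+\epsilon\langle u_1\rangle+\epsilon^2\langle u_2\rangle+O(\epsilon^3)$ uniformly on $K$ together with all derivatives up to order four (in particular for the partial sum $\langle u_0\rangle+\epsilon\langle u_1\rangle+\epsilon^2\langle u_2\rangle$ itself). -/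

import Mathlib

open MeasureTheory Set Filter Topology
open scoped ContDiff

noncomputable section

namespace QuasiPeriodic

/-- Points of `ℝ^d` with the Euclidean structure. -/
abbrev Pt (d : ℕ) : Type := EuclideanSpace ℝ (Fin d)

/-- The partial derivative `∂f/∂x_i` of a (scalar or Banach-space valued) function on `ℝ^d`. -/
def pd {d : ℕ} {F : Type*} [NormedAddCommGroup F] [NormedSpace ℝ F]
    (i : Fin d) (f : Pt d → F) (x : Pt d) : F :=
  fderiv ℝ f x (EuclideanSpace.single i (1 : ℝ))

/-- The unit cell `Y = {y : 0 < y_j < ℓ_j}`. -/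
def cell {d : ℕ} (ℓ : Fin d → ℝ) : Set (Pt d) :=
  {y | ∀ j, 0 < y j ∧ y j < ℓ j}

/-- Lebesgue measure on the unit cell. -/
abbrev cellMeasure {d : ℕ} (ℓ : Fin d → ℝ) : Measure (Pt d) :=
  volume.restrict (cell ℓ)

/-- `Y`-periodicity of a function on `ℝ^d`. -/
def IsPeriodic {d : ℕ} (ℓ : Fin d → ℝ) (f : Pt d → ℝ) : Prop :=
  ∀ y j, f (y + EuclideanSpace.single j (ℓ j)) = f y

/-- Test functions: smooth `Y`-periodic functions. -/
structure IsTest {d : ℕ} (ℓ : Fin d → ℝ) (φ : Pt d → ℝ) : Prop where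
  smooth : ContDiff ℝ ∞ φ
  periodic : IsPeriodic ℓ φ

/-- The space `L²(Y)`. -/
abbrev L2 {d : ℕ} (ℓ : Fin d → ℝ) : Type := Lp ℝ 2 (cellMeasure ℓ)

lemma cell_subset_closedBall {d : ℕ} (ℓ : Fin d → ℝ) :
    cell ℓ ⊆ Metric.closedBall (0 : Pt d) (Real.sqrt (∑ j, ℓ j ^ 2)) := by
  intro y hy
  rw [mem_closedBall_zero_iff, EuclideanSpace.norm_eq]
  apply Real.sqrt_le_sqrt
  apply Finset.sum_le_sum
  intro j _
  rw [Real.norm_eq_abs, sq_abs]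
  exact pow_le_pow_left₀ (hy j).1.le (hy j).2.le 2

instance {d : ℕ} (ℓ : Fin d → ℝ) : IsFiniteMeasure (cellMeasure ℓ) := by
  refine ⟨?_⟩
  rw [Measure.restrict_apply_univ]
  exact lt_of_le_of_lt (measure_mono (cell_subset_closedBall ℓ)) measure_closedBall_lt_top

lemma measurableSet_cell {d : ℕ} (ℓ : Fin d → ℝ) : MeasurableSet (cell ℓ) := by
  have h : cell ℓ = ⋂ j, ({y : Pt d | 0 < y j} ∩ {y : Pt d | y j < ℓ j}) := by
    ext y
    simp [cell]
  rw [h]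
  refine MeasurableSet.iInter fun j => ?_
  exact (measurableSet_lt measurable_const (by fun_prop)).inter
    (measurableSet_lt (by fun_prop) measurable_const)

lemma integrable_mul_of_continuous {d : ℕ} {ℓ : Fin d → ℝ} (f : L2 ℓ) {ψ : Pt d → ℝ}
    (hψ : Continuous ψ) : Integrable (fun y => f y * ψ y) (cellMeasure ℓ) := by
  have hf : Integrable (fun y => f y) (cellMeasure ℓ) :=
    (Lp.memLp f).integrable (by norm_num)
  obtain ⟨B, hB⟩ := (isCompact_closedBall (0 : Pt d)
    (Real.sqrt (∑ j, ℓ j ^ 2))).exists_bound_of_continuousOn hψ.continuousOn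
  refine hf.mul_bdd (c := B) hψ.aestronglyMeasurable ?_
  filter_upwards [ae_restrict_mem (measurableSet_cell ℓ)] with y hy
  exact hB y (cell_subset_closedBall ℓ hy)

lemma IsTest.continuous_pd {d : ℕ} {ℓ : Fin d → ℝ} {φ : Pt d → ℝ} (h : IsTest ℓ φ) (i : Fin d) :
    Continuous (pd i φ) :=
  (h.smooth.continuous_fderiv (by simp)).clm_apply continuous_const

/-- The periodic Sobolev space `H¹_per(Y)`: pairs `(w, ∇w)` of a function `w ∈ L²(Y)` and its weak
gradient in `L²(Y)^d`, the weak derivatives being taken against smooth periodic test functions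
(so that the traces of `w` on opposite faces of `Y` agree). It carries the norm of
`L² × (L²)^d`, which is equivalent to the usual `H¹` norm. -/
def H1per {d : ℕ} (ℓ : Fin d → ℝ) : Submodule ℝ (L2 ℓ × (Fin d → L2 ℓ)) where
  carrier := {w | ∀ φ, IsTest ℓ φ → ∀ i,
    ∫ y, w.1 y * pd i φ y ∂(cellMeasure ℓ) = -∫ y, w.2 i y * φ y ∂(cellMeasure ℓ)}
  zero_mem' := by
    intro φ _ i
    have h0 : ((0 : L2 ℓ) : Pt d → ℝ) =ᵐ[cellMeasure ℓ] 0 := Lp.coeFn_zero _ _ _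
    have h1 : ∀ ψ : Pt d → ℝ, ∫ y, (0 : L2 ℓ) y * ψ y ∂(cellMeasure ℓ) = 0 := by
      intro ψ
      apply integral_eq_zero_of_ae
      filter_upwards [h0] with y hy
      simp only [hy, Pi.zero_apply, zero_mul]
    change ∫ y, (0 : L2 ℓ) y * pd i φ y ∂(cellMeasure ℓ)
      = -∫ y, (0 : L2 ℓ) y * φ y ∂(cellMeasure ℓ)
    rw [h1, h1, neg_zero]
  add_mem' := by
    intro v w hv hw φ hφ i
    have key : ∀ (f g : L2 ℓ) (ψ : Pt d → ℝ), Continuous ψ →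
        ∫ y, (f + g) y * ψ y ∂(cellMeasure ℓ)
          = ∫ y, f y * ψ y ∂(cellMeasure ℓ) + ∫ y, g y * ψ y ∂(cellMeasure ℓ) := by
      intro f g ψ hψ
      rw [← integral_add (integrable_mul_of_continuous f hψ) (integrable_mul_of_continuous g hψ)]
      apply integral_congr_ae
      filter_upwards [Lp.coeFn_add f g] with y hy
      rw [hy, Pi.add_apply, add_mul]
    change ∫ y, (v.1 + w.1) y * pd i φ y ∂(cellMeasure ℓ)
      = -∫ y, (v.2 i + w.2 i) y * φ y ∂(cellMeasure ℓ)
    rw [key _ _ _ (hφ.continuous_pd i), key _ _ _ hφ.smooth.continuous, hv φ hφ i, hw φ hφ i]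
    ring
  smul_mem' := by
    intro c w hw φ hφ i
    have key : ∀ (f : L2 ℓ) (ψ : Pt d → ℝ),
        ∫ y, (c • f) y * ψ y ∂(cellMeasure ℓ) = c * ∫ y, f y * ψ y ∂(cellMeasure ℓ) := by
      intro f ψ
      rw [← integral_const_mul]
      apply integral_congr_ae
      filter_upwards [Lp.coeFn_smul c f] with y hy
      rw [hy, Pi.smul_apply, smul_eq_mul, mul_assoc]
    change ∫ y, (c • w.1) y * pd i φ y ∂(cellMeasure ℓ)
      = -∫ y, (c • w.2 i) y * φ y ∂(cellMeasure ℓ)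
    rw [key, key, hw φ hφ i]
    ring

/-- The underlying `L²` function of an element of `H¹_per(Y)`. -/
def val {d : ℕ} {ℓ : Fin d → ℝ} (w : H1per ℓ) : L2 ℓ := (w : L2 ℓ × (Fin d → L2 ℓ)).1

/-- The weak partial derivative `∂w/∂y_i` of an element of `H¹_per(Y)`. -/
def dy {d : ℕ} {ℓ : Fin d → ℝ} (i : Fin d) (w : H1per ℓ) : L2 ℓ :=
  (w : L2 ℓ × (Fin d → L2 ℓ)).2 i

/-- The mean `⟨w⟩ = ∫_Y w` (recall `|Y| = 1`). -/
def mean {d : ℕ} {ℓ : Fin d → ℝ} (w : H1per ℓ) : ℝ := ∫ y, val w y ∂(cellMeasure ℓ)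

/-- A two-scale field `u(x, y)`, `Y`-periodic in `y`: a map `x ↦ u(x, ·) ∈ H¹_per(Y)`. -/
abbrev TwoScale {d : ℕ} (ℓ : Fin d → ℝ) : Type := Pt d → H1per ℓ

/-- The two kinds of separation of scales. -/
inductive Separation where
  | additive
  | multiplicative

/-- Combination of a macroscopic and a microscopic variation. -/
def Separation.combine (s : Separation) (a b : ℝ) : ℝ :=
  match s with
  | .additive => a + b
  | .multiplicative => a * b

/-- A quasi-periodic medium: smooth macroscopic variations `G', ρ'`, and `Y`-periodic, possibly
discontinuous microscopic variations `G'', ρ''`, which combine additively or multiplicatively to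
elastic and density coefficients `G, ρ > 0`. -/
structure Medium (d : ℕ) where
  ℓ : Fin d → ℝ
  ℓ_pos : ∀ j, 0 < ℓ j
  volume_one : ∏ j, ℓ j = 1
  sep : Separation
  Gmac : Pt d → ℝ
  ρmac : Pt d → ℝ
  Gmic : Pt d → ℝ
  ρmic : Pt d → ℝ
  Gmac_smooth : ContDiff ℝ ∞ Gmac
  ρmac_smooth : ContDiff ℝ ∞ ρmac
  Gmic_measurable : Measurable Gmic
  ρmic_measurable : Measurable ρmic
  Gmic_periodic : IsPeriodic ℓ Gmic
  ρmic_periodic : IsPeriodic ℓ ρmic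
  Gmic_bounded : ∃ B, ∀ᵐ y ∂(cellMeasure ℓ), |Gmic y| ≤ B
  ρmic_bounded : ∃ B, ∀ᵐ y ∂(cellMeasure ℓ), |ρmic y| ≤ B
  elliptic : ∀ x, ∃ c, 0 < c ∧ ∀ᵐ y ∂(cellMeasure ℓ), c ≤ sep.combine (Gmac x) (Gmic y)
  density_pos : ∀ x, ∀ᵐ y ∂(cellMeasure ℓ), 0 < sep.combine (ρmac x) (ρmic y)

variable {d : ℕ}

/-- The two-scale coefficient `G(x, y)`. -/
def Medium.G (M : Medium d) (x y : Pt d) : ℝ := M.sep.combine (M.Gmac x) (M.Gmic y)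

/-- The two-scale coefficient `ρ(x, y)`. -/
def Medium.ρ (M : Medium d) (x y : Pt d) : ℝ := M.sep.combine (M.ρmac x) (M.ρmic y)

/-- `⟨F⟩(x) = ∫_Y F(x, y) dy`. -/
def avg (M : Medium d) (F : Pt d → Pt d → ℝ) (x : Pt d) : ℝ :=
  ∫ y, F x y ∂(cellMeasure M.ℓ)

/-- `⟨F φ⟩(x) = ∫_Y F(x, y) φ(y) dy`: the two-scale density `F` tested against `φ` in `y`. -/
def pair (M : Medium d) (F : Pt d → Pt d → ℝ) (φ : Pt d → ℝ) (x : Pt d) : ℝ :=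
  ∫ y, F x y * φ y ∂(cellMeasure M.ℓ)

/-- The weak fast divergence `∇_y · F` of a periodic vector density, tested against `φ`. That
`F` has no jump in its normal component, neither across interfaces nor across opposite faces
of `Y`, is part of an equation for this functional of the test function `φ`. -/
def divY (M : Medium d) (F : Fin d → Pt d → Pt d → ℝ) (φ : Pt d → ℝ) (x : Pt d) : ℝ :=
  -∑ i, pair M (F i) (pd i φ) x

/-- The slow divergence `∇_x · F`, tested against `φ` in `y`. -/
def divX (M : Medium d) (F : Fin d → Pt d → Pt d → ℝ) (φ : Pt d → ℝ) (x : Pt d) : ℝ :=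
  ∑ i, pd i (pair M (F i) φ) x

/-- The components of the second-order identity tensor. -/
def δ (i j : Fin d) : ℝ := if i = j then 1 else 0

/-! ### The two-scale wave equation -/

/-- `∇_y · (G ∇_y u)`, tested against `φ`. -/
def opYY (M : Medium d) (u : TwoScale M.ℓ) : (Pt d → ℝ) → Pt d → ℝ :=
  divY M fun i x y => M.G x y * dy i (u x) y

/-- `∇_x · (G ∇_y u) + ∇_y · (G ∇_x u)`, tested against `φ`. -/
def opXY (M : Medium d) (u : TwoScale M.ℓ) (φ : Pt d → ℝ) (x : Pt d) : ℝ :=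
  divX M (fun i x y => M.G x y * dy i (u x) y) φ x
    + divY M (fun i x y => M.G x y * val (pd i u x) y) φ x

/-- `ρ ω² u + ∇_x · (G ∇_x u)`, tested against `φ`. -/
def opXX (M : Medium d) (om : ℝ) (u : TwoScale M.ℓ) (φ : Pt d → ℝ) (x : Pt d) : ℝ :=
  om ^ 2 * pair M (fun x y => M.ρ x y * val (u x) y) φ x
    + divX M (fun i x y => M.G x y * val (pd i u x) y) φ x

/-- The coefficient of `ε ^ (n - 2)` obtained by inserting `u = ∑ ε ^ k u_k` into the two-scale
wave equation
`ε⁻² ∇_y·(G∇_y u) + ε⁻¹ [∇_x·(G∇_y u) + ∇_y·(G∇_x u)] + [ρω²u + ∇_x·(G∇_x u)] = 0`. -/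
def orderCoeff (M : Medium d) (om : ℝ) (u : ℕ → TwoScale M.ℓ) (n : ℕ)
    (φ : Pt d → ℝ) (x : Pt d) : ℝ :=
  opYY M (u n) φ x
    + (if 1 ≤ n then opXY M (u (n - 1)) φ x else 0)
    + (if 2 ≤ n then opXX M om (u (n - 2)) φ x else 0)

/-- The ansatz `u = ∑ ε ^ k u_k`, with `u_k` smooth in `x`, solves the two-scale wave equation
formally, at the orders `ε⁻², …, ε²`. -/
structure IsExpansion (M : Medium d) (om : ℝ) (u : ℕ → TwoScale M.ℓ) : Prop where
  smooth : ∀ n ≤ 4, ContDiff ℝ ∞ (u n)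
  order_eq : ∀ n ≤ 4, ∀ φ, IsTest M.ℓ φ → ∀ x, orderCoeff M om u n φ x = 0

/-- The mean field `⟨u⟩(x)`. -/
def meanField (M : Medium d) (u : TwoScale M.ℓ) (x : Pt d) : ℝ := mean (u x)

/-! ### Cell functions and effective coefficients -/

/-- The components of the tensorial cell functions `P, Q, R, P̃, Q̃, R̃`. -/
structure CellFunctions (M : Medium d) where
  P : Fin d → TwoScale M.ℓ
  Q : Fin d → Fin d → TwoScale M.ℓ
  R : Fin d → Fin d → Fin d → TwoScale M.ℓ
  Ptil : Fin d → TwoScale M.ℓ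
  Qtil : Fin d → Fin d → TwoScale M.ℓ
  Rtil : Fin d → TwoScale M.ℓ

namespace CellFunctions

variable {M : Medium d} (C : CellFunctions M)

/-- `G (I₂ + ∇_y P)`. -/
def fluxP (i j : Fin d) (x y : Pt d) : ℝ :=
  M.G x y * (δ i j + dy i (C.P j x) y)

/-- `G (I₂ ⊗ P + ∇_y Q)`. -/
def fluxQ (i j k : Fin d) (x y : Pt d) : ℝ :=
  M.G x y * (δ i j * val (C.P k x) y + dy i (C.Q j k x) y)

/-- `G (∇_x P + ∇_y P̃)`. -/
def fluxPt (i j : Fin d) (x y : Pt d) : ℝ :=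
  M.G x y * (val (pd i (C.P j) x) y + dy i (C.Ptil j x) y)

/-- `G (I₂ ⊗ Q + ∇_y R)`. -/
def fluxR (i j k l : Fin d) (x y : Pt d) : ℝ :=
  M.G x y * (δ i j * val (C.Q k l x) y + dy i (C.R j k l x) y)

/-- `G (∇_x Q + I₂ ⊗ P̃ + ∇_y Q̃)`. -/
def fluxQt (i j k : Fin d) (x y : Pt d) : ℝ :=
  M.G x y * (val (pd i (C.Q j k) x) y + δ i j * val (C.Ptil k x) y + dy i (C.Qtil j k x) y)

/-- `G (∇_x P̃ + ∇_y R̃)`. -/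
def fluxRt (i j : Fin d) (x y : Pt d) : ℝ :=
  M.G x y * (val (pd i (C.Ptil j) x) y + dy i (C.Rtil j x) y)

/-- `μ⁽⁰⁾ = ⟨G (I₂ + ∇_y P)⟩`. -/
def mu0 (i j : Fin d) : Pt d → ℝ := avg M (C.fluxP i j)

/-- `μ⁽¹⁾ = ⟨G (I₂ ⊗ P + ∇_y Q)⟩`. -/
def mu1 (i j k : Fin d) : Pt d → ℝ := avg M (C.fluxQ i j k)

/-- `μ⁽²⁾ = ⟨G (I₂ ⊗ Q + ∇_y R)⟩`. -/
def mu2 (i j k l : Fin d) : Pt d → ℝ := avg M (C.fluxR i j k l)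

/-- `ϱ⁽¹⁾ = ⟨ρ P⟩`. -/
def rho1 (j : Fin d) : Pt d → ℝ := avg M fun x y => M.ρ x y * val (C.P j x) y

/-- `ϱ⁽²⁾ = ⟨ρ Q⟩`. -/
def rho2 (j k : Fin d) : Pt d → ℝ := avg M fun x y => M.ρ x y * val (C.Q j k x) y

/-- `ϱ̃⁽²⁾ = ⟨ρ P̃⟩`. -/
def rho2t (j : Fin d) : Pt d → ℝ := avg M fun x y => M.ρ x y * val (C.Ptil j x) y

/-- `η = ⟨G (∇_x P + ∇_y P̃)⟩`. -/
def eta (i j : Fin d) : Pt d → ℝ := avg M (C.fluxPt i j)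

/-- `φ = ⟨G (∇_x P̃ + ∇_y R̃)⟩`. -/
def phi (i j : Fin d) : Pt d → ℝ := avg M (C.fluxRt i j)

/-- `ψ = ⟨G (∇_x Q + I₂ ⊗ P̃ + ∇_y Q̃)⟩`. -/
def psi (i j k : Fin d) : Pt d → ℝ := avg M (C.fluxQt i j k)

end CellFunctions

/-- `ϱ⁽⁰⁾ = ⟨ρ⟩`. -/
def Medium.rho0 (M : Medium d) : Pt d → ℝ := avg M M.ρ

namespace CellFunctions

variable {M : Medium d} (C : CellFunctions M)

/-- `∇ · μ⁽⁰⁾`; divergences contract with the first index. -/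
def divMu0 (j : Fin d) (x : Pt d) : ℝ := ∑ i, pd i (C.mu0 i j) x

/-- `∇ · μ⁽¹⁾`. -/
def divMu1 (j k : Fin d) (x : Pt d) : ℝ := ∑ i, pd i (C.mu1 i j k) x

/-- `∇ · μ⁽²⁾`. -/
def divMu2 (j k l : Fin d) (x : Pt d) : ℝ := ∑ i, pd i (C.mu2 i j k l) x

/-- `∇ · η`. -/
def divEta (j : Fin d) (x : Pt d) : ℝ := ∑ i, pd i (C.eta i j) x

/-- `∇ · φ`. -/
def divPhi (j : Fin d) (x : Pt d) : ℝ := ∑ i, pd i (C.phi i j) x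

/-- `∇ · ψ`. -/
def divPsi (j k : Fin d) (x : Pt d) : ℝ := ∑ i, pd i (C.psi i j k) x

/-- `ρ (P - ϱ⁽¹⁾ / ϱ⁽⁰⁾)`. -/
def source (j : Fin d) (x y : Pt d) : ℝ :=
  M.ρ x y * (val (C.P j x) y - C.rho1 j x / M.rho0 x)

/-- The cell functions are smooth in `x`, have zero mean in `y`, and solve the periodic cell
problems, in weak form on the cell of periodicity. -/
structure Solves : Prop where
  smooth_P : ∀ j, ContDiff ℝ ∞ (C.P j)
  smooth_Q : ∀ j k, ContDiff ℝ ∞ (C.Q j k)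
  smooth_R : ∀ j k l, ContDiff ℝ ∞ (C.R j k l)
  smooth_Pt : ∀ j, ContDiff ℝ ∞ (C.Ptil j)
  smooth_Qt : ∀ j k, ContDiff ℝ ∞ (C.Qtil j k)
  smooth_Rt : ∀ j, ContDiff ℝ ∞ (C.Rtil j)
  mean_P : ∀ j x, mean (C.P j x) = 0
  mean_Q : ∀ j k x, mean (C.Q j k x) = 0
  mean_R : ∀ j k l x, mean (C.R j k l x) = 0
  mean_Pt : ∀ j x, mean (C.Ptil j x) = 0
  mean_Qt : ∀ j k x, mean (C.Qtil j k x) = 0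
  mean_Rt : ∀ j x, mean (C.Rtil j x) = 0
  /-- `∇_y·[G(I₂ + ∇_y P)] = 0`. -/
  eq_P : ∀ φ, IsTest M.ℓ φ → ∀ x j,
    divY M (fun i => C.fluxP i j) φ x = 0
  /-- `∇_y·[G(I₂⊗P + ∇_y Q)] = (ρ/ϱ⁽⁰⁾) μ⁽⁰⁾ - G(I₂ + ∇_y P)`. -/
  eq_Q : ∀ φ, IsTest M.ℓ φ → ∀ x j k,
    divY M (fun i => C.fluxQ i j k) φ x =
      pair M M.ρ φ x / M.rho0 x * C.mu0 j k x - pair M (C.fluxP j k) φ x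
  /-- `∇_y·[G(∇_x P + ∇_y P̃)] = (ρ/ϱ⁽⁰⁾) ∇·μ⁽⁰⁾ - ∇_x·[G(I₂ + ∇_y P)]`. -/
  eq_Pt : ∀ φ, IsTest M.ℓ φ → ∀ x j,
    divY M (fun i => C.fluxPt i j) φ x =
      pair M M.ρ φ x / M.rho0 x * C.divMu0 j x - divX M (fun i => C.fluxP i j) φ x
  /-- `∇_y·[G(I₂⊗P̃ + ∇_x Q + ∇_y Q̃)] = (ρ/ϱ⁽⁰⁾)(η + ∇·μ⁽¹⁾) - ∇_x·[G(I₂⊗P + ∇_y Q)]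
  - G(∇_x P + ∇_y P̃) + s ⊗ (∇·μ⁽⁰⁾)/ϱ⁽⁰⁾ + s · ∇[μ⁽⁰⁾/ϱ⁽⁰⁾]`, `s = ρ(P - ϱ⁽¹⁾/ϱ⁽⁰⁾)`. -/
  eq_Qt : ∀ φ, IsTest M.ℓ φ → ∀ x j k,
    divY M (fun i => C.fluxQt i j k) φ x =
      pair M M.ρ φ x / M.rho0 x * (C.eta j k x + C.divMu1 j k x)
        - divX M (fun i => C.fluxQ i j k) φ x - pair M (C.fluxPt j k) φ x
        + pair M (C.source j) φ x * (C.divMu0 k x / M.rho0 x)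
        + ∑ m, pair M (C.source m) φ x * pd m (fun z => C.mu0 j k z / M.rho0 z) x
  /-- `∇_y·[G(I₂⊗Q + ∇_y R)] = (ρ/ϱ⁽⁰⁾) μ⁽¹⁾ - G(I₂⊗P + ∇_y Q) + (μ⁽⁰⁾/ϱ⁽⁰⁾) ⊗ s`. -/
  eq_R : ∀ φ, IsTest M.ℓ φ → ∀ x j k l,
    divY M (fun i => C.fluxR i j k l) φ x =
      pair M M.ρ φ x / M.rho0 x * C.mu1 j k l x - pair M (C.fluxQ j k l) φ x
        + C.mu0 j k x / M.rho0 x * pair M (C.source l) φ x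
  /-- `∇_y·[G(∇_x P̃ + ∇_y R̃)] = (ρ/ϱ⁽⁰⁾) ∇·η - ∇_x·[G(∇_x P + ∇_y P̃)] + s · ∇[∇·μ⁽⁰⁾/ϱ⁽⁰⁾]`. -/
  eq_Rt : ∀ φ, IsTest M.ℓ φ → ∀ x j,
    divY M (fun i => C.fluxRt i j) φ x =
      pair M M.ρ φ x / M.rho0 x * C.divEta j x - divX M (fun i => C.fluxPt i j) φ x
        + ∑ m, pair M (C.source m) φ x * pd m (fun z => C.divMu0 j z / M.rho0 z) x

/-- All effective coefficients are smooth functions of `x`. -/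
structure SmoothCoefficients : Prop where
  rho0 : ContDiff ℝ ∞ M.rho0
  rho1 : ∀ j, ContDiff ℝ ∞ (C.rho1 j)
  rho2 : ∀ j k, ContDiff ℝ ∞ (C.rho2 j k)
  rho2t : ∀ j, ContDiff ℝ ∞ (C.rho2t j)
  mu0 : ∀ i j, ContDiff ℝ ∞ (C.mu0 i j)
  mu1 : ∀ i j k, ContDiff ℝ ∞ (C.mu1 i j k)
  mu2 : ∀ i j k l, ContDiff ℝ ∞ (C.mu2 i j k l)
  eta : ∀ i j, ContDiff ℝ ∞ (C.eta i j)
  phi : ∀ i j, ContDiff ℝ ∞ (C.phi i j)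
  psi : ∀ i j k, ContDiff ℝ ∞ (C.psi i j k)

/-- `∇·[μ⁽⁰⁾·∇v] + ϱ⁽⁰⁾ ω² v`. -/
def op0 (om : ℝ) (v : Pt d → ℝ) (x : Pt d) : ℝ :=
  ∑ i, pd i (fun z => ∑ j, C.mu0 i j z * pd j v z) x + M.rho0 x * om ^ 2 * v x

/-- `[∇·η + ϱ⁽¹⁾ω²]·∇v + [η + ∇·μ⁽¹⁾]:∇∇v + μ⁽¹⁾:∇∇∇v`. -/
def op1 (om : ℝ) (v : Pt d → ℝ) (x : Pt d) : ℝ :=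
  ∑ j, (C.divEta j x + C.rho1 j x * om ^ 2) * pd j v x
    + ∑ j, ∑ k, (C.eta j k x + C.divMu1 j k x) * pd j (pd k v) x
    + ∑ j, ∑ k, ∑ l, C.mu1 j k l x * pd j (pd k (pd l v)) x

/-- `[∇·φ + ϱ̃⁽²⁾ω²]·∇v + [∇·ψ + φ + ϱ⁽²⁾ω²]:∇∇v + [ψ + ∇·μ⁽²⁾]:∇∇∇v + μ⁽²⁾:∇∇∇∇v`. -/
def op2 (om : ℝ) (v : Pt d → ℝ) (x : Pt d) : ℝ :=
  ∑ j, (C.divPhi j x + C.rho2t j x * om ^ 2) * pd j v x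
    + ∑ j, ∑ k, (C.divPsi j k x + C.phi j k x + C.rho2 j k x * om ^ 2) * pd j (pd k v) x
    + ∑ j, ∑ k, ∑ l, (C.psi j k l x + C.divMu2 j k l x) * pd j (pd k (pd l v)) x
    + ∑ j, ∑ k, ∑ l, ∑ m, C.mu2 j k l m x * pd j (pd k (pd l (pd m v))) x

/-- `u₀ = ⟨u₀⟩`, `u₁ = ⟨u₁⟩ + P·∇⟨u₀⟩`,
`u₂ = ⟨u₂⟩ + P·∇⟨u₁⟩ + Q:∇∇⟨u₀⟩ + P̃·∇⟨u₀⟩` and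
`u₃ = ⟨u₃⟩ + P·∇⟨u₂⟩ + P̃·∇⟨u₁⟩ + Q:∇∇⟨u₁⟩ + R̃·∇⟨u₀⟩ + Q̃:∇∇⟨u₀⟩ + R:∇∇∇⟨u₀⟩`. -/
structure Represents (u : ℕ → TwoScale M.ℓ) : Prop where
  repr0 : ∀ x, ∀ᵐ y ∂(cellMeasure M.ℓ), val (u 0 x) y = meanField M (u 0) x
  repr1 : ∀ x, ∀ᵐ y ∂(cellMeasure M.ℓ), val (u 1 x) y =
    meanField M (u 1) x + ∑ j, val (C.P j x) y * pd j (meanField M (u 0)) x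
  repr2 : ∀ x, ∀ᵐ y ∂(cellMeasure M.ℓ), val (u 2 x) y =
    meanField M (u 2) x + ∑ j, val (C.P j x) y * pd j (meanField M (u 1)) x
      + ∑ j, ∑ k, val (C.Q j k x) y * pd j (pd k (meanField M (u 0))) x
      + ∑ j, val (C.Ptil j x) y * pd j (meanField M (u 0)) x
  repr3 : ∀ x, ∀ᵐ y ∂(cellMeasure M.ℓ), val (u 3 x) y =
    meanField M (u 3) x + ∑ j, val (C.P j x) y * pd j (meanField M (u 2)) x
      + ∑ j, val (C.Ptil j x) y * pd j (meanField M (u 1)) x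
      + ∑ j, ∑ k, val (C.Q j k x) y * pd j (pd k (meanField M (u 1))) x
      + ∑ j, val (C.Rtil j x) y * pd j (meanField M (u 0)) x
      + ∑ j, ∑ k, val (C.Qtil j k x) y * pd j (pd k (meanField M (u 0))) x
      + ∑ j, ∑ k, ∑ l, val (C.R j k l x) y * pd j (pd k (pd l (meanField M (u 0)))) x

end CellFunctions

/-- `U ε = v₀ + ε v₁ + ε² v₂ + O(ε³)` as `ε → 0⁺`, uniformly on `K` and together with the
derivatives up to the fourth order. -/
def HasSecondOrderExpansion (K : Set (Pt d)) (v : ℕ → Pt d → ℝ) (U : ℝ → Pt d → ℝ) : Prop :=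
  ∃ A : ℝ, ∀ᶠ ε in 𝓝[>] (0 : ℝ), ContDiff ℝ 4 (U ε) ∧ ∀ x ∈ K, ∀ m ≤ 4,
    ‖iteratedFDeriv ℝ m (fun z => U ε z - ∑ k ∈ Finset.range 3, ε ^ k * v k z) x‖ ≤ A * ε ^ 3

end QuasiPeriodic

end

/-! The two-scale equation is a recursion of periodic elliptic problems in `y` with `x` as a
parameter. At every order the new unknown `w` satisfies `∇_y·[G(f + ∇_y w)] = g` with `f` and `g`
already known. Such a problem is solvable exactly when `g` has zero mean, and its solution is unique
up to a constant in `y`. Uniqueness identifies `u₁`, `u₂`, `u₃` with the stated combinations of cell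
functions (`expansion_one`, `expansion_two`, `expansion_three`); the zero-mean condition at the
orders two, three and four is the hierarchy for `L₀`, `L₁`, `L₂` (`mean_two`, `mean_three`,
`mean_four`).

The elliptic theory rests on Fourier series. Parseval on the cell gives the Poincaré inequality
`exists_poincare`, so the gradients form a closed subspace of `L²(Y)^d` with a continuous potential
map. Multiplication by `G`, compressed to that subspace, is coercive, hence invertible by
Lax–Milgram, and this solves the cell problem (`weakDiv_solveCell`). Smoothness in `x` comes from
the separation of scales: `G(x, ·)` depends on `x` only through a scalar, so the multiplication
operator is smooth in operator norm however rough the microstructure is, and inversion of operators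
is smooth (`contDiff_solveCell`). For uniqueness the solution itself must be admissible as a test
function, which `WeakDiv.sum_inner_dyL_eq_zero` provides. The six cell problems form a triangular
system whose data have zero mean by the very definition of the effective coefficients.

The algebra is done for an arbitrary smooth macroscopic field `v`. It generates correctors `corr1`,
`corr2`, `corr3` and fluxes `flux1`, `flux2`, `flux3`, and the cell equations collapse to equations
whose sources are slow divergences with a multiple of `ρ` subtracted (`source2_eq`, `source3_eq`).
In the third-order equation there remains a term `s·∇(⟨div1 v⟩/ϱ⁽⁰⁾)`. For `v = ⟨u₀⟩` the equation
`L₀⟨u₀⟩ = 0` turns the quotient into `-ω²⟨u₀⟩`, and this term becomes the inertia of the corrector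
`P·∇⟨u₀⟩` (`source_three`).

The effective equation then follows by linearity: the three operators are bounded on compact sets by
derivatives up to order four, the orders `1`, `ε`, `ε²` cancel by the hierarchy, and what is left is
`O(ε³)`. -/

noncomputable section

namespace QuasiPeriodic

variable {d : ℕ} {ℓ : Fin d → ℝ}

/-! ### Fourier series on the cell -/

section Fourier

/-- The normalised measure on `ℝ / ℤ`. -/
abbrev circleMeasureSpace : MeasureSpace UnitAddCircle := ⟨AddCircle.haarAddCircle⟩

attribute [local instance] circleMeasureSpace

/-- The torus unrolled onto the cell. -/
def torusSection (ℓ : Fin d → ℝ) (z : UnitAddTorus (Fin d)) : Pt d :=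
  WithLp.toLp 2 fun i => ℓ i * (AddCircle.equivIoc 1 0 (z i)).1

lemma cell_ae_eq_pi_Ioc (ℓ : Fin d → ℝ) :
    ((WithLp.toLp 2 : (Fin d → ℝ) → Pt d) ⁻¹' cell ℓ : Set (Fin d → ℝ))
      =ᵐ[volume] Set.pi univ fun i => Ioc 0 (ℓ i) := by
  have h : ((WithLp.toLp 2 : (Fin d → ℝ) → Pt d) ⁻¹' cell ℓ : Set (Fin d → ℝ))
      = Set.pi univ fun i => Ioo 0 (ℓ i) := by
    ext x; simp [cell]
  rw [h]
  exact Measure.pi_Ioo_ae_eq_pi_Ioc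

/-- The Jacobian of the scaling is `∏ ℓ_j`; the normalisation `|Y| = 1` removes it. -/
lemma measurePreserving_scale (hvol : ∏ j, ℓ j = 1) :
    MeasurePreserving (fun (x : Fin d → ℝ) i => ℓ i * x i) volume volume := by
  refine ⟨by fun_prop, ?_⟩
  have h := Real.smul_map_diagonal_volume_pi (D := ℓ) (by
    rw [Matrix.det_diagonal, hvol]; norm_num)
  rw [Matrix.det_diagonal, hvol, abs_one, ENNReal.ofReal_one, one_smul] at h
  have e : (fun (x : Fin d → ℝ) i => ℓ i * x i) = Matrix.toLin' (Matrix.diagonal ℓ) := by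
    funext x i
    simp [Matrix.mulVec_diagonal]
  rw [e, h]

/-- The map is a composite of measure-preserving ones: the torus to the half-open unit box, the box
to its image under the scaling, and the identification with Euclidean space. The faces that
distinguish the half-open box from the open cell are null. -/
lemma measurePreserving_torusSection (hpos : ∀ j, 0 < ℓ j) (hvol : ∏ j, ℓ j = 1) :
    MeasurePreserving (torusSection ℓ) volume (cellMeasure ℓ) := by
  have hm : MeasurableSet {x : Fin d → ℝ | ∀ i, x i ∈ Ioc (0 : ℝ) (0 + 1)} :=
    MeasurableSet.univ_pi' fun i => measurableSet_Ioc
  have h1 := UnitAddTorus.measurePreserving_equivPiIoc (d := Fin d) (fun _ => 0)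
  have h2 := measurePreserving_subtype_coe (μa := (volume : Measure (Fin d → ℝ))) hm
  have hbox : (fun (x : Fin d → ℝ) i => ℓ i * x i) ⁻¹' (Set.pi univ fun i => Ioc 0 (ℓ i))
      = {x : Fin d → ℝ | ∀ i, x i ∈ Ioc (0 : ℝ) (0 + 1)} := by
    ext x
    simp only [mem_preimage, Set.mem_pi, mem_univ, forall_const, mem_Ioc, mem_ofPred_eq, zero_add]
    refine forall_congr' fun i => ?_
    have := hpos i
    constructor
    · rintro ⟨h1, h2⟩
      exact ⟨by nlinarith, by nlinarith⟩
    · rintro ⟨h1, h2⟩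
      exact ⟨by positivity, by nlinarith⟩
  have h3 := (measurePreserving_scale hvol).restrict_preimage
    (s := Set.pi univ fun i => Ioc 0 (ℓ i)) (MeasurableSet.univ_pi fun i => measurableSet_Ioc)
  rw [hbox] at h3
  have h4 := (PiLp.volume_preserving_toLp (Fin d)).restrict_preimage (measurableSet_cell ℓ)
  rw [Measure.restrict_congr_set (cell_ae_eq_pi_Ioc ℓ)] at h4
  exact ((h4.comp h3).comp h2).comp h1

lemma integral_torusSection (hpos : ∀ j, 0 < ℓ j) (hvol : ∏ j, ℓ j = 1) {E : Type*}
    [NormedAddCommGroup E] [NormedSpace ℝ E] {g : Pt d → E}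
    (hg : AEStronglyMeasurable g (cellMeasure ℓ)) :
    ∫ t, g (torusSection ℓ t) = ∫ y, g y ∂(cellMeasure ℓ) := by
  have hS := measurePreserving_torusSection hpos hvol
  rw [← hS.map_eq] at hg ⊢
  exact (integral_map hS.measurable.aemeasurable hg).symm

/-- The phase `2π ∑ n_j y_j / ℓ_j`. -/
def phase (ℓ : Fin d → ℝ) (n : Fin d → ℤ) (y : Pt d) : ℝ :=
  ∑ j, 2 * Real.pi * n j / ℓ j * y j

lemma mFourier_torus (hpos : ∀ j, 0 < ℓ j) (n : Fin d → ℤ) (z : UnitAddTorus (Fin d)) :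
    UnitAddTorus.mFourier n z = Complex.exp (phase ℓ n (torusSection ℓ z) * Complex.I) := by
  change ∏ i, fourier (n i) (z i) = _
  have h : ∀ i, z i = (((AddCircle.equivIoc 1 0 (z i)).1 : ℝ) : UnitAddCircle) := fun i =>
    ((AddCircle.equivIoc 1 0).symm_apply_apply (z i)).symm
  have h2 : ∀ i, fourier (n i) (z i)
      = Complex.exp (2 * Real.pi * n i / ℓ i * torusSection ℓ z i * Complex.I) := by
    intro i
    conv_lhs => rw [h i]
    rw [fourier_coe_apply]
    congr 1
    have := (hpos i).ne'
    have : (ℓ i : ℂ) ≠ 0 := by exact_mod_cast this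
    simp only [torusSection]
    push_cast
    field_simp
  rw [Finset.prod_congr rfl fun i _ => h2 i, ← Complex.exp_sum]
  congr 1
  rw [phase]
  push_cast
  rw [Finset.sum_mul]

lemma continuous_phase (ℓ : Fin d → ℝ) (n : Fin d → ℤ) : Continuous (phase ℓ n) := by
  unfold phase
  fun_prop

/-- Parseval's identity on the cell. -/
lemma hasSum_sq_fourier (hpos : ∀ j, 0 < ℓ j) (hvol : ∏ j, ℓ j = 1) (f : L2 ℓ) :
    HasSum (fun n : Fin d → ℤ => (∫ y, f y * Real.cos (phase ℓ n y) ∂(cellMeasure ℓ)) ^ 2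
      + (∫ y, f y * Real.sin (phase ℓ n y) ∂(cellMeasure ℓ)) ^ 2) (‖f‖ ^ 2) := by
  have hS := measurePreserving_torusSection hpos hvol
  have hf : MemLp (fun y => (f y : ℂ)) 2 (cellMeasure ℓ) := (Lp.memLp f).ofReal
  have hF := hf.comp_measurePreserving hS
  have key := UnitAddTorus.hasSum_sq_mFourierCoeff hF.toLp
  have hae := hF.coeFn_toLp
  have e1 : ∫ t, ‖hF.toLp _ t‖ ^ 2 = ‖f‖ ^ 2 := by
    have : ∫ t, ‖hF.toLp _ t‖ ^ 2 = ∫ t, (fun y => f y ^ 2) (torusSection ℓ t) := by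
      apply integral_congr_ae
      filter_upwards [hae] with t ht
      rw [ht]
      simp
    rw [this, integral_torusSection hpos hvol (g := fun y => f y ^ 2)
      ((Lp.aestronglyMeasurable f).pow 2), ← real_inner_self_eq_norm_sq, L2.inner_def]
    simp [sq]
  rw [e1] at key
  convert key using 2 with n
  -- The `n`-th coefficient pairs with the character of index `-n`, whence the minus sign. For a
  -- real function the two integrals are real, and the squared modulus is the sum of their squares.
  have e2 : UnitAddTorus.mFourierCoeff (hF.toLp _) n
      = ∫ y, ((f y * Real.cos (phase ℓ n y) : ℝ) : ℂ)
          - ((f y * Real.sin (phase ℓ n y) : ℝ) : ℂ) * Complex.I ∂(cellMeasure ℓ) := by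
    have : UnitAddTorus.mFourierCoeff (hF.toLp _) n
      = ∫ t, (fun y => ((f y * Real.cos (phase ℓ n y) : ℝ) : ℂ)
          - ((f y * Real.sin (phase ℓ n y) : ℝ) : ℂ) * Complex.I) (torusSection ℓ t) := by
      apply integral_congr_ae
      filter_upwards [hae] with t ht
      rw [ht, UnitAddTorus.mFourier_neg, mFourier_torus hpos, ← Complex.exp_conj]
      simp only [map_mul, Complex.conj_ofReal, Complex.conj_I, smul_eq_mul, Function.comp]
      rw [mul_neg, ← neg_mul, Complex.exp_mul_I, Complex.cos_neg, Complex.sin_neg]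
      push_cast
      ring
    rw [this]
    have h1 := (Lp.aestronglyMeasurable f).mul
      ((Real.continuous_cos.comp (continuous_phase ℓ n)).aestronglyMeasurable (μ := cellMeasure ℓ))
    have h2 := (Lp.aestronglyMeasurable f).mul
      ((Real.continuous_sin.comp (continuous_phase ℓ n)).aestronglyMeasurable (μ := cellMeasure ℓ))
    exact integral_torusSection hpos hvol <|
      (Complex.continuous_ofReal.comp_aestronglyMeasurable h1).sub
      ((Complex.continuous_ofReal.comp_aestronglyMeasurable h2).mul aestronglyMeasurable_const)
  have i1 := integrable_mul_of_continuous f (Real.continuous_cos.comp (continuous_phase ℓ n))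
  have i2 := integrable_mul_of_continuous f (Real.continuous_sin.comp (continuous_phase ℓ n))
  simp only [Function.comp] at i1 i2
  rw [e2, integral_sub i1.ofReal (i2.ofReal.mul_const _), integral_mul_const,
    integral_complex_ofReal, integral_complex_ofReal, Complex.sq_norm, Complex.normSq_apply]
  simp
  ring

end Fourier

/-! ### Integration by parts -/

lemma integral_cell (g : Pt d → ℝ) :
    ∫ y, g y ∂(cellMeasure ℓ) = ∫ x in Icc 0 ℓ, g (WithLp.toLp 2 x) := by
  have h := (PiLp.volume_preserving_toLp (Fin d)).setIntegral_preimage_emb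
    (MeasurableEquiv.toLp 2 (Fin d → ℝ)).measurableEmbedding g (cell ℓ)
  rw [← h]
  refine setIntegral_congr_set ?_
  refine (cell_ae_eq_pi_Ioc ℓ).trans ?_
  exact Measure.univ_pi_Ioc_ae_eq_Icc

/-- Divergence theorem on the box for the field whose only nonzero component is the `i`-th, equal to
`f`: the two faces orthogonal to direction `i` contribute opposite amounts by periodicity. -/
lemma integral_pd_eq_zero (hpos : ∀ j, 0 < ℓ j) {f : Pt d → ℝ} (hf : IsTest ℓ f) (i : Fin d) :
    ∫ y, pd i f y ∂(cellMeasure ℓ) = 0 := by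
  rw [integral_cell]
  -- The divergence theorem lives in dimension `n + 1`; in dimension zero there is no index `i`.
  obtain _ | n := d
  · exact i.elim0
  set T : (Fin (n + 1) → ℝ) →L[ℝ] Pt (n + 1) :=
    ((EuclideanSpace.equiv (Fin (n + 1)) ℝ).symm : (Fin (n + 1) → ℝ) →L[ℝ] Pt (n + 1)) with hT
  have hTa : ∀ x, T x = WithLp.toLp 2 x := fun x => rfl
  have hd : ∀ x, HasFDerivAt (fun x => f (T x)) ((fderiv ℝ f (T x)).comp T) x := fun x =>
    ((hf.smooth.differentiable (by simp) (T x)).hasFDerivAt).comp x T.hasFDerivAt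
  have hc := hf.continuous_pd i
  have hfc : Continuous f := hf.smooth.continuous
  have h := integral_divergence_of_hasFDerivAt_off_countable' 0 ℓ (fun j => (hpos j).le)
    (fun j x => if j = i then f (T x) else 0)
    (fun j x => if j = i then (fderiv ℝ f (T x)).comp T else 0) ∅ countable_empty
    (by
      intro j
      split_ifs
      · exact (hfc.comp T.continuous).continuousOn
      · exact continuousOn_const)
    (by
      intro x _ j
      split_ifs
      · exact hd x
      · exact hasFDerivAt_const _ _)
    (by
      refine Continuous.integrableOn_Icc ?_
      refine continuous_finsetSum _ fun j _ => ?_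
      split_ifs with hj
      · subst hj
        exact hc.comp T.continuous
      · exact continuous_const)
  have h1 : ∀ x, pd i f (WithLp.toLp 2 x) = ∑ j, (if j = i then (fderiv ℝ f (T x)).comp T else 0)
      (Pi.single j 1) := by
    intro x
    rw [Finset.sum_eq_single i]
    · simp [pd, hT]
    · intro j _ hj; simp [hj]
    · simp
  simp_rw [h1]
  rw [h]
  refine Finset.sum_eq_zero fun j _ => ?_
  by_cases hj : j = i
  · subst hj
    simp only [if_true, sub_eq_zero]
    refine integral_congr_ae (Eventually.of_forall fun x => ?_)
    -- A point of the face at `0`, shifted by one period, is the corresponding point of the face at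
    -- `ℓ j`.
    have := hf.periodic (T (j.insertNth 0 x)) j
    simp only [Pi.zero_apply]
    rw [← this]
    congr 1
    rw [hTa, hTa]
    ext k
    refine Fin.succAboveCases j ?_ (fun k => ?_) k
    · simp
    · simp
  · simp [hj]

/-! ### The spaces `L²(Y)` and `H¹_per(Y)` -/

open scoped RealInnerProductSpace

lemma memLp_of_continuous {ψ : Pt d → ℝ} (hψ : Continuous ψ) : MemLp ψ 2 (cellMeasure ℓ) := by
  obtain ⟨B, hB⟩ := (isCompact_closedBall (0 : Pt d)
    (Real.sqrt (∑ j, ℓ j ^ 2))).exists_bound_of_continuousOn hψ.continuousOn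
  refine MemLp.of_bound hψ.aestronglyMeasurable B ?_
  filter_upwards [ae_restrict_mem (measurableSet_cell ℓ)] with y hy
  exact hB y (cell_subset_closedBall ℓ hy)

open scoped Classical in
/-- The class of a function in `L²(Y)`, or `0` if it is not square integrable. -/
def toL2 (ℓ : Fin d → ℝ) (ψ : Pt d → ℝ) : L2 ℓ :=
  if h : MemLp ψ 2 (cellMeasure ℓ) then h.toLp else 0

lemma coeFn_toL2 {ψ : Pt d → ℝ} (hψ : MemLp ψ 2 (cellMeasure ℓ)) :
    toL2 ℓ ψ =ᵐ[cellMeasure ℓ] ψ := by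
  rw [toL2, dif_pos hψ]
  exact hψ.coeFn_toLp

/-- This turns every weak formulation into an identity between inner products in `L²(Y)`, where
linearity and continuity are immediate. -/
lemma inner_toL2 {ψ : Pt d → ℝ} (hψ : Continuous ψ) (f : L2 ℓ) :
    ⟪toL2 ℓ ψ, f⟫ = ∫ y, f y * ψ y ∂(cellMeasure ℓ) := by
  rw [L2.inner_def]
  apply integral_congr_ae
  filter_upwards [coeFn_toL2 (ℓ := ℓ) (memLp_of_continuous hψ)] with y hy
  rw [hy]
  simp

lemma mem_H1per_iff {w : L2 ℓ × (Fin d → L2 ℓ)} : w ∈ H1per ℓ ↔ ∀ φ, IsTest ℓ φ → ∀ i,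
    ⟪toL2 ℓ (pd i φ), w.1⟫ = -⟪toL2 ℓ φ, w.2 i⟫ := by
  refine forall_congr' fun φ => forall_congr' fun hφ => forall_congr' fun i => ?_
  rw [inner_toL2 (hφ.continuous_pd i), inner_toL2 hφ.smooth.continuous]

/-- The defining conditions equate continuous functionals, so they cut out a closed subspace of a
complete space. -/
instance : CompleteSpace (H1per ℓ) := by
  suffices h : IsClosed (H1per ℓ : Set (L2 ℓ × (Fin d → L2 ℓ))) from h.completeSpace_coe
  have : (H1per ℓ : Set (L2 ℓ × (Fin d → L2 ℓ))) = {w | ∀ φ, IsTest ℓ φ → ∀ i,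
    ⟪toL2 ℓ (pd i φ), w.1⟫ = -⟪toL2 ℓ φ, w.2 i⟫} := by
    ext w
    exact mem_H1per_iff
  rw [this]
  simp only [ofPred_forall]
  refine isClosed_iInter fun φ => isClosed_iInter fun _ => isClosed_iInter fun i => ?_
  refine isClosed_eq ?_ ?_ <;> fun_prop

/-- The function underlying an element of `H¹_per(Y)`, as a continuous linear map. -/
def valL : H1per ℓ →L[ℝ] L2 ℓ :=
  (ContinuousLinearMap.fst ℝ (L2 ℓ) (Fin d → L2 ℓ)).comp (H1per ℓ).subtypeL

/-- The weak partial derivative as a continuous linear map. -/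
def dyL (i : Fin d) : H1per ℓ →L[ℝ] L2 ℓ :=
  ((ContinuousLinearMap.proj i).comp
    (ContinuousLinearMap.snd ℝ (L2 ℓ) (Fin d → L2 ℓ))).comp (H1per ℓ).subtypeL

lemma valL_apply (w : H1per ℓ) : valL w = val w := rfl

lemma inner_pd_valL {φ : Pt d → ℝ} (hφ : IsTest ℓ φ) (i : Fin d) (w : H1per ℓ) :
    ⟪toL2 ℓ (pd i φ), valL w⟫ = -⟪toL2 ℓ φ, dyL i w⟫ :=
  mem_H1per_iff.1 w.2 φ hφ i

/-- The constant function `1`. -/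
def oneL2 (ℓ : Fin d → ℝ) : L2 ℓ := toL2 ℓ fun _ => 1

/-- The mean over the cell as a continuous linear functional on `L²(Y)`. -/
def meanL (ℓ : Fin d → ℝ) : L2 ℓ →L[ℝ] ℝ := innerSL ℝ (oneL2 ℓ)

lemma coeFn_oneL2 : oneL2 ℓ =ᵐ[cellMeasure ℓ] fun _ => (1 : ℝ) :=
  coeFn_toL2 (memLp_of_continuous continuous_const)

lemma meanL_apply (f : L2 ℓ) : meanL ℓ f = ∫ y, f y ∂(cellMeasure ℓ) := by
  change ⟪oneL2 ℓ, f⟫ = _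
  rw [oneL2, inner_toL2 continuous_const]
  simp

lemma inner_oneL2 (f : L2 ℓ) : ⟪oneL2 ℓ, f⟫ = meanL ℓ f := rfl

lemma mean_eq (w : H1per ℓ) : mean w = meanL ℓ (valL w) := (meanL_apply _).symm

lemma volume_cell (hpos : ∀ j, 0 < ℓ j) (hvol : ∏ j, ℓ j = 1) : volume (cell ℓ) = 1 := by
  rw [← (PiLp.volume_preserving_toLp (Fin d)).measure_preimage
    (measurableSet_cell ℓ).nullMeasurableSet, measure_congr (cell_ae_eq_pi_Ioc ℓ),
    Real.volume_pi_Ioc]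
  simp only [sub_zero]
  rw [← ENNReal.ofReal_prod_of_nonneg fun i _ => (hpos i).le, hvol, ENNReal.ofReal_one]

lemma meanL_one (hpos : ∀ j, 0 < ℓ j) (hvol : ∏ j, ℓ j = 1) : meanL ℓ (oneL2 ℓ) = 1 := by
  rw [meanL_apply, integral_congr_ae coeFn_oneL2, integral_const, Measure.real,
    Measure.restrict_apply_univ, volume_cell hpos hvol]
  simp

lemma isTest_const (c : ℝ) : IsTest ℓ (fun _ => c) :=
  ⟨contDiff_const, fun _ _ => rfl⟩

lemma pd_const {F : Type*} [NormedAddCommGroup F] [NormedSpace ℝ F] (i : Fin d) (c : F) :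
    pd i (fun _ => c) = fun _ : Pt d => (0 : F) := by
  funext x
  simp [pd]

lemma toL2_zero : toL2 ℓ (fun _ => 0) = 0 := by
  refine Lp.ext ((coeFn_toL2 (memLp_of_continuous continuous_const)).trans ?_)
  exact (Lp.coeFn_zero _ _ _).symm

lemma IsTest.mul {φ ψ : Pt d → ℝ} (hφ : IsTest ℓ φ) (hψ : IsTest ℓ ψ) :
    IsTest ℓ (fun y => φ y * ψ y) :=
  ⟨hφ.smooth.mul hψ.smooth, fun y j => by simp only [hφ.periodic y j, hψ.periodic y j]⟩

lemma pd_mul {φ ψ : Pt d → ℝ} (hφ : ContDiff ℝ 1 φ) (hψ : ContDiff ℝ 1 ψ) (i : Fin d) (y : Pt d) :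
    pd i (fun z => φ z * ψ z) y = φ y * pd i ψ y + ψ y * pd i φ y := by
  have h := ((hφ.differentiable (by simp) y).hasFDerivAt.mul
    (hψ.differentiable (by simp) y).hasFDerivAt).fderiv
  simp only [pd]
  rw [show (fun z => φ z * ψ z) = φ * ψ from rfl, h]
  simp

/-- A test function as an element of `H¹_per(Y)`. -/
def testH1 (hpos : ∀ j, 0 < ℓ j) {φ : Pt d → ℝ} (hφ : IsTest ℓ φ) : H1per ℓ :=
  ⟨(toL2 ℓ φ, fun i => toL2 ℓ (pd i φ)), by
    rw [mem_H1per_iff]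
    intro ψ hψ i
    simp only
    -- Integration by parts for smooth periodic functions: the derivative of the product `φ ψ` has
    -- zero integral over the cell.
    rw [inner_toL2 (hψ.continuous_pd i), inner_toL2 hψ.smooth.continuous, ← sub_eq_zero,
      sub_neg_eq_add, ← integral_add (integrable_mul_of_continuous _ (hψ.continuous_pd i))
        (integrable_mul_of_continuous _ hψ.smooth.continuous),
      ← integral_pd_eq_zero hpos (hφ.mul hψ) i]
    apply integral_congr_ae
    filter_upwards [coeFn_toL2 (ℓ := ℓ) (memLp_of_continuous (hφ.continuous_pd i)),
      coeFn_toL2 (ℓ := ℓ) (memLp_of_continuous hφ.smooth.continuous)] with y h1 h2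
    rw [h1, h2, pd_mul (hφ.smooth.of_le (by simp)) (hψ.smooth.of_le (by simp))]
    ring⟩

lemma valL_testH1 (hpos : ∀ j, 0 < ℓ j) {φ : Pt d → ℝ} (hφ : IsTest ℓ φ) :
    valL (testH1 hpos hφ) = toL2 ℓ φ := rfl

lemma dyL_testH1 (hpos : ∀ j, 0 < ℓ j) {φ : Pt d → ℝ} (hφ : IsTest ℓ φ) (i : Fin d) :
    dyL i (testH1 hpos hφ) = toL2 ℓ (pd i φ) := rfl

/-- The constant function `1` as an element of `H¹_per(Y)`. -/
def oneH1 (hpos : ∀ j, 0 < ℓ j) : H1per ℓ := testH1 hpos (isTest_const 1)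

lemma valL_oneH1 (hpos : ∀ j, 0 < ℓ j) : valL (oneH1 hpos) = oneL2 ℓ := rfl

lemma dyL_oneH1 (hpos : ∀ j, 0 < ℓ j) (i : Fin d) : dyL i (oneH1 hpos) = 0 := by
  rw [oneH1, dyL_testH1, pd_const, toL2_zero]

/-! ### The trigonometric system and the Poincaré inequality -/

lemma contDiff_phase (n : Fin d → ℤ) : ContDiff ℝ ∞ (phase ℓ n) := by
  unfold phase
  fun_prop

lemma pd_phase (n : Fin d → ℤ) (i : Fin d) (y : Pt d) :
    pd i (phase ℓ n) y = 2 * Real.pi * n i / ℓ i := by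
  have h : HasFDerivAt (phase ℓ n)
      (∑ j, (2 * Real.pi * n j / ℓ j) • (EuclideanSpace.proj j : Pt d →L[ℝ] ℝ)) y := by
    unfold phase
    refine HasFDerivAt.fun_sum fun j _ => ?_
    exact ((EuclideanSpace.proj j : Pt d →L[ℝ] ℝ).hasFDerivAt).const_mul _
  rw [pd, h.fderiv]
  simp

lemma phase_add_period (hpos : ∀ j, 0 < ℓ j) (n : Fin d → ℤ) (y : Pt d) (j : Fin d) :
    phase ℓ n (y + EuclideanSpace.single j (ℓ j)) = phase ℓ n y + n j * (2 * Real.pi) := by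
  have h : ∀ k, 2 * Real.pi * n k / ℓ k * (y + EuclideanSpace.single j (ℓ j)) k
      = 2 * Real.pi * n k / ℓ k * y k + if k = j then n k * (2 * Real.pi) else 0 := by
    intro k
    have := (hpos k).ne'
    by_cases hk : k = j
    · subst hk
      simp
      field_simp
    · simp [hk]
  simp only [phase]
  rw [Finset.sum_congr rfl fun k _ => h k, Finset.sum_add_distrib]
  simp

lemma isTest_cos (hpos : ∀ j, 0 < ℓ j) (n : Fin d → ℤ) :
    IsTest ℓ (fun y => Real.cos (phase ℓ n y)) :=
  ⟨(contDiff_phase n).cos, fun y j => by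
    rw [phase_add_period hpos, Real.cos_add_int_mul_two_pi]⟩

lemma isTest_sin (hpos : ∀ j, 0 < ℓ j) (n : Fin d → ℤ) :
    IsTest ℓ (fun y => Real.sin (phase ℓ n y)) :=
  ⟨(contDiff_phase n).sin, fun y j => by
    rw [phase_add_period hpos, Real.sin_add_int_mul_two_pi]⟩

/-- The class of `cos (phase n)`. -/
def cosL (ℓ : Fin d → ℝ) (n : Fin d → ℤ) : L2 ℓ := toL2 ℓ fun y => Real.cos (phase ℓ n y)

/-- The class of `sin (phase n)`. -/
def sinL (ℓ : Fin d → ℝ) (n : Fin d → ℤ) : L2 ℓ := toL2 ℓ fun y => Real.sin (phase ℓ n y)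

lemma toL2_smul {ψ : Pt d → ℝ} (hψ : Continuous ψ) (c : ℝ) :
    toL2 ℓ (fun y => c * ψ y) = c • toL2 ℓ ψ := by
  refine Lp.ext ((coeFn_toL2 (memLp_of_continuous (continuous_const.mul hψ))).trans ?_)
  filter_upwards [coeFn_toL2 (ℓ := ℓ) (memLp_of_continuous hψ),
    Lp.coeFn_smul c (toL2 ℓ ψ)] with y h1 h2
  rw [h2, Pi.smul_apply, h1, smul_eq_mul, Pi.mul_apply]

lemma toL2_pd_cos (n : Fin d → ℤ) (i : Fin d) :
    toL2 ℓ (pd i fun y => Real.cos (phase ℓ n y)) = -(2 * Real.pi * n i / ℓ i) • sinL ℓ n := by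
  rw [sinL, ← toL2_smul (ψ := fun y => Real.sin (phase ℓ n y))
    (Real.continuous_sin.comp (continuous_phase ℓ n))]
  congr 1
  funext y
  have h := (((contDiff_phase (ℓ := ℓ) n).differentiable (by simp) y).hasFDerivAt.cos).fderiv
  rw [pd, h, ← pd_phase (ℓ := ℓ) n i y, pd]
  simp
  ring

lemma toL2_pd_sin (n : Fin d → ℤ) (i : Fin d) :
    toL2 ℓ (pd i fun y => Real.sin (phase ℓ n y)) = (2 * Real.pi * n i / ℓ i) • cosL ℓ n := by
  rw [cosL, ← toL2_smul (ψ := fun y => Real.cos (phase ℓ n y))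
    (Real.continuous_cos.comp (continuous_phase ℓ n))]
  congr 1
  funext y
  have h := (((contDiff_phase (ℓ := ℓ) n).differentiable (by simp) y).hasFDerivAt.sin).fderiv
  rw [pd, h, ← pd_phase (ℓ := ℓ) n i y, pd]
  simp
  ring

/-- The trigonometric functions are admissible in the definition of the weak derivative, so
differentiation acts on Fourier coefficients as a multiplier that exchanges sines and cosines. -/
lemma inner_cosL_dyL (hpos : ∀ j, 0 < ℓ j) (n : Fin d → ℤ) (i : Fin d) (w : H1per ℓ) :
    ⟪cosL ℓ n, dyL i w⟫ = 2 * Real.pi * n i / ℓ i * ⟪sinL ℓ n, valL w⟫ := by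
  have h := inner_pd_valL (isTest_cos hpos n) i w
  rw [toL2_pd_cos, real_inner_smul_left] at h
  change _ = -⟪cosL ℓ n, dyL i w⟫ at h
  linarith

lemma inner_sinL_dyL (hpos : ∀ j, 0 < ℓ j) (n : Fin d → ℤ) (i : Fin d) (w : H1per ℓ) :
    ⟪sinL ℓ n, dyL i w⟫ = -(2 * Real.pi * n i / ℓ i * ⟪cosL ℓ n, valL w⟫) := by
  have h := inner_pd_valL (isTest_sin hpos n) i w
  rw [toL2_pd_sin, real_inner_smul_left] at h
  change _ = -⟪sinL ℓ n, dyL i w⟫ at h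
  linarith

lemma hasSum_sq_inner (hpos : ∀ j, 0 < ℓ j) (hvol : ∏ j, ℓ j = 1) (f : L2 ℓ) :
    HasSum (fun n : Fin d → ℤ => ⟪cosL ℓ n, f⟫ ^ 2 + ⟪sinL ℓ n, f⟫ ^ 2) (‖f‖ ^ 2) := by
  convert hasSum_sq_fourier hpos hvol f using 4 with n
  · exact inner_toL2 (Real.continuous_cos.comp (continuous_phase ℓ n)) f
  · exact inner_toL2 (Real.continuous_sin.comp (continuous_phase ℓ n)) f

lemma cosL_zero : cosL ℓ 0 = oneL2 ℓ := by
  simp [cosL, oneL2, phase]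

lemma sinL_zero : sinL ℓ 0 = 0 := by
  simp [sinL, phase, toL2_zero]

/-- Compare the two Parseval sums mode by mode. The zero mode vanishes with the mean, and every
other integer frequency has some `n i ^ 2 ≥ 1`. -/
lemma exists_poincare (hpos : ∀ j, 0 < ℓ j) (hvol : ∏ j, ℓ j = 1) :
    ∃ c : ℝ, 0 ≤ c ∧ ∀ w : H1per ℓ, meanL ℓ (valL w) = 0 →
      ‖valL w‖ ^ 2 ≤ c * ∑ i, ‖dyL i w‖ ^ 2 := by
  -- These weights turn the multiplier `(2π n_i / ℓ_i)²` into `n_i²`.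
  set a : Fin d → ℝ := fun i => (ℓ i / (2 * Real.pi)) ^ 2 with ha
  have ha0 : ∀ i, 0 ≤ a i := fun i => sq_nonneg _
  refine ⟨∑ i, a i, Finset.sum_nonneg fun i _ => ha0 i, fun w hw => ?_⟩
  have h1 := hasSum_sq_inner hpos hvol (valL w)
  have h2 : HasSum (fun n => ∑ i, a i * (⟪cosL ℓ n, dyL i w⟫ ^ 2 + ⟪sinL ℓ n, dyL i w⟫ ^ 2))
      (∑ i, a i * ‖dyL i w‖ ^ 2) :=
    hasSum_sum fun i _ => (hasSum_sq_inner hpos hvol (dyL i w)).mul_left _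
  refine (hasSum_le (fun n => ?_) h1 h2).trans ?_
  · have h3 : ∀ i, a i * (⟪cosL ℓ n, dyL i w⟫ ^ 2 + ⟪sinL ℓ n, dyL i w⟫ ^ 2)
        = (n i : ℝ) ^ 2 * (⟪cosL ℓ n, valL w⟫ ^ 2 + ⟪sinL ℓ n, valL w⟫ ^ 2) := by
      intro i
      rw [inner_cosL_dyL hpos, inner_sinL_dyL hpos, ha]
      have := (hpos i).ne'
      have := Real.pi_pos.ne'
      field_simp
      ring
    by_cases hn : n = 0
    · subst hn
      rw [cosL_zero, sinL_zero, inner_oneL2, hw]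
      simp only [inner_zero_left]
      simp only [ne_eq, OfNat.ofNat_ne_zero, not_false_eq_true, zero_pow, add_zero]
      exact Finset.sum_nonneg fun i _ => by have := ha0 i; positivity
    · obtain ⟨i, hi⟩ := Function.ne_iff.1 hn
      rw [Finset.sum_congr rfl fun i _ => h3 i, ← Finset.sum_mul]
      refine le_mul_of_one_le_left (by positivity) ?_
      have h4 : (1 : ℝ) ≤ (n i : ℝ) ^ 2 := by
        have : (1 : ℤ) ≤ n i ^ 2 := Int.add_one_le_iff.2 (sq_pos_of_ne_zero hi)
        exact_mod_cast this
      exact h4.trans (Finset.single_le_sum (f := fun i => (n i : ℝ) ^ 2)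
        (fun i _ => sq_nonneg _) (Finset.mem_univ i))
  · rw [Finset.mul_sum]
    refine Finset.sum_le_sum fun i _ => ?_
    exact mul_le_mul_of_nonneg_right
      (Finset.single_le_sum (fun i _ => ha0 i) (Finset.mem_univ i)) (sq_nonneg _)

/-! ### The periodic elliptic problem -/

/-- The weak equation `∇_y · F = g` on the cell of periodicity. -/
def WeakDiv (F : Fin d → L2 ℓ) (g : L2 ℓ) : Prop :=
  ∀ φ, IsTest ℓ φ → -∑ i, ⟪toL2 ℓ (pd i φ), F i⟫ = ⟪toL2 ℓ φ, g⟫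

lemma WeakDiv.congr {F F' : Fin d → L2 ℓ} {g g' : L2 ℓ} (h : WeakDiv F g)
    (hF : ∀ i, F i = F' i) (hg : g = g') : WeakDiv F' g' := by
  rw [← hg, ← funext hF]
  exact h

lemma WeakDiv.add {F F' : Fin d → L2 ℓ} {g g' : L2 ℓ} (h : WeakDiv F g) (h' : WeakDiv F' g') :
    WeakDiv (fun i => F i + F' i) (g + g') := by
  intro φ hφ
  simp only [inner_add_right, Finset.sum_add_distrib, neg_add, h φ hφ, h' φ hφ]

lemma WeakDiv.smul {F : Fin d → L2 ℓ} {g : L2 ℓ} (c : ℝ) (h : WeakDiv F g) :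
    WeakDiv (fun i => c • F i) (c • g) := by
  intro φ hφ
  simp only [inner_smul_right, ← Finset.mul_sum, ← h φ hφ, mul_neg]

lemma WeakDiv.sub {F F' : Fin d → L2 ℓ} {g g' : L2 ℓ} (h : WeakDiv F g) (h' : WeakDiv F' g') :
    WeakDiv (fun i => F i - F' i) (g - g') := by
  refine (h.add (h'.smul (-1))).congr (fun i => ?_) ?_ <;> module

lemma WeakDiv.sum {ι : Type*} (s : Finset ι) {F : ι → Fin d → L2 ℓ} {g : ι → L2 ℓ}
    (h : ∀ k ∈ s, WeakDiv (F k) (g k)) : WeakDiv (fun i => ∑ k ∈ s, F k i) (∑ k ∈ s, g k) := by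
  intro φ hφ
  simp only [inner_sum]
  rw [Finset.sum_comm, ← Finset.sum_neg_distrib]
  exact Finset.sum_congr rfl fun k hk => h k hk φ hφ

/-- Test with the constant `1`, whose gradient vanishes. This solvability condition is the source of
all the mean-field equations. -/
lemma WeakDiv.meanL_eq_zero {F : Fin d → L2 ℓ} {g : L2 ℓ} (h : WeakDiv F g) : meanL ℓ g = 0 := by
  have := h (fun _ => 1) (isTest_const 1)
  simp only [pd_const, toL2_zero, inner_zero_left, Finset.sum_const_zero, neg_zero] at this
  exact this.symm

/-- The space `L²(Y)^d`. -/
abbrev L2Vec (ℓ : Fin d → ℝ) : Type := PiLp 2 fun _ : Fin d => L2 ℓ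

/-- The weak gradient. -/
def gradL : H1per ℓ →L[ℝ] L2Vec ℓ :=
  ((PiLp.continuousLinearEquiv 2 ℝ fun _ : Fin d => L2 ℓ).symm :
    (Fin d → L2 ℓ) →L[ℝ] L2Vec ℓ).comp (ContinuousLinearMap.pi dyL)

@[simp]
lemma gradL_apply (w : H1per ℓ) (i : Fin d) : gradL w i = dyL i w := rfl

/-- The elements of `H¹_per(Y)` with zero mean. -/
def H1zero (ℓ : Fin d → ℝ) : Submodule ℝ (H1per ℓ) :=
  ((meanL ℓ).comp valL).ker

lemma mem_H1zero {w : H1per ℓ} : w ∈ H1zero ℓ ↔ meanL ℓ (valL w) = 0 := Iff.rfl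

instance : NormedAddCommGroup (H1zero ℓ) := Submodule.normedAddCommGroup _

instance : NormedSpace ℝ (H1zero ℓ) := Submodule.normedSpace _

instance : CompleteSpace (H1zero ℓ) :=
  (ContinuousLinearMap.isClosed_ker ((meanL ℓ).comp valL)).completeSpace_coe

/-- The weak gradient on the space of functions with zero mean. -/
def gradZero (ℓ : Fin d → ℝ) : H1zero ℓ →L[ℝ] L2Vec ℓ := gradL.comp (H1zero ℓ).subtypeL

/-! ### Operators bounded from below -/

section BoundedBelow

variable {E F : Type*} [NormedAddCommGroup E] [NormedSpace ℝ E]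
  [NormedAddCommGroup F] [NormedSpace ℝ F]

lemma antilipschitz_of_norm_le {f : E →L[ℝ] F} {c : ℝ} (h : ∀ w, ‖w‖ ≤ c * ‖f w‖) :
    AntilipschitzWith c.toNNReal f :=
  f.antilipschitz_of_bound fun w => (h w).trans
    (mul_le_mul_of_nonneg_right (Real.le_coe_toNNReal c) (norm_nonneg _))

lemma completeSpace_range_of_norm_le [CompleteSpace E] [CompleteSpace F] {f : E →L[ℝ] F} {c : ℝ} (h : ∀ w, ‖w‖ ≤ c * ‖f w‖) :
    CompleteSpace f.range :=
  have hc : IsClosed (f.range : Set F) :=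
    (antilipschitz_of_norm_le h).isClosed_range f.uniformContinuous
  hc.completeSpace_coe

/-- An operator bounded from below is injective with closed range, so the open mapping theorem gives
a continuous inverse on the range. -/
lemma exists_inverse_of_norm_le [CompleteSpace E] [CompleteSpace F] {f : E →L[ℝ] F} {c : ℝ}
    (h : ∀ w, ‖w‖ ≤ c * ‖f w‖) : ∃ J : f.range →L[ℝ] E, ∀ p, f (J p) = p := by
  have h1 := antilipschitz_of_norm_le h
  have h2 : IsClosed (range f) := h1.isClosed_range f.uniformContinuous
  refine ⟨(f.equivRange h1.injective h2).symm.toContinuousLinearMap, fun p => ?_⟩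
  exact congrArg Subtype.val ((f.equivRange h1.injective h2).apply_symm_apply p)

end BoundedBelow

lemma exists_norm_le_gradZero (hpos : ∀ j, 0 < ℓ j) (hvol : ∏ j, ℓ j = 1) :
    ∃ c, ∀ w, ‖w‖ ≤ c * ‖gradZero ℓ w‖ := by
  obtain ⟨c, hc, h⟩ := exists_poincare hpos hvol
  refine ⟨Real.sqrt c + 1, fun w => ?_⟩
  have hn : ‖gradZero ℓ w‖ ^ 2 = ∑ i, ‖dyL i (w : H1per ℓ)‖ ^ 2 := by
    rw [PiLp.norm_sq_eq_of_L2]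
    rfl
  have hs := Real.sqrt_nonneg c
  have h1 : ‖valL (w : H1per ℓ)‖ ≤ Real.sqrt c * ‖gradZero ℓ w‖ := by
    refine (sq_le_sq₀ (norm_nonneg _) (by positivity)).1 ?_
    rw [mul_pow, Real.sq_sqrt hc, hn]
    exact h _ w.2
  have h2 : ∀ i, ‖dyL i (w : H1per ℓ)‖ ≤ ‖gradZero ℓ w‖ := fun i =>
    PiLp.norm_apply_le (gradZero ℓ w) i
  -- The norm is the maximum norm of the product, so the function and its gradient are estimated
  -- separately, the former by Poincaré.
  have h3 : ‖w‖ = max ‖valL (w : H1per ℓ)‖ ‖fun i => dyL i (w : H1per ℓ)‖ := rfl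
  rw [h3]
  refine max_le ?_ ?_
  · nlinarith [norm_nonneg (gradZero ℓ w)]
  · refine (pi_norm_le_iff_of_nonneg (by positivity)).2 fun i => (h2 i).trans ?_
    nlinarith [norm_nonneg (gradZero ℓ w)]

/-- The space of weak gradients of periodic functions. -/
abbrev GradSpace (ℓ : Fin d → ℝ) : Submodule ℝ (L2Vec ℓ) := (gradZero ℓ).range

lemma injective_gradZero (hpos : ∀ j, 0 < ℓ j) (hvol : ∏ j, ℓ j = 1) :
    Function.Injective (gradZero ℓ) := by
  obtain ⟨c, hc⟩ := exists_norm_le_gradZero hpos hvol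
  exact (antilipschitz_of_norm_le (E := H1zero ℓ) (F := L2Vec ℓ) (f := gradZero ℓ) hc).injective

lemma completeSpace_gradSpace (hpos : ∀ j, 0 < ℓ j) (hvol : ∏ j, ℓ j = 1) :
    CompleteSpace (GradSpace ℓ) := by
  obtain ⟨c, hc⟩ := exists_norm_le_gradZero hpos hvol
  exact completeSpace_range_of_norm_le (E := H1zero ℓ) (F := L2Vec ℓ) (f := gradZero ℓ) hc

lemma exists_potential (hpos : ∀ j, 0 < ℓ j) (hvol : ∏ j, ℓ j = 1) :
    ∃ J : GradSpace ℓ →L[ℝ] H1zero ℓ, ∀ p, gradZero ℓ (J p) = p := by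
  obtain ⟨c, hc⟩ := exists_norm_le_gradZero hpos hvol
  exact exists_inverse_of_norm_le (E := H1zero ℓ) (F := L2Vec ℓ) (f := gradZero ℓ) hc

/-- The periodic potential with zero mean of a gradient field. -/
def potential (hpos : ∀ j, 0 < ℓ j) (hvol : ∏ j, ℓ j = 1) : GradSpace ℓ →L[ℝ] H1per ℓ :=
  (H1zero ℓ).subtypeL.comp (exists_potential hpos hvol).choose

lemma meanL_potential (hpos : ∀ j, 0 < ℓ j) (hvol : ∏ j, ℓ j = 1) (p : GradSpace ℓ) :
    meanL ℓ (valL (potential hpos hvol p)) = 0 :=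
  ((exists_potential hpos hvol).choose p).2

lemma gradL_potential (hpos : ∀ j, 0 < ℓ j) (hvol : ∏ j, ℓ j = 1) (p : GradSpace ℓ) :
    gradL (potential hpos hvol p) = p :=
  (exists_potential hpos hvol).choose_spec p

lemma dyL_potential (hpos : ∀ j, 0 < ℓ j) (hvol : ∏ j, ℓ j = 1) (p : GradSpace ℓ) (i : Fin d) :
    dyL i (potential hpos hvol p) = (p : L2Vec ℓ) i :=
  congrArg (fun q : L2Vec ℓ => q i) (gradL_potential hpos hvol p)

/-- Subtraction of the mean. -/
def centre (hpos : ∀ j, 0 < ℓ j) (w : H1per ℓ) : H1per ℓ := w - meanL ℓ (valL w) • oneH1 hpos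

lemma meanL_centre (hpos : ∀ j, 0 < ℓ j) (hvol : ∏ j, ℓ j = 1) (w : H1per ℓ) :
    meanL ℓ (valL (centre hpos w)) = 0 := by
  simp [centre, valL_oneH1, meanL_one hpos hvol]

lemma dyL_centre (hpos : ∀ j, 0 < ℓ j) (w : H1per ℓ) (i : Fin d) :
    dyL i (centre hpos w) = dyL i w := by
  simp [centre, dyL_oneH1]

lemma eq_of_dyL_eq (hpos : ∀ j, 0 < ℓ j) (hvol : ∏ j, ℓ j = 1) {v w : H1per ℓ}
    (h : ∀ i, dyL i v = dyL i w) (hm : meanL ℓ (valL v) = meanL ℓ (valL w)) : v = w := by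
  have h0 : v - w ∈ H1zero ℓ := by
    rw [mem_H1zero, map_sub, map_sub, hm, sub_self]
  have h1 : gradZero ℓ ⟨v - w, h0⟩ = gradZero ℓ 0 := by
    ext1 i
    change dyL i (v - w) = dyL i 0
    simp [h]
  have := congrArg Subtype.val (injective_gradZero hpos hvol h1)
  exact sub_eq_zero.1 this

lemma eq_const_of_dyL_eq_zero (hpos : ∀ j, 0 < ℓ j) (hvol : ∏ j, ℓ j = 1) {w : H1per ℓ}
    (h : ∀ i, dyL i w = 0) : w = meanL ℓ (valL w) • oneH1 hpos := by
  refine eq_of_dyL_eq hpos hvol (fun i => ?_) ?_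
  · simp [h, dyL_oneH1]
  · simp [valL_oneH1, meanL_one hpos hvol]

/-- A divergence-free field is orthogonal to all periodic gradients. -/
lemma WeakDiv.sum_inner_dyL_eq_zero (hpos : ∀ j, 0 < ℓ j) (hvol : ∏ j, ℓ j = 1)
    {F : Fin d → L2 ℓ} (h : WeakDiv F 0) (v : H1per ℓ) : ∑ i, ⟪F i, dyL i v⟫ = 0 := by
  have := completeSpace_gradSpace hpos hvol
  -- The hypothesis speaks only of smooth test functions. Instead of a density argument, `F` is
  -- projected onto the gradients, and the potential `w` of the projection is shown to have a
  -- vanishing gradient: it is weakly harmonic against the trigonometric functions.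
  set f : L2Vec ℓ := WithLp.toLp 2 F with hf
  set p : GradSpace ℓ := (GradSpace ℓ).orthogonalProjectionOnto f with hp
  set w := potential hpos hvol p with hw
  have horth : ∀ v : H1per ℓ, ⟪(p : L2Vec ℓ), gradL v⟫ = ∑ i, ⟪F i, dyL i v⟫ := by
    intro v
    have hv : gradL v ∈ GradSpace ℓ := by
      refine ⟨⟨centre hpos v, meanL_centre hpos hvol v⟩, ?_⟩
      ext1 i
      exact dyL_centre hpos v i
    have h1 := Submodule.inner_orthogonalProjectionOnto_eq_of_mem_left ⟨gradL v, hv⟩ f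
    rw [real_inner_comm, hp]
    refine h1.trans ?_
    rw [real_inner_comm, PiLp.inner_apply]
    rfl
  have htest : ∀ φ, IsTest ℓ φ → ∑ i, ⟪toL2 ℓ (pd i φ), dyL i w⟫ = 0 := by
    intro φ hφ
    have h1 := h φ hφ
    rw [inner_zero_right, neg_eq_zero] at h1
    have h2 := horth (testH1 hpos hφ)
    rw [PiLp.inner_apply] at h2
    simp only [gradL_apply, dyL_testH1, ← dyL_potential hpos hvol] at h2
    rw [← h1, Finset.sum_congr rfl fun i _ => real_inner_comm (dyL i w) (toL2 ℓ (pd i φ)), h2]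
    exact Finset.sum_congr rfl fun i _ => real_inner_comm _ _
  have hk : ∀ n : Fin d → ℤ, n ≠ 0 → 0 < ∑ i, (2 * Real.pi * n i / ℓ i) ^ 2 := by
    intro n hn
    obtain ⟨i, hi⟩ := Function.ne_iff.1 hn
    refine Finset.sum_pos' (fun i _ => sq_nonneg _) ⟨i, Finset.mem_univ i, ?_⟩
    have h1 : (n i : ℝ) ≠ 0 := by exact_mod_cast hi
    have h2 := hpos i
    have := Real.pi_pos
    positivity
  -- Two integrations by parts against `cos (phase n)` produce `|k|² ⟪cos, w⟫ = 0`, where `k_i = 2π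
  -- n_i / ℓ_i`. For `n = 0` the coefficient is the mean, which is zero by the choice of potential.
  have hcos : ∀ n, ⟪cosL ℓ n, valL w⟫ = 0 := by
    intro n
    by_cases hn : n = 0
    · subst hn
      rw [cosL_zero]
      exact meanL_potential hpos hvol p
    · have h1 := htest _ (isTest_cos hpos n)
      simp only [toL2_pd_cos, inner_smul_left, inner_sinL_dyL hpos, RCLike.conj_to_real] at h1
      have h2 : (∑ i, (2 * Real.pi * n i / ℓ i) ^ 2) * ⟪cosL ℓ n, valL w⟫ = 0 := by
        rw [Finset.sum_mul, ← h1]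
        exact Finset.sum_congr rfl fun i _ => by ring
      exact (mul_eq_zero.1 h2).resolve_left (hk n hn).ne'
  have hsin : ∀ n, ⟪sinL ℓ n, valL w⟫ = 0 := by
    intro n
    by_cases hn : n = 0
    · subst hn
      rw [sinL_zero, inner_zero_left]
    · have h1 := htest _ (isTest_sin hpos n)
      simp only [toL2_pd_sin, inner_smul_left, inner_cosL_dyL hpos, RCLike.conj_to_real] at h1
      have h2 : (∑ i, (2 * Real.pi * n i / ℓ i) ^ 2) * ⟪sinL ℓ n, valL w⟫ = 0 := by
        rw [Finset.sum_mul, ← h1]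
        exact Finset.sum_congr rfl fun i _ => by ring
      exact (mul_eq_zero.1 h2).resolve_left (hk n hn).ne'
  -- The coefficients of `dyL i w` are multiples of those of `w`, so Parseval gives norm zero.
  have hnorm : ∀ i, dyL i w = 0 := by
    intro i
    have h1 := hasSum_sq_inner hpos hvol (dyL i w)
    simp only [inner_cosL_dyL hpos, inner_sinL_dyL hpos, hcos, hsin, mul_zero, neg_zero,
      ne_eq, OfNat.ofNat_ne_zero, not_false_eq_true, zero_pow, add_zero] at h1
    have := h1.unique hasSum_zero
    simpa using this
  have hp0 : (p : L2Vec ℓ) = 0 := by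
    ext1 i
    rw [← dyL_potential hpos hvol, hnorm]
    rfl
  rw [← horth, hp0, inner_zero_left]

/-- The inclusion of the `i`-th component. -/
def singleL (i : Fin d) : L2 ℓ →L[ℝ] L2Vec ℓ :=
  ((PiLp.continuousLinearEquiv 2 ℝ fun _ : Fin d => L2 ℓ).symm :
    (Fin d → L2 ℓ) →L[ℝ] L2Vec ℓ).comp (ContinuousLinearMap.single ℝ (fun _ : Fin d => L2 ℓ) i)

lemma inner_singleL (i : Fin d) (f : L2 ℓ) (p : L2Vec ℓ) : ⟪singleL i f, p⟫ = ⟪f, p i⟫ := by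
  rw [PiLp.inner_apply, Finset.sum_eq_single i]
  · simp [singleL]
  · intro j _ hj
    simp [singleL, hj]
  · simp

/-! ### Solution of the cell problem by projection and Lax–Milgram -/

section Solver

variable [CompleteSpace (GradSpace ℓ)]

/-- The projection of the field `f e_i` onto the gradients. -/
def projL (i : Fin d) : L2 ℓ →L[ℝ] GradSpace ℓ :=
  ((GradSpace ℓ).orthogonalProjectionOnto).comp (singleL i)

lemma inner_projL (i : Fin d) (f : L2 ℓ) (p : GradSpace ℓ) :
    ⟪projL i f, p⟫ = ⟪f, (p : L2Vec ℓ) i⟫ := by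
  rw [← inner_singleL, real_inner_comm, real_inner_comm (p : L2Vec ℓ)]
  exact Submodule.inner_orthogonalProjectionOnto_eq_of_mem_left p (singleL i f)

/-- The `i`-th component of a gradient. -/
def compL (i : Fin d) : GradSpace ℓ →L[ℝ] L2 ℓ :=
  (PiLp.proj 2 (fun _ : Fin d => L2 ℓ) i).comp (GradSpace ℓ).subtypeL

/-- The operator `p ↦ proj (m p)` on gradients, for a multiplication operator `m`. -/
def ellipticL (m : L2 ℓ →L[ℝ] L2 ℓ) : GradSpace ℓ →L[ℝ] GradSpace ℓ :=
  ∑ i, (projL i).comp (m.comp (compL i))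

lemma inner_ellipticL (m : L2 ℓ →L[ℝ] L2 ℓ) (p q : GradSpace ℓ) :
    ⟪ellipticL m p, q⟫ = ∑ i, ⟪m ((p : L2Vec ℓ) i), (q : L2Vec ℓ) i⟫ := by
  simp only [ellipticL, sum_apply, sum_inner]
  refine Finset.sum_congr rfl fun i _ => ?_
  exact inner_projL i _ q

/-- Uniform positivity of an operator on `L²(Y)`. -/
def Elliptic (m : L2 ℓ →L[ℝ] L2 ℓ) : Prop := ∃ c : ℝ, 0 < c ∧ ∀ f, c * ‖f‖ ^ 2 ≤ ⟪m f, f⟫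

/-- Lax–Milgram: the bilinear form of the compressed operator inherits the coercivity constant of
`m`, because the squared norm of a gradient is the sum over its components. -/
lemma isInvertible_ellipticL {m : L2 ℓ →L[ℝ] L2 ℓ} (hm : Elliptic m) :
    (ellipticL m).IsInvertible := by
  obtain ⟨c, hc, h⟩ := hm
  set B : GradSpace ℓ →L[ℝ] GradSpace ℓ →L[ℝ] ℝ := (innerSL ℝ).comp (ellipticL m) with hB
  have hBa : ∀ p q, B p q = ⟪ellipticL m p, q⟫ := fun p q => rfl
  have hco : IsCoercive B := by
    refine ⟨c, hc, fun p => ?_⟩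
    rw [hBa, inner_ellipticL, mul_assoc, ← sq]
    have h1 : ‖p‖ ^ 2 = ∑ i, ‖(p : L2Vec ℓ) i‖ ^ 2 := PiLp.norm_sq_eq_of_L2 _ (p : L2Vec ℓ)
    rw [h1, Finset.mul_sum]
    exact Finset.sum_le_sum fun i _ => h _
  refine ⟨hco.continuousLinearEquivOfBilin, ?_⟩
  ext1 p
  refine (hco.unique_continuousLinearEquivOfBilin fun q => ?_).symm
  rfl

/-- The solution with zero mean of `∇_y · m(f + ∇_y w) = g`. -/
def solveCell (hpos : ∀ j, 0 < ℓ j) (hvol : ∏ j, ℓ j = 1) (m : L2 ℓ →L[ℝ] L2 ℓ)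
    (f : Fin d → L2 ℓ) (g : L2 ℓ) : H1per ℓ :=
  -- The adjoint of `valL ∘ potential` represents the functional `p ↦ ⟪g, val (J p)⟫`, so that the
  -- source `g` becomes a vector in the space of gradients. An explicit formula, rather than a
  -- choice of solution for each `x`, makes the dependence on the data visible.
  potential hpos hvol ((ellipticL m).inverse
    (-∑ i, projL i (m (f i)) - (valL.comp (potential hpos hvol)).adjoint g))

end Solver

section Solver

variable [CompleteSpace (GradSpace ℓ)]

lemma meanL_solveCell (hpos : ∀ j, 0 < ℓ j) (hvol : ∏ j, ℓ j = 1) (m : L2 ℓ →L[ℝ] L2 ℓ)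
    (f : Fin d → L2 ℓ) (g : L2 ℓ) : meanL ℓ (valL (solveCell hpos hvol m f g)) = 0 :=
  meanL_potential hpos hvol _

/-- The variational identity in the space of gradients is tested against the gradient of `φ`. Its
zero-mean potential is `φ` minus a constant, and the constant is not seen by `g` because `g` has
zero mean. -/
lemma weakDiv_solveCell (hpos : ∀ j, 0 < ℓ j) (hvol : ∏ j, ℓ j = 1) {m : L2 ℓ →L[ℝ] L2 ℓ}
    (hm : Elliptic m) (f : Fin d → L2 ℓ) {g : L2 ℓ} (hg : meanL ℓ g = 0) :
    WeakDiv (fun i => m (f i + dyL i (solveCell hpos hvol m f g))) g := by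
  intro φ hφ
  set J := potential hpos hvol with hJ
  set r : GradSpace ℓ := -∑ i, projL i (m (f i)) - (valL.comp J).adjoint g with hr
  set p : GradSpace ℓ := (ellipticL m).inverse r with hp
  have hw : solveCell hpos hvol m f g = J p := rfl
  have hAp : ellipticL m p = r := by
    obtain ⟨e, he⟩ := isInvertible_ellipticL hm
    rw [hp, ← he, ContinuousLinearMap.inverse_equiv]
    exact e.apply_symm_apply r
  set v : H1per ℓ := centre hpos (testH1 hpos hφ) with hv
  set q : GradSpace ℓ := ⟨gradZero ℓ ⟨v, meanL_centre hpos hvol _⟩, ⟨_, rfl⟩⟩ with hq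
  have hqi : ∀ i, (q : L2Vec ℓ) i = toL2 ℓ (pd i φ) := fun i => dyL_centre hpos _ i
  have hJq : J q = v := by
    refine eq_of_dyL_eq hpos hvol (fun i => ?_) ?_
    · rw [hJ, dyL_potential, hqi, hv, dyL_centre, dyL_testH1]
    · rw [hJ, meanL_potential, hv, meanL_centre hpos hvol]
  have h1 := inner_ellipticL m p q
  rw [hAp, hr, inner_sub_left, inner_neg_left, sum_inner,
    ContinuousLinearMap.adjoint_inner_left] at h1
  simp only [inner_projL, hqi] at h1
  -- This is where the compatibility condition on `g` enters.
  have h2 : ⟪g, (valL.comp J) q⟫ = ⟪g, toL2 ℓ φ⟫ := by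
    rw [ContinuousLinearMap.comp_apply, hJq, hv, centre, map_sub, map_smul, valL_oneH1,
      valL_testH1, inner_sub_right, inner_smul_right, real_inner_comm (oneL2 ℓ), inner_oneL2, hg,
      mul_zero, sub_zero]
  rw [h2] at h1
  simp only [map_add, inner_add_right, Finset.sum_add_distrib, hw, hJ, dyL_potential]
  have h3 : ∀ i, ⟪toL2 ℓ (pd i φ), m (f i)⟫ = ⟪m (f i), toL2 ℓ (pd i φ)⟫ := fun i =>
    real_inner_comm _ _
  have h4 : ∀ i, ⟪toL2 ℓ (pd i φ), m ((p : L2Vec ℓ) i)⟫ = ⟪m ((p : L2Vec ℓ) i), toL2 ℓ (pd i φ)⟫ :=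
    fun i => real_inner_comm _ _
  simp only [h3, h4]
  rw [← h1, real_inner_comm g]
  ring

/-- Inversion is smooth at invertible operators, and the remaining ingredients of the formula are
fixed continuous linear maps. -/
lemma contDiff_solveCell (hpos : ∀ j, 0 < ℓ j) (hvol : ∏ j, ℓ j = 1)
    {m : Pt d → L2 ℓ →L[ℝ] L2 ℓ} (hm : ContDiff ℝ ∞ m) (hel : ∀ x, Elliptic (m x))
    {f : Fin d → Pt d → L2 ℓ} (hf : ∀ i, ContDiff ℝ ∞ (f i)) {g : Pt d → L2 ℓ}
    (hg : ContDiff ℝ ∞ g) :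
    ContDiff ℝ ∞ fun x => solveCell hpos hvol (m x) (fun i => f i x) (g x) := by
  have h1 : ContDiff ℝ ∞ fun x => ellipticL (m x) := by
    unfold ellipticL
    exact ContDiff.sum fun i _ => contDiff_const.clm_comp (hm.clm_comp contDiff_const)
  have h2 : ContDiff ℝ ∞ fun x => (ellipticL (m x)).inverse := by
    refine contDiff_iff_contDiffAt.2 fun x => ?_
    exact ((isInvertible_ellipticL (hel x)).contDiffAt_map_inverse).comp x h1.contDiffAt
  unfold solveCell
  refine (ContinuousLinearMap.contDiff _).comp (h2.clm_apply (ContDiff.sub (ContDiff.neg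
    (ContDiff.sum fun i _ => (ContinuousLinearMap.contDiff _).comp (hm.clm_apply (hf i))))
    ((ContinuousLinearMap.contDiff _).comp hg)))

end Solver

/-- By `WeakDiv.sum_inner_dyL_eq_zero` the equation may be tested with `w` itself; ellipticity then
kills the gradient. -/
lemma eq_const_of_weakDiv (hpos : ∀ j, 0 < ℓ j) (hvol : ∏ j, ℓ j = 1) {m : L2 ℓ →L[ℝ] L2 ℓ}
    (hm : Elliptic m) {w : H1per ℓ} (h : WeakDiv (fun i => m (dyL i w)) 0) :
    w = meanL ℓ (valL w) • oneH1 hpos := by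
  obtain ⟨c, hc, hm⟩ := hm
  refine eq_const_of_dyL_eq_zero hpos hvol fun i => ?_
  have h1 := h.sum_inner_dyL_eq_zero hpos hvol w
  have h2 : ∀ i, 0 ≤ ⟪m (dyL i w), dyL i w⟫ := fun i =>
    (mul_nonneg hc.le (sq_nonneg _)).trans (hm _)
  have h3 := (Finset.sum_eq_zero_iff_of_nonneg fun i _ => h2 i).1 h1 i (Finset.mem_univ i)
  have h4 := hm (dyL i w)
  rw [h3] at h4
  have h5 : ‖dyL i w‖ ^ 2 ≤ 0 := by
    by_contra! h6
    have := mul_pos hc h6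
    linarith
  have h6 : ‖dyL i w‖ = 0 := by
    have := le_antisymm h5 (sq_nonneg _)
    exact pow_eq_zero_iff (two_ne_zero) |>.1 this
  exact norm_eq_zero.1 h6

/-! ### The coefficients as multiplication operators -/

open scoped Classical ENNReal in
/-- Multiplication by a bounded function. -/
def mulOp (ℓ : Fin d → ℝ) (b : Pt d → ℝ) : L2 ℓ →L[ℝ] L2 ℓ :=
  if h : MemLp b ∞ (cellMeasure ℓ) then
    (ContinuousLinearMap.mul ℝ ℝ).holderL (cellMeasure ℓ) ∞ 2 2 h.toLp
  else 0

open scoped ENNReal in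
lemma coeFn_mulOp {b : Pt d → ℝ} (hb : MemLp b ∞ (cellMeasure ℓ)) (f : L2 ℓ) :
    mulOp ℓ b f =ᵐ[cellMeasure ℓ] fun y => b y * f y := by
  rw [mulOp, dif_pos hb]
  have h := (ContinuousLinearMap.mul ℝ ℝ).coeFn_holder (r := 2) hb.toLp f
  filter_upwards [h, hb.coeFn_toLp] with y h1 h2
  change (ContinuousLinearMap.mul ℝ ℝ).holder 2 hb.toLp f y = _
  rw [h1, h2]
  simp

/-- Multiplication by the combination of a macroscopic value and a microscopic coefficient. -/
def Separation.op (s : Separation) (ℓ : Fin d → ℝ) (a : ℝ) (b : Pt d → ℝ) : L2 ℓ →L[ℝ] L2 ℓ :=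
  match s with
  | .additive => a • ContinuousLinearMap.id ℝ (L2 ℓ) + mulOp ℓ b
  | .multiplicative => a • mulOp ℓ b

open scoped ENNReal in
lemma Separation.coeFn_op (s : Separation) (a : ℝ) {b : Pt d → ℝ}
    (hb : MemLp b ∞ (cellMeasure ℓ)) (f : L2 ℓ) :
    s.op ℓ a b f =ᵐ[cellMeasure ℓ] fun y => s.combine a (b y) * f y := by
  cases s with
  | additive =>
    filter_upwards [coeFn_mulOp hb f, Lp.coeFn_smul a f, Lp.coeFn_add (a • f) (mulOp ℓ b f)]
      with y h1 h2 h3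
    change (a • f + mulOp ℓ b f) y = (a + b y) * f y
    rw [h3, Pi.add_apply, h2, h1, Pi.smul_apply, smul_eq_mul]
    ring
  | multiplicative =>
    filter_upwards [coeFn_mulOp hb f, Lp.coeFn_smul a (mulOp ℓ b f)] with y h1 h2
    change (a • mulOp ℓ b f) y = (a * b y) * f y
    rw [h2, Pi.smul_apply, h1, smul_eq_mul]
    ring

/-- Here the separation of scales is used: `x` enters only through the scalar `a x`, so smoothness
in operator norm requires no regularity of `b`. -/
lemma Separation.contDiff_op (s : Separation) {a : Pt d → ℝ} (ha : ContDiff ℝ ∞ a)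
    (b : Pt d → ℝ) : ContDiff ℝ ∞ fun x => s.op ℓ (a x) b := by
  cases s with
  | additive => exact (ha.smul contDiff_const).add contDiff_const
  | multiplicative => exact ha.smul contDiff_const

/-! ### The coefficient operators of a medium -/

namespace Medium

variable (M : Medium d)

open scoped ENNReal in
lemma memLp_Gmic : MemLp M.Gmic ∞ (cellMeasure M.ℓ) := by
  obtain ⟨B, hB⟩ := M.Gmic_bounded
  exact memLp_top_of_bound M.Gmic_measurable.aestronglyMeasurable B hB

open scoped ENNReal in
lemma memLp_ρmic : MemLp M.ρmic ∞ (cellMeasure M.ℓ) := by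
  obtain ⟨B, hB⟩ := M.ρmic_bounded
  exact memLp_top_of_bound M.ρmic_measurable.aestronglyMeasurable B hB

/-- Multiplication by `G(x, ·)`. -/
def mulG (x : Pt d) : L2 M.ℓ →L[ℝ] L2 M.ℓ := M.sep.op M.ℓ (M.Gmac x) M.Gmic

/-- Multiplication by `ρ(x, ·)`. -/
def mulρ (x : Pt d) : L2 M.ℓ →L[ℝ] L2 M.ℓ := M.sep.op M.ℓ (M.ρmac x) M.ρmic

lemma coeFn_mulG (x : Pt d) (f : L2 M.ℓ) : M.mulG x f =ᵐ[cellMeasure M.ℓ] fun y => M.G x y * f y :=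
  M.sep.coeFn_op _ M.memLp_Gmic f

lemma coeFn_mulρ (x : Pt d) (f : L2 M.ℓ) : M.mulρ x f =ᵐ[cellMeasure M.ℓ] fun y => M.ρ x y * f y :=
  M.sep.coeFn_op _ M.memLp_ρmic f

lemma contDiff_mulG : ContDiff ℝ ∞ M.mulG := M.sep.contDiff_op M.Gmac_smooth _

lemma contDiff_mulρ : ContDiff ℝ ∞ M.mulρ := M.sep.contDiff_op M.ρmac_smooth _

lemma elliptic_mulG (x : Pt d) : Elliptic (M.mulG x) := by
  obtain ⟨c, hc, h⟩ := M.elliptic x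
  refine ⟨c, hc, fun f => ?_⟩
  rw [← real_inner_self_eq_norm_sq, ← real_inner_smul_left, L2.inner_def, L2.inner_def]
  refine integral_mono_ae (L2.integrable_inner _ _) (L2.integrable_inner _ _) ?_
  filter_upwards [h, M.coeFn_mulG x f, Lp.coeFn_smul c f] with y h1 h2 h3
  rw [h2, h3, Pi.smul_apply]
  simp only [smul_eq_mul, RCLike.inner_apply, conj_trivial]
  have : c ≤ M.G x y := h1
  nlinarith [mul_nonneg (sub_nonneg.2 this) (mul_self_nonneg (f y))]

/-- The constant function `1` as an element of `H¹_per(Y)`. -/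
abbrev one : H1per M.ℓ := oneH1 M.ℓ_pos

lemma meanL_oneL2 : meanL M.ℓ (oneL2 M.ℓ) = 1 := meanL_one M.ℓ_pos M.volume_one

lemma eq_mean_smul_one {x : Pt d} {w : H1per M.ℓ} (h : WeakDiv (fun i => M.mulG x (dyL i w)) 0) :
    w = meanL M.ℓ (valL w) • M.one :=
  eq_const_of_weakDiv M.ℓ_pos M.volume_one (M.elliptic_mulG x) h

/-- The difference of two solutions is constant in `y`. This yields both the uniqueness of the cell
functions and the identification of the terms `u_n`. -/
lemma eq_of_weakDiv {x : Pt d} {f : Fin d → L2 M.ℓ} {g : L2 M.ℓ} {v w : H1per M.ℓ}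
    (hv : WeakDiv (fun i => M.mulG x (f i + dyL i v)) g)
    (hw : WeakDiv (fun i => M.mulG x (f i + dyL i w)) g)
    (hm : meanL M.ℓ (valL v) = meanL M.ℓ (valL w)) : v = w := by
  have h : WeakDiv (fun i => M.mulG x (dyL i (v - w))) 0 := by
    refine (hv.sub hw).congr (fun i => ?_) (sub_self g)
    simp only [map_add, map_sub]
    abel
  have := M.eq_mean_smul_one h
  rw [map_sub, map_sub, hm, sub_self, zero_smul] at this
  exact sub_eq_zero.1 this

/-- All six cell problems have this shape: `f` collects the lower-order cell functions inside the
flux, and `g` is a source of zero mean. -/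
lemma exists_cellSolution {f : Fin d → Pt d → L2 M.ℓ} (hf : ∀ i, ContDiff ℝ ∞ (f i))
    {g : Pt d → L2 M.ℓ} (hg : ContDiff ℝ ∞ g) (hg0 : ∀ x, meanL M.ℓ (g x) = 0) :
    ∃ w : TwoScale M.ℓ, ContDiff ℝ ∞ w ∧ (∀ x, meanL M.ℓ (valL (w x)) = 0) ∧
      ∀ x, WeakDiv (fun i => M.mulG x (f i x + dyL i (w x))) (g x) := by
  have := completeSpace_gradSpace M.ℓ_pos M.volume_one
  exact ⟨fun x => solveCell M.ℓ_pos M.volume_one (M.mulG x) (fun i => f i x) (g x),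
    contDiff_solveCell _ _ M.contDiff_mulG M.elliptic_mulG hf hg,
    fun x => meanL_solveCell _ _ _ _ _,
    fun x => weakDiv_solveCell _ _ (M.elliptic_mulG x) _ (hg0 x)⟩

end Medium

/-! ### Calculus of partial derivatives -/

section Calculus

variable {F F' : Type*} [NormedAddCommGroup F] [NormedSpace ℝ F] [NormedAddCommGroup F']
  [NormedSpace ℝ F']

lemma contDiff_pd_of_le {f : Pt d → F} {m n : WithTop ℕ∞} (hf : ContDiff ℝ n f) (h : m + 1 ≤ n)
    (i : Fin d) : ContDiff ℝ m (pd i f) :=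
  (hf.fderiv_right h).clm_apply contDiff_const

lemma contDiff_pd {f : Pt d → F} (hf : ContDiff ℝ ∞ f) (i : Fin d) : ContDiff ℝ ∞ (pd i f) :=
  contDiff_pd_of_le hf (by simp) i

/-- Averages and pairings with test functions are continuous linear on `L²(Y)`, so for `L²`-valued
fields this replaces differentiation under the integral sign. -/
lemma pd_clm (L : F →L[ℝ] F') {f : Pt d → F} {x : Pt d} (hf : DifferentiableAt ℝ f x)
    (i : Fin d) : pd i (fun z => L (f z)) x = L (pd i f x) := by
  have h : HasFDerivAt (fun z => L (f z)) (L.comp (fderiv ℝ f x)) x :=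
    L.hasFDerivAt.comp x hf.hasFDerivAt
  rw [pd, h.fderiv]
  rfl

lemma pd_add {f g : Pt d → F} {x : Pt d} (hf : DifferentiableAt ℝ f x)
    (hg : DifferentiableAt ℝ g x) (i : Fin d) :
    pd i (fun z => f z + g z) x = pd i f x + pd i g x := by
  rw [pd, fderiv_fun_add hf hg]
  rfl

lemma pd_sum {ι : Type*} (s : Finset ι) {f : ι → Pt d → F} {x : Pt d}
    (hf : ∀ k ∈ s, DifferentiableAt ℝ (f k) x) (i : Fin d) :
    pd i (fun z => ∑ k ∈ s, f k z) x = ∑ k ∈ s, pd i (f k) x := by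
  rw [pd, fderiv_fun_sum hf, sum_apply]
  rfl

lemma pd_smul {c : Pt d → ℝ} {f : Pt d → F} {x : Pt d} (hc : DifferentiableAt ℝ c x)
    (hf : DifferentiableAt ℝ f x) (i : Fin d) :
    pd i (fun z => c z • f z) x = c x • pd i f x + pd i c x • f x := by
  rw [pd, fderiv_fun_smul hc hf]
  rfl

lemma pd_mul' {c f : Pt d → ℝ} {x : Pt d} (hc : DifferentiableAt ℝ c x)
    (hf : DifferentiableAt ℝ f x) (i : Fin d) :
    pd i (fun z => c z * f z) x = c x * pd i f x + pd i c x * f x :=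
  pd_smul hc hf i

lemma pd_const_mul (c : ℝ) {f : Pt d → ℝ} {x : Pt d} (hf : DifferentiableAt ℝ f x) (i : Fin d) :
    pd i (fun z => c * f z) x = c * pd i f x := by
  rw [pd_mul' (differentiableAt_const c) hf, pd_const, zero_mul, add_zero]

/-- Needed once, in `source3_eq`, to bring third derivatives of the mean field into the index order
of the problem for `R`. -/
lemma pd_comm {f : Pt d → F} (hf : ContDiff ℝ 2 f) (i j : Fin d) :
    pd i (pd j f) = pd j (pd i f) := by
  funext x
  have hd : DifferentiableAt ℝ (fderiv ℝ f) x :=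
    (hf.fderiv_right (m := 1) (by norm_num)).differentiable (by simp) x
  have h1 : ∀ i j : Fin d, pd i (pd j f) x = fderiv ℝ (fderiv ℝ f) x
      (EuclideanSpace.single i 1) (EuclideanSpace.single j 1) := by
    intro i j
    exact pd_clm (ContinuousLinearMap.apply ℝ F (EuclideanSpace.single j (1 : ℝ) : Pt d)) hd i
  rw [h1, h1]
  exact (hf.contDiffAt.isSymmSndFDerivAt (by simp)) _ _

lemma contDiff_div {f g : Pt d → ℝ} (hf : ContDiff ℝ ∞ f) (hg : ContDiff ℝ ∞ g)
    (h : ∀ x, g x ≠ 0) : ContDiff ℝ ∞ fun x => f x / g x :=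
  hf.div hg h

end Calculus

/-! ### Densities as `L²(Y)`-valued fields -/

/-- The density `F(x, ·)` is the field `f(x)`. -/
def IsField (M : Medium d) (F : Pt d → Pt d → ℝ) (f : Pt d → L2 M.ℓ) : Prop :=
  ∀ x, F x =ᵐ[cellMeasure M.ℓ] f x

namespace IsField

variable {M : Medium d} {F : Pt d → Pt d → ℝ} {f : Pt d → L2 M.ℓ}

lemma avg_eq (h : IsField M F f) : avg M F = fun x => meanL M.ℓ (f x) := by
  funext x
  rw [avg, meanL_apply]
  exact integral_congr_ae (h x)

lemma pair_eq (h : IsField M F f) {φ : Pt d → ℝ} (hφ : Continuous φ) :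
    pair M F φ = fun x => ⟪toL2 M.ℓ φ, f x⟫ := by
  funext x
  rw [pair, inner_toL2 hφ]
  refine integral_congr_ae ?_
  filter_upwards [h x] with y hy
  rw [hy]

lemma divY_eq {F : Fin d → Pt d → Pt d → ℝ} {f : Fin d → Pt d → L2 M.ℓ}
    (h : ∀ i, IsField M (F i) (f i)) {φ : Pt d → ℝ} (hφ : IsTest M.ℓ φ) (x : Pt d) :
    divY M F φ x = -∑ i, ⟪toL2 M.ℓ (pd i φ), f i x⟫ := by
  rw [divY]
  congr 1
  exact Finset.sum_congr rfl fun i _ => by rw [(h i).pair_eq (hφ.continuous_pd i)]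

/-- A slow divergence is defined only after testing in `y`; for smooth fields it is the pairing with
a genuine derivative in `L²(Y)`. -/
lemma divX_eq {F : Fin d → Pt d → Pt d → ℝ} {f : Fin d → Pt d → L2 M.ℓ}
    (h : ∀ i, IsField M (F i) (f i)) (hf : ∀ i, ContDiff ℝ ∞ (f i)) {φ : Pt d → ℝ}
    (hφ : IsTest M.ℓ φ) (x : Pt d) :
    divX M F φ x = ⟪toL2 M.ℓ φ, ∑ i, pd i (f i) x⟫ := by
  rw [divX, inner_sum]
  refine Finset.sum_congr rfl fun i _ => ?_
  rw [(h i).pair_eq hφ.smooth.continuous]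
  exact pd_clm (innerSL ℝ (toL2 M.ℓ φ)) ((hf i).differentiable (by simp) x) i

end IsField

namespace Medium

variable (M : Medium d)

/-- The density `ρ(x, ·)` as an `L²(Y)`-valued field. -/
def ρField (x : Pt d) : L2 M.ℓ := M.mulρ x (oneL2 M.ℓ)

lemma isField_mulρ {F : Pt d → Pt d → ℝ} {f : Pt d → L2 M.ℓ} (h : IsField M F f) :
    IsField M (fun x y => M.ρ x y * F x y) (fun x => M.mulρ x (f x)) := by
  intro x
  filter_upwards [M.coeFn_mulρ x (f x), h x] with y h1 h2
  rw [h1, h2]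

lemma isField_mulG {F : Pt d → Pt d → ℝ} {f : Pt d → L2 M.ℓ} (h : IsField M F f) :
    IsField M (fun x y => M.G x y * F x y) (fun x => M.mulG x (f x)) := by
  intro x
  filter_upwards [M.coeFn_mulG x (f x), h x] with y h1 h2
  rw [h1, h2]

lemma isField_val (u : TwoScale M.ℓ) : IsField M (fun x y => val (u x) y) fun x => valL (u x) :=
  fun _ => Filter.EventuallyEq.rfl

lemma isField_dy (i : Fin d) (u : TwoScale M.ℓ) :
    IsField M (fun x y => dy i (u x) y) fun x => dyL i (u x) :=
  fun _ => Filter.EventuallyEq.rfl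

lemma isField_const (c : ℝ) : IsField M (fun _ _ => c) fun _ => c • oneL2 M.ℓ := by
  intro x
  filter_upwards [coeFn_oneL2 (ℓ := M.ℓ), Lp.coeFn_smul c (oneL2 M.ℓ)] with y h1 h2
  rw [h2, Pi.smul_apply, h1, smul_eq_mul, mul_one]

lemma isField_ρ : IsField M M.ρ M.ρField := by
  intro x
  filter_upwards [M.coeFn_mulρ x (oneL2 M.ℓ), coeFn_oneL2 (ℓ := M.ℓ)] with y h1 h2
  rw [ρField, h1, h2, mul_one]

end Medium

/-! ### Algebra of fields -/

section IsFieldAlgebra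

variable {M : Medium d} {F F' : Pt d → Pt d → ℝ} {f f' : Pt d → L2 M.ℓ}

lemma IsField.add (h : IsField M F f) (h' : IsField M F' f') :
    IsField M (fun x y => F x y + F' x y) fun x => f x + f' x := by
  intro x
  filter_upwards [h x, h' x, Lp.coeFn_add (f x) (f' x)] with y h1 h2 h3
  rw [h3, Pi.add_apply, h1, h2]

lemma IsField.smul (h : IsField M F f) (c : Pt d → ℝ) :
    IsField M (fun x y => c x * F x y) fun x => c x • f x := by
  intro x
  filter_upwards [h x, Lp.coeFn_smul (c x) (f x)] with y h1 h2
  rw [h2, Pi.smul_apply, h1, smul_eq_mul]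

lemma IsField.congr (h : IsField M F f) (hF : ∀ x y, F x y = F' x y) (hf : ∀ x, f x = f' x) :
    IsField M F' f' := by
  rw [← funext hf, ← show F = F' from funext fun x => funext fun y => hF x y]
  exact h

end IsFieldAlgebra

/-! ### The mean density -/

namespace Medium

variable (M : Medium d)

lemma contDiff_ρField : ContDiff ℝ ∞ M.ρField := M.contDiff_mulρ.clm_apply contDiff_const

lemma rho0_eq : M.rho0 = fun x => meanL M.ℓ (M.ρField x) := M.isField_ρ.avg_eq

lemma contDiff_rho0 : ContDiff ℝ ∞ M.rho0 := by
  rw [rho0_eq]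
  exact (meanL M.ℓ).contDiff.comp M.contDiff_ρField

lemma rho0_pos (x : Pt d) : 0 < M.rho0 x := by
  have hint : Integrable (M.ρ x) (cellMeasure M.ℓ) :=
    ((Lp.memLp (M.ρField x)).integrable (by norm_num)).congr (M.isField_ρ x).symm
  have hpos : ∀ᵐ y ∂(cellMeasure M.ℓ), 0 < M.ρ x y := M.density_pos x
  change 0 < ∫ y, M.ρ x y ∂(cellMeasure M.ℓ)
  rw [integral_pos_iff_support_of_nonneg_ae (hpos.mono fun y hy => hy.le) hint]
  -- Positivity almost everywhere gives the support full measure, and the cell has measure one.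
  have h : (Function.support (M.ρ x) : Set (Pt d)) =ᵐ[cellMeasure M.ℓ] univ := by
    rw [eventuallyEq_univ]
    filter_upwards [hpos] with y hy
    exact hy.ne'
  rw [measure_congr h, Measure.restrict_apply_univ, volume_cell M.ℓ_pos M.volume_one]
  exact one_pos

lemma rho0_ne (x : Pt d) : M.rho0 x ≠ 0 := (M.rho0_pos x).ne'

lemma meanL_ρField (x : Pt d) : meanL M.ℓ (M.ρField x) = M.rho0 x := by rw [rho0_eq]

end Medium

/-! ### The fluxes and sources of the cell problems -/

namespace CellFunctions

variable {M : Medium d} (C : CellFunctions M)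

/-- `G (I₂ + ∇_y P)` as an `L²(Y)`-valued field. -/
def fieldP (i j : Fin d) (x : Pt d) : L2 M.ℓ :=
  M.mulG x (δ i j • oneL2 M.ℓ + dyL i (C.P j x))

/-- `G (I₂ ⊗ P + ∇_y Q)` as an `L²(Y)`-valued field. -/
def fieldQ (i j k : Fin d) (x : Pt d) : L2 M.ℓ :=
  M.mulG x (δ i j • valL (C.P k x) + dyL i (C.Q j k x))

/-- `G (∇_x P + ∇_y P̃)` as an `L²(Y)`-valued field. -/
def fieldPt (i j : Fin d) (x : Pt d) : L2 M.ℓ :=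
  M.mulG x (valL (pd i (C.P j) x) + dyL i (C.Ptil j x))

/-- `G (I₂ ⊗ Q + ∇_y R)` as an `L²(Y)`-valued field. -/
def fieldR (i j k l : Fin d) (x : Pt d) : L2 M.ℓ :=
  M.mulG x (δ i j • valL (C.Q k l x) + dyL i (C.R j k l x))

/-- `G (∇_x Q + I₂ ⊗ P̃ + ∇_y Q̃)` as an `L²(Y)`-valued field. -/
def fieldQt (i j k : Fin d) (x : Pt d) : L2 M.ℓ :=
  M.mulG x (valL (pd i (C.Q j k) x) + δ i j • valL (C.Ptil k x) + dyL i (C.Qtil j k x))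

/-- `G (∇_x P̃ + ∇_y R̃)` as an `L²(Y)`-valued field. -/
def fieldRt (i j : Fin d) (x : Pt d) : L2 M.ℓ :=
  M.mulG x (valL (pd i (C.Ptil j) x) + dyL i (C.Rtil j x))

/-- `ρ (P - ϱ⁽¹⁾ / ϱ⁽⁰⁾)` as an `L²(Y)`-valued field. -/
def sourceField (j : Fin d) (x : Pt d) : L2 M.ℓ :=
  M.mulρ x (valL (C.P j x)) - (C.rho1 j x / M.rho0 x) • M.ρField x

lemma isField_fluxP (i j : Fin d) : IsField M (C.fluxP i j) (C.fieldP i j) :=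
  M.isField_mulG ((M.isField_const _).add (M.isField_dy i _))

lemma isField_fluxQ (i j k : Fin d) : IsField M (C.fluxQ i j k) (C.fieldQ i j k) :=
  M.isField_mulG (((M.isField_val _).smul fun _ => δ i j).add (M.isField_dy i _))

lemma isField_fluxPt (i j : Fin d) : IsField M (C.fluxPt i j) (C.fieldPt i j) :=
  M.isField_mulG ((M.isField_val _).add (M.isField_dy i _))

lemma isField_fluxR (i j k l : Fin d) : IsField M (C.fluxR i j k l) (C.fieldR i j k l) :=
  M.isField_mulG (((M.isField_val _).smul fun _ => δ i j).add (M.isField_dy i _))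

lemma isField_fluxQt (i j k : Fin d) : IsField M (C.fluxQt i j k) (C.fieldQt i j k) :=
  M.isField_mulG (((M.isField_val _).add ((M.isField_val _).smul fun _ => δ i j)).add
    (M.isField_dy i _))

lemma isField_fluxRt (i j : Fin d) : IsField M (C.fluxRt i j) (C.fieldRt i j) :=
  M.isField_mulG ((M.isField_val _).add (M.isField_dy i _))

lemma isField_source (j : Fin d) : IsField M (C.source j) (C.sourceField j) := by
  refine ((M.isField_mulρ (M.isField_val (C.P j))).add
    (M.isField_ρ.smul fun x => -(C.rho1 j x / M.rho0 x))).congr (fun x y => ?_) fun x => ?_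
  · rw [source]
    ring
  · rw [sourceField, neg_smul, sub_eq_add_neg]

lemma mu0_eq (i j : Fin d) : C.mu0 i j = fun x => meanL M.ℓ (C.fieldP i j x) :=
  (C.isField_fluxP i j).avg_eq

lemma mu1_eq (i j k : Fin d) : C.mu1 i j k = fun x => meanL M.ℓ (C.fieldQ i j k x) :=
  (C.isField_fluxQ i j k).avg_eq

lemma mu2_eq (i j k l : Fin d) : C.mu2 i j k l = fun x => meanL M.ℓ (C.fieldR i j k l x) :=
  (C.isField_fluxR i j k l).avg_eq

lemma eta_eq (i j : Fin d) : C.eta i j = fun x => meanL M.ℓ (C.fieldPt i j x) :=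
  (C.isField_fluxPt i j).avg_eq

lemma phi_eq (i j : Fin d) : C.phi i j = fun x => meanL M.ℓ (C.fieldRt i j x) :=
  (C.isField_fluxRt i j).avg_eq

lemma psi_eq (i j k : Fin d) : C.psi i j k = fun x => meanL M.ℓ (C.fieldQt i j k x) :=
  (C.isField_fluxQt i j k).avg_eq

lemma rho1_eq (j : Fin d) : C.rho1 j = fun x => meanL M.ℓ (M.mulρ x (valL (C.P j x))) :=
  (M.isField_mulρ (M.isField_val _)).avg_eq

lemma rho2_eq (j k : Fin d) : C.rho2 j k = fun x => meanL M.ℓ (M.mulρ x (valL (C.Q j k x))) :=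
  (M.isField_mulρ (M.isField_val _)).avg_eq

lemma rho2t_eq (j : Fin d) : C.rho2t j = fun x => meanL M.ℓ (M.mulρ x (valL (C.Ptil j x))) :=
  (M.isField_mulρ (M.isField_val _)).avg_eq

/-- The subtraction of `ϱ⁽¹⁾/ϱ⁽⁰⁾` serves this purpose: the extra source terms do not disturb the
compatibility of the cell problems. -/
lemma meanL_sourceField (j : Fin d) (x : Pt d) : meanL M.ℓ (C.sourceField j x) = 0 := by
  rw [sourceField, map_sub, map_smul, M.meanL_ρField, rho1_eq, smul_eq_mul,
    div_mul_cancel₀ _ (M.rho0_ne x), sub_self]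

/-- The right-hand side of the problem for `Q`. -/
def rhsQ (j k : Fin d) (x : Pt d) : L2 M.ℓ :=
  (C.mu0 j k x / M.rho0 x) • M.ρField x - C.fieldP j k x

/-- The right-hand side of the problem for `P̃`. -/
def rhsPt (j : Fin d) (x : Pt d) : L2 M.ℓ :=
  (C.divMu0 j x / M.rho0 x) • M.ρField x - ∑ i, pd i (C.fieldP i j) x

/-- The right-hand side of the problem for `Q̃`. -/
def rhsQt (j k : Fin d) (x : Pt d) : L2 M.ℓ :=
  ((C.eta j k x + C.divMu1 j k x) / M.rho0 x) • M.ρField x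
    - ∑ i, pd i (C.fieldQ i j k) x - C.fieldPt j k x
    + (C.divMu0 k x / M.rho0 x) • C.sourceField j x
    + ∑ m, pd m (fun z => C.mu0 j k z / M.rho0 z) x • C.sourceField m x

/-- The right-hand side of the problem for `R`. -/
def rhsR (j k l : Fin d) (x : Pt d) : L2 M.ℓ :=
  (C.mu1 j k l x / M.rho0 x) • M.ρField x - C.fieldQ j k l x
    + (C.mu0 j k x / M.rho0 x) • C.sourceField l x

/-- The right-hand side of the problem for `R̃`. -/
def rhsRt (j : Fin d) (x : Pt d) : L2 M.ℓ :=
  (C.divEta j x / M.rho0 x) • M.ρField x - ∑ i, pd i (C.fieldPt i j) x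
    + ∑ m, pd m (fun z => C.divMu0 j z / M.rho0 z) x • C.sourceField m x

/-! ### Smoothness and compatibility of the cell data -/

section Smooth

variable {C}

lemma contDiff_valL {u : TwoScale M.ℓ} (hu : ContDiff ℝ ∞ u) :
    ContDiff ℝ ∞ fun x => valL (u x) :=
  valL.contDiff.comp hu

lemma contDiff_dyL {u : TwoScale M.ℓ} (hu : ContDiff ℝ ∞ u) (i : Fin d) :
    ContDiff ℝ ∞ fun x => dyL i (u x) :=
  (dyL i).contDiff.comp hu

/-- Here and below the hypotheses name only the cell functions that enter the expression, so that
the lemmas apply to the partially built families in `exists_solvesL2`. -/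
lemma contDiff_fieldP (hP : ∀ j, ContDiff ℝ ∞ (C.P j)) (i j : Fin d) :
    ContDiff ℝ ∞ (C.fieldP i j) :=
  M.contDiff_mulG.clm_apply (contDiff_const.add (contDiff_dyL (hP j) i))

lemma contDiff_fieldQ (hP : ∀ j, ContDiff ℝ ∞ (C.P j)) (hQ : ∀ j k, ContDiff ℝ ∞ (C.Q j k))
    (i j k : Fin d) : ContDiff ℝ ∞ (C.fieldQ i j k) :=
  M.contDiff_mulG.clm_apply (((contDiff_valL (hP k)).const_smul (δ i j)).add
    (contDiff_dyL (hQ j k) i))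

lemma contDiff_fieldPt (hP : ∀ j, ContDiff ℝ ∞ (C.P j)) (hPt : ∀ j, ContDiff ℝ ∞ (C.Ptil j))
    (i j : Fin d) : ContDiff ℝ ∞ (C.fieldPt i j) :=
  M.contDiff_mulG.clm_apply ((contDiff_valL (contDiff_pd (hP j) i)).add
    (contDiff_dyL (hPt j) i))

lemma contDiff_fieldR (hQ : ∀ j k, ContDiff ℝ ∞ (C.Q j k))
    (hR : ∀ j k l, ContDiff ℝ ∞ (C.R j k l)) (i j k l : Fin d) :
    ContDiff ℝ ∞ (C.fieldR i j k l) :=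
  M.contDiff_mulG.clm_apply (((contDiff_valL (hQ k l)).const_smul (δ i j)).add
    (contDiff_dyL (hR j k l) i))

lemma contDiff_fieldQt (hQ : ∀ j k, ContDiff ℝ ∞ (C.Q j k))
    (hPt : ∀ j, ContDiff ℝ ∞ (C.Ptil j)) (hQt : ∀ j k, ContDiff ℝ ∞ (C.Qtil j k))
    (i j k : Fin d) : ContDiff ℝ ∞ (C.fieldQt i j k) :=
  M.contDiff_mulG.clm_apply (((contDiff_valL (contDiff_pd (hQ j k) i)).add
    ((contDiff_valL (hPt k)).const_smul (δ i j))).add (contDiff_dyL (hQt j k) i))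

lemma contDiff_fieldRt (hPt : ∀ j, ContDiff ℝ ∞ (C.Ptil j))
    (hRt : ∀ j, ContDiff ℝ ∞ (C.Rtil j)) (i j : Fin d) : ContDiff ℝ ∞ (C.fieldRt i j) :=
  M.contDiff_mulG.clm_apply ((contDiff_valL (contDiff_pd (hPt j) i)).add
    (contDiff_dyL (hRt j) i))

lemma contDiff_mu0 (hP : ∀ j, ContDiff ℝ ∞ (C.P j)) (i j : Fin d) :
    ContDiff ℝ ∞ (C.mu0 i j) := by
  rw [mu0_eq]
  exact (meanL M.ℓ).contDiff.comp (contDiff_fieldP hP i j)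

lemma contDiff_mu1 (hP : ∀ j, ContDiff ℝ ∞ (C.P j)) (hQ : ∀ j k, ContDiff ℝ ∞ (C.Q j k))
    (i j k : Fin d) : ContDiff ℝ ∞ (C.mu1 i j k) := by
  rw [mu1_eq]
  exact (meanL M.ℓ).contDiff.comp (contDiff_fieldQ hP hQ i j k)

lemma contDiff_eta (hP : ∀ j, ContDiff ℝ ∞ (C.P j)) (hPt : ∀ j, ContDiff ℝ ∞ (C.Ptil j))
    (i j : Fin d) : ContDiff ℝ ∞ (C.eta i j) := by
  rw [eta_eq]
  exact (meanL M.ℓ).contDiff.comp (contDiff_fieldPt hP hPt i j)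

lemma contDiff_rho1 (hP : ∀ j, ContDiff ℝ ∞ (C.P j)) (j : Fin d) : ContDiff ℝ ∞ (C.rho1 j) := by
  rw [rho1_eq]
  exact (meanL M.ℓ).contDiff.comp (M.contDiff_mulρ.clm_apply (contDiff_valL (hP j)))

lemma contDiff_sourceField (hP : ∀ j, ContDiff ℝ ∞ (C.P j)) (j : Fin d) :
    ContDiff ℝ ∞ (C.sourceField j) :=
  (M.contDiff_mulρ.clm_apply (contDiff_valL (hP j))).sub
    ((contDiff_div (contDiff_rho1 hP j) M.contDiff_rho0 M.rho0_ne).smul M.contDiff_ρField)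

lemma contDiff_divMu0 (hP : ∀ j, ContDiff ℝ ∞ (C.P j)) (j : Fin d) : ContDiff ℝ ∞ (C.divMu0 j) :=
  ContDiff.sum fun i _ => contDiff_pd (contDiff_mu0 hP i j) i

lemma contDiff_divMu1 (hP : ∀ j, ContDiff ℝ ∞ (C.P j)) (hQ : ∀ j k, ContDiff ℝ ∞ (C.Q j k))
    (j k : Fin d) : ContDiff ℝ ∞ (C.divMu1 j k) :=
  ContDiff.sum fun i _ => contDiff_pd (contDiff_mu1 hP hQ i j k) i

lemma contDiff_divEta (hP : ∀ j, ContDiff ℝ ∞ (C.P j)) (hPt : ∀ j, ContDiff ℝ ∞ (C.Ptil j))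
    (j : Fin d) : ContDiff ℝ ∞ (C.divEta j) :=
  ContDiff.sum fun i _ => contDiff_pd (contDiff_eta hP hPt i j) i

lemma contDiff_smul_ρField {c : Pt d → ℝ} (hc : ContDiff ℝ ∞ c) :
    ContDiff ℝ ∞ fun x => (c x / M.rho0 x) • M.ρField x :=
  (contDiff_div hc M.contDiff_rho0 M.rho0_ne).smul M.contDiff_ρField

lemma contDiff_rhsQ (hP : ∀ j, ContDiff ℝ ∞ (C.P j)) (j k : Fin d) :
    ContDiff ℝ ∞ (C.rhsQ j k) :=
  (contDiff_smul_ρField (contDiff_mu0 hP j k)).sub (contDiff_fieldP hP j k)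

lemma contDiff_rhsPt (hP : ∀ j, ContDiff ℝ ∞ (C.P j)) (j : Fin d) : ContDiff ℝ ∞ (C.rhsPt j) :=
  (contDiff_smul_ρField (contDiff_divMu0 hP j)).sub
    (ContDiff.sum fun i _ => contDiff_pd (contDiff_fieldP hP i j) i)

lemma contDiff_rhsQt (hP : ∀ j, ContDiff ℝ ∞ (C.P j)) (hQ : ∀ j k, ContDiff ℝ ∞ (C.Q j k))
    (hPt : ∀ j, ContDiff ℝ ∞ (C.Ptil j)) (j k : Fin d) : ContDiff ℝ ∞ (C.rhsQt j k) :=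
  ((((contDiff_smul_ρField ((contDiff_eta hP hPt j k).add (contDiff_divMu1 hP hQ j k))).sub
    (ContDiff.sum fun i _ => contDiff_pd (contDiff_fieldQ hP hQ i j k) i)).sub
    (contDiff_fieldPt hP hPt j k)).add
    ((contDiff_div (contDiff_divMu0 hP k) M.contDiff_rho0 M.rho0_ne).smul
      (contDiff_sourceField hP j))).add
    (ContDiff.sum fun m _ => (contDiff_pd (contDiff_div (contDiff_mu0 hP j k) M.contDiff_rho0
      M.rho0_ne) m).smul (contDiff_sourceField hP m))

lemma contDiff_rhsR (hP : ∀ j, ContDiff ℝ ∞ (C.P j)) (hQ : ∀ j k, ContDiff ℝ ∞ (C.Q j k))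
    (j k l : Fin d) : ContDiff ℝ ∞ (C.rhsR j k l) :=
  ((contDiff_smul_ρField (contDiff_mu1 hP hQ j k l)).sub (contDiff_fieldQ hP hQ j k l)).add
    ((contDiff_div (contDiff_mu0 hP j k) M.contDiff_rho0 M.rho0_ne).smul
      (contDiff_sourceField hP l))

lemma contDiff_rhsRt (hP : ∀ j, ContDiff ℝ ∞ (C.P j)) (hPt : ∀ j, ContDiff ℝ ∞ (C.Ptil j))
    (j : Fin d) : ContDiff ℝ ∞ (C.rhsRt j) :=
  ((contDiff_smul_ρField (contDiff_divEta hP hPt j)).sub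
    (ContDiff.sum fun i _ => contDiff_pd (contDiff_fieldPt hP hPt i j) i)).add
    (ContDiff.sum fun m _ => (contDiff_pd (contDiff_div (contDiff_divMu0 hP j) M.contDiff_rho0
      M.rho0_ne) m).smul (contDiff_sourceField hP m))

lemma meanL_smul_ρField (c : ℝ) (x : Pt d) :
    meanL M.ℓ ((c / M.rho0 x) • M.ρField x) = c := by
  rw [map_smul, M.meanL_ρField, smul_eq_mul, div_mul_cancel₀ _ (M.rho0_ne x)]

lemma meanL_pd {f : Pt d → L2 M.ℓ} (hf : ContDiff ℝ ∞ f) (i : Fin d) (x : Pt d) :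
    meanL M.ℓ (pd i f x) = pd i (fun z => meanL M.ℓ (f z)) x :=
  (pd_clm (meanL M.ℓ) (hf.differentiable (by simp) x) i).symm

variable (C)

/-- Compatibility holds by design: the coefficient of `ρ/ϱ⁽⁰⁾` is the mean of what is subtracted.
The same mechanism works in the other problems, where slow derivatives are first moved outside the
mean. -/
lemma meanL_rhsQ (j k : Fin d) (x : Pt d) : meanL M.ℓ (C.rhsQ j k x) = 0 := by
  rw [rhsQ, map_sub, meanL_smul_ρField, mu0_eq, sub_self]

lemma meanL_sum_smul_source (c : Fin d → ℝ) (x : Pt d) :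
    meanL M.ℓ (∑ m, c m • C.sourceField m x) = 0 := by
  simp [map_sum, meanL_sourceField]

variable {C}

lemma meanL_rhsPt (hP : ∀ j, ContDiff ℝ ∞ (C.P j)) (j : Fin d) (x : Pt d) :
    meanL M.ℓ (C.rhsPt j x) = 0 := by
  rw [rhsPt, map_sub, meanL_smul_ρField, map_sum, divMu0, sub_eq_zero]
  refine Finset.sum_congr rfl fun i _ => ?_
  rw [meanL_pd (contDiff_fieldP hP i j), mu0_eq]

lemma meanL_rhsQt (hP : ∀ j, ContDiff ℝ ∞ (C.P j)) (hQ : ∀ j k, ContDiff ℝ ∞ (C.Q j k))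
    (j k : Fin d) (x : Pt d) : meanL M.ℓ (C.rhsQt j k x) = 0 := by
  rw [rhsQt, map_add, map_add, map_sub, map_sub, meanL_smul_ρField, meanL_sum_smul_source,
    map_smul, meanL_sourceField, smul_zero, map_sum, divMu1, eta_eq,
    Finset.sum_congr rfl fun i _ => meanL_pd (contDiff_fieldQ hP hQ i j k) i x]
  simp only [mu1_eq]
  ring

lemma meanL_rhsR (j k l : Fin d) (x : Pt d) : meanL M.ℓ (C.rhsR j k l x) = 0 := by
  rw [rhsR, map_add, map_sub, meanL_smul_ρField, map_smul, meanL_sourceField, mu1_eq]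
  simp

lemma meanL_rhsRt (hP : ∀ j, ContDiff ℝ ∞ (C.P j)) (hPt : ∀ j, ContDiff ℝ ∞ (C.Ptil j))
    (j : Fin d) (x : Pt d) : meanL M.ℓ (C.rhsRt j x) = 0 := by
  rw [rhsRt, map_add, map_sub, meanL_smul_ρField, meanL_sum_smul_source, map_sum, divEta,
    Finset.sum_congr rfl fun i _ => meanL_pd (contDiff_fieldPt hP hPt i j) i x]
  simp only [eta_eq]
  ring

end Smooth

end CellFunctions

/-! ### The cell problems as equations in `L²(Y)` -/

namespace CellFunctions

variable {M : Medium d}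

lemma weakDiv_iff_of_isField {F : Fin d → Pt d → Pt d → ℝ} {f : Fin d → Pt d → L2 M.ℓ}
    (h : ∀ i, IsField M (F i) (f i)) (x : Pt d) (g : L2 M.ℓ) :
    (∀ φ, IsTest M.ℓ φ → divY M F φ x = ⟪toL2 M.ℓ φ, g⟫) ↔ WeakDiv (fun i => f i x) g :=
  forall_congr' fun φ => forall_congr' fun hφ => by rw [IsField.divY_eq h hφ]

/-- The cell problems as equations between `L²(Y)`-valued fields. -/
structure SolvesL2 (C : CellFunctions M) : Prop where
  smooth_P : ∀ j, ContDiff ℝ ∞ (C.P j)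
  smooth_Q : ∀ j k, ContDiff ℝ ∞ (C.Q j k)
  smooth_R : ∀ j k l, ContDiff ℝ ∞ (C.R j k l)
  smooth_Pt : ∀ j, ContDiff ℝ ∞ (C.Ptil j)
  smooth_Qt : ∀ j k, ContDiff ℝ ∞ (C.Qtil j k)
  smooth_Rt : ∀ j, ContDiff ℝ ∞ (C.Rtil j)
  mean_P : ∀ j x, meanL M.ℓ (valL (C.P j x)) = 0
  mean_Q : ∀ j k x, meanL M.ℓ (valL (C.Q j k x)) = 0
  mean_R : ∀ j k l x, meanL M.ℓ (valL (C.R j k l x)) = 0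
  mean_Pt : ∀ j x, meanL M.ℓ (valL (C.Ptil j x)) = 0
  mean_Qt : ∀ j k x, meanL M.ℓ (valL (C.Qtil j k x)) = 0
  mean_Rt : ∀ j x, meanL M.ℓ (valL (C.Rtil j x)) = 0
  eq_P : ∀ j x, WeakDiv (fun i => C.fieldP i j x) 0
  eq_Q : ∀ j k x, WeakDiv (fun i => C.fieldQ i j k x) (C.rhsQ j k x)
  eq_Pt : ∀ j x, WeakDiv (fun i => C.fieldPt i j x) (C.rhsPt j x)
  eq_Qt : ∀ j k x, WeakDiv (fun i => C.fieldQt i j k x) (C.rhsQt j k x)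
  eq_R : ∀ j k l x, WeakDiv (fun i => C.fieldR i j k l x) (C.rhsR j k l x)
  eq_Rt : ∀ j x, WeakDiv (fun i => C.fieldRt i j x) (C.rhsRt j x)

section Rhs

variable (C : CellFunctions M) {φ : Pt d → ℝ}

lemma inner_rhsQ (hφ : IsTest M.ℓ φ) (x : Pt d) (j k : Fin d) : ⟪toL2 M.ℓ φ, C.rhsQ j k x⟫ =
    pair M M.ρ φ x / M.rho0 x * C.mu0 j k x - pair M (C.fluxP j k) φ x := by
  rw [M.isField_ρ.pair_eq hφ.smooth.continuous, (C.isField_fluxP j k).pair_eq hφ.smooth.continuous,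
    rhsQ, inner_sub_right, inner_smul_right]
  ring

lemma inner_rhsPt (hφ : IsTest M.ℓ φ) (x : Pt d) (hP : ∀ j, ContDiff ℝ ∞ (C.P j)) (j : Fin d) : ⟪toL2 M.ℓ φ, C.rhsPt j x⟫ =
    pair M M.ρ φ x / M.rho0 x * C.divMu0 j x - divX M (fun i => C.fluxP i j) φ x := by
  rw [M.isField_ρ.pair_eq hφ.smooth.continuous,
    IsField.divX_eq (fun i => C.isField_fluxP i j) (fun i => contDiff_fieldP hP i j) hφ,
    rhsPt, inner_sub_right, inner_smul_right]
  ring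

lemma inner_rhsQt (hφ : IsTest M.ℓ φ) (x : Pt d) (hP : ∀ j, ContDiff ℝ ∞ (C.P j)) (hQ : ∀ j k, ContDiff ℝ ∞ (C.Q j k))
    (j k : Fin d) : ⟪toL2 M.ℓ φ, C.rhsQt j k x⟫ =
      pair M M.ρ φ x / M.rho0 x * (C.eta j k x + C.divMu1 j k x)
        - divX M (fun i => C.fluxQ i j k) φ x - pair M (C.fluxPt j k) φ x
        + pair M (C.source j) φ x * (C.divMu0 k x / M.rho0 x)
        + ∑ m, pair M (C.source m) φ x * pd m (fun z => C.mu0 j k z / M.rho0 z) x := by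
  simp only [M.isField_ρ.pair_eq hφ.smooth.continuous,
    (C.isField_fluxPt j k).pair_eq hφ.smooth.continuous,
    fun m => (C.isField_source m).pair_eq hφ.smooth.continuous]
  rw [IsField.divX_eq (fun i => C.isField_fluxQ i j k) (fun i => contDiff_fieldQ hP hQ i j k) hφ,
    rhsQt]
  simp only [inner_sub_right, inner_add_right, inner_smul_right,
    inner_sum (𝕜 := ℝ) Finset.univ (fun m => _ • C.sourceField m x)]
  rw [Finset.sum_congr rfl fun m _ => mul_comm _ _]
  ring

lemma inner_rhsR (hφ : IsTest M.ℓ φ) (x : Pt d) (j k l : Fin d) : ⟪toL2 M.ℓ φ, C.rhsR j k l x⟫ =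
      pair M M.ρ φ x / M.rho0 x * C.mu1 j k l x - pair M (C.fluxQ j k l) φ x
        + C.mu0 j k x / M.rho0 x * pair M (C.source l) φ x := by
  rw [M.isField_ρ.pair_eq hφ.smooth.continuous,
    (C.isField_fluxQ j k l).pair_eq hφ.smooth.continuous,
    (C.isField_source l).pair_eq hφ.smooth.continuous,
    rhsR, inner_add_right, inner_sub_right, inner_smul_right, inner_smul_right]
  ring

lemma inner_rhsRt (hφ : IsTest M.ℓ φ) (x : Pt d) (hP : ∀ j, ContDiff ℝ ∞ (C.P j)) (hPt : ∀ j, ContDiff ℝ ∞ (C.Ptil j))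
    (j : Fin d) : ⟪toL2 M.ℓ φ, C.rhsRt j x⟫ =
      pair M M.ρ φ x / M.rho0 x * C.divEta j x - divX M (fun i => C.fluxPt i j) φ x
        + ∑ m, pair M (C.source m) φ x * pd m (fun z => C.divMu0 j z / M.rho0 z) x := by
  simp only [M.isField_ρ.pair_eq hφ.smooth.continuous,
    fun m => (C.isField_source m).pair_eq hφ.smooth.continuous]
  rw [IsField.divX_eq (fun i => C.isField_fluxPt i j) (fun i => contDiff_fieldPt hP hPt i j) hφ,
    rhsRt]
  simp only [inner_sub_right, inner_add_right, inner_smul_right,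
    inner_sum (𝕜 := ℝ) Finset.univ (fun m => _ • C.sourceField m x)]
  rw [Finset.sum_congr rfl fun m _ => mul_comm _ _]
  ring

end Rhs

lemma solves_iff (C : CellFunctions M) : C.Solves ↔ C.SolvesL2 := by
  constructor
  · intro h
    refine ⟨h.smooth_P, h.smooth_Q, h.smooth_R, h.smooth_Pt, h.smooth_Qt, h.smooth_Rt,
      fun j x => ?_, fun j k x => ?_, fun j k l x => ?_, fun j x => ?_, fun j k x => ?_,
      fun j x => ?_, fun j x => ?_, fun j k x => ?_, fun j x => ?_, fun j k x => ?_,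
      fun j k l x => ?_, fun j x => ?_⟩
    · rw [← mean_eq, h.mean_P]
    · rw [← mean_eq, h.mean_Q]
    · rw [← mean_eq, h.mean_R]
    · rw [← mean_eq, h.mean_Pt]
    · rw [← mean_eq, h.mean_Qt]
    · rw [← mean_eq, h.mean_Rt]
    · exact (weakDiv_iff_of_isField (fun i => C.isField_fluxP i j) x _).1 fun φ hφ => by
        rw [h.eq_P φ hφ, inner_zero_right]
    · exact (weakDiv_iff_of_isField (fun i => C.isField_fluxQ i j k) x _).1 fun φ hφ => by
        rw [h.eq_Q φ hφ, inner_rhsQ C hφ]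
    · exact (weakDiv_iff_of_isField (fun i => C.isField_fluxPt i j) x _).1 fun φ hφ => by
        rw [h.eq_Pt φ hφ, inner_rhsPt C hφ x h.smooth_P]
    · exact (weakDiv_iff_of_isField (fun i => C.isField_fluxQt i j k) x _).1 fun φ hφ => by
        rw [h.eq_Qt φ hφ, inner_rhsQt C hφ x h.smooth_P h.smooth_Q]
    · exact (weakDiv_iff_of_isField (fun i => C.isField_fluxR i j k l) x _).1 fun φ hφ => by
        rw [h.eq_R φ hφ, inner_rhsR C hφ]
    · exact (weakDiv_iff_of_isField (fun i => C.isField_fluxRt i j) x _).1 fun φ hφ => by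
        rw [h.eq_Rt φ hφ, inner_rhsRt C hφ x h.smooth_P h.smooth_Pt]
  · intro h
    refine ⟨h.smooth_P, h.smooth_Q, h.smooth_R, h.smooth_Pt, h.smooth_Qt, h.smooth_Rt,
      fun j x => ?_, fun j k x => ?_, fun j k l x => ?_, fun j x => ?_, fun j k x => ?_,
      fun j x => ?_, fun φ hφ x j => ?_, fun φ hφ x j k => ?_, fun φ hφ x j => ?_,
      fun φ hφ x j k => ?_, fun φ hφ x j k l => ?_, fun φ hφ x j => ?_⟩
    · rw [mean_eq, h.mean_P]
    · rw [mean_eq, h.mean_Q]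
    · rw [mean_eq, h.mean_R]
    · rw [mean_eq, h.mean_Pt]
    · rw [mean_eq, h.mean_Qt]
    · rw [mean_eq, h.mean_Rt]
    · rw [(weakDiv_iff_of_isField (fun i => C.isField_fluxP i j) x _).2 (h.eq_P j x) φ hφ,
        inner_zero_right]
    · rw [(weakDiv_iff_of_isField (fun i => C.isField_fluxQ i j k) x _).2 (h.eq_Q j k x) φ hφ,
        inner_rhsQ C hφ]
    · rw [(weakDiv_iff_of_isField (fun i => C.isField_fluxPt i j) x _).2 (h.eq_Pt j x) φ hφ,
        inner_rhsPt C hφ x h.smooth_P]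
    · rw [(weakDiv_iff_of_isField (fun i => C.isField_fluxQt i j k) x _).2 (h.eq_Qt j k x) φ hφ,
        inner_rhsQt C hφ x h.smooth_P h.smooth_Q]
    · rw [(weakDiv_iff_of_isField (fun i => C.isField_fluxR i j k l) x _).2 (h.eq_R j k l x) φ hφ,
        inner_rhsR C hφ]
    · rw [(weakDiv_iff_of_isField (fun i => C.isField_fluxRt i j) x _).2 (h.eq_Rt j x) φ hφ,
        inner_rhsRt C hφ x h.smooth_P h.smooth_Pt]

/-! ### Existence and uniqueness of the cell functions -/

/-- The system is triangular: `P` comes first, then `Q` and `P̃`, whose data involve `P`, and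
finally `Q̃`, `R`, `R̃`, whose data involve only those three. -/
lemma exists_solvesL2 (M : Medium d) : ∃ C : CellFunctions M, C.SolvesL2 := by
  choose P hP mP eP using fun j : Fin d => M.exists_cellSolution
    (f := fun i _ => δ i j • oneL2 M.ℓ) (g := fun _ => 0) (fun _ => contDiff_const) contDiff_const
    (fun _ => map_zero _)
  -- The zeros are placeholders. The sources for `Q` and `P̃` depend on `P` alone, so they agree
  -- definitionally with those of the final family.
  let C₁ : CellFunctions M := ⟨P, 0, 0, 0, 0, 0⟩
  choose Q hQ mQ eQ using fun j k : Fin d => M.exists_cellSolution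
    (f := fun i x => δ i j • valL (P k x)) (fun i => (contDiff_valL (hP k)).const_smul (δ i j))
    (contDiff_rhsQ (C := C₁) hP j k) (C₁.meanL_rhsQ j k)
  choose Pt hPt mPt ePt using fun j : Fin d => M.exists_cellSolution
    (f := fun i x => valL (pd i (P j) x)) (fun i => contDiff_valL (contDiff_pd (hP j) i))
    (contDiff_rhsPt (C := C₁) hP j) (meanL_rhsPt (C := C₁) hP j)
  -- The remaining three sources involve only `P`, `Q` and `P̃`, hence again do not see the
  -- placeholders.
  let C₂ : CellFunctions M := ⟨P, Q, 0, Pt, 0, 0⟩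
  choose Qt hQt mQt eQt using fun j k : Fin d => M.exists_cellSolution
    (f := fun i x => valL (pd i (Q j k) x) + δ i j • valL (Pt k x))
    (fun i => (contDiff_valL (contDiff_pd (hQ j k) i)).add
      ((contDiff_valL (hPt k)).const_smul (δ i j)))
    (contDiff_rhsQt (C := C₂) hP hQ hPt j k) (meanL_rhsQt (C := C₂) hP hQ j k)
  choose R hR mR eR using fun j k l : Fin d => M.exists_cellSolution
    (f := fun i x => δ i j • valL (Q k l x)) (fun i => (contDiff_valL (hQ k l)).const_smul (δ i j))
    (contDiff_rhsR (C := C₂) hP hQ j k l) (meanL_rhsR (C := C₂) j k l)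
  choose Rt hRt mRt eRt using fun j : Fin d => M.exists_cellSolution
    (f := fun i x => valL (pd i (Pt j) x)) (fun i => contDiff_valL (contDiff_pd (hPt j) i))
    (contDiff_rhsRt (C := C₂) hP hPt j) (meanL_rhsRt (C := C₂) hP hPt j)
  exact ⟨⟨P, Q, R, Pt, Qt, Rt⟩, hP, hQ, hR, hPt, hQt, hRt, mP, mQ, mR, mPt, mQt, mRt,
    eP, eQ, ePt, eQt, eR, eRt⟩

/-- Uniqueness follows the same triangular order: once the earlier components coincide, the next
problem has identical data for both families. -/
lemma SolvesL2.unique {C C' : CellFunctions M} (h : C.SolvesL2) (h' : C'.SolvesL2) : C = C' := by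
  obtain ⟨P, Q, R, Pt, Qt, Rt⟩ := C
  obtain ⟨P', Q', R', Pt', Qt', Rt'⟩ := C'
  have e1 : P = P' := by
    funext j x
    exact M.eq_of_weakDiv (h.eq_P j x) (h'.eq_P j x) ((h.mean_P j x).trans (h'.mean_P j x).symm)
  subst e1
  have e2 : Q = Q' := by
    funext j k x
    exact M.eq_of_weakDiv (h.eq_Q j k x) (h'.eq_Q j k x)
      ((h.mean_Q j k x).trans (h'.mean_Q j k x).symm)
  subst e2
  have e3 : Pt = Pt' := by
    funext j x
    exact M.eq_of_weakDiv (h.eq_Pt j x) (h'.eq_Pt j x)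
      ((h.mean_Pt j x).trans (h'.mean_Pt j x).symm)
  subst e3
  have e4 : Qt = Qt' := by
    funext j k x
    exact M.eq_of_weakDiv (h.eq_Qt j k x) (h'.eq_Qt j k x)
      ((h.mean_Qt j k x).trans (h'.mean_Qt j k x).symm)
  subst e4
  have e5 : R = R' := by
    funext j k l x
    exact M.eq_of_weakDiv (h.eq_R j k l x) (h'.eq_R j k l x)
      ((h.mean_R j k l x).trans (h'.mean_R j k l x).symm)
  subst e5
  have e6 : Rt = Rt' := by
    funext j x
    exact M.eq_of_weakDiv (h.eq_Rt j x) (h'.eq_Rt j x)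
      ((h.mean_Rt j x).trans (h'.mean_Rt j x).symm)
  subst e6
  rfl

lemma existsUnique_solves (M : Medium d) : ∃! C : CellFunctions M, C.Solves := by
  obtain ⟨C, hC⟩ := exists_solvesL2 M
  exact ⟨C, (solves_iff C).2 hC, fun C' hC' => ((solves_iff C').1 hC').unique hC⟩

lemma SolvesL2.smoothCoefficients {C : CellFunctions M} (h : C.SolvesL2) :
    C.SmoothCoefficients where
  rho0 := M.contDiff_rho0
  rho1 := contDiff_rho1 h.smooth_P
  rho2 j k := by
    rw [rho2_eq]
    exact (meanL M.ℓ).contDiff.comp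
      (M.contDiff_mulρ.clm_apply (contDiff_valL (h.smooth_Q j k)))
  rho2t j := by
    rw [rho2t_eq]
    exact (meanL M.ℓ).contDiff.comp (M.contDiff_mulρ.clm_apply (contDiff_valL (h.smooth_Pt j)))
  mu0 := contDiff_mu0 h.smooth_P
  mu1 := contDiff_mu1 h.smooth_P h.smooth_Q
  mu2 i j k l := by
    rw [mu2_eq]
    exact (meanL M.ℓ).contDiff.comp (contDiff_fieldR h.smooth_Q h.smooth_R i j k l)
  eta := contDiff_eta h.smooth_P h.smooth_Pt
  phi i j := by
    rw [phi_eq]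
    exact (meanL M.ℓ).contDiff.comp (contDiff_fieldRt h.smooth_Pt h.smooth_Rt i j)
  psi i j k := by
    rw [psi_eq]
    exact (meanL M.ℓ).contDiff.comp
      (contDiff_fieldQt h.smooth_Q h.smooth_Pt h.smooth_Qt i j k)

end CellFunctions

/-! ### Correctors and fluxes generated by a macroscopic field -/

lemma sum_delta_smul {E : Type*} [AddCommGroup E] [Module ℝ E] (i : Fin d) (X : Fin d → E) :
    ∑ j, δ i j • X j = X i := by
  simp [δ]

/-- Leibniz rule for a contraction. An arbitrary finite index type allows double and triple
contractions to be treated as single sums over pairs and triples. -/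
lemma pd_sum_smul {E : Type*} [NormedAddCommGroup E] [NormedSpace ℝ E] {ι : Type*} [Fintype ι]
    {c : ι → Pt d → ℝ} {X : ι → Pt d → E} (hc : ∀ t, ContDiff ℝ ∞ (c t))
    (hX : ∀ t, ContDiff ℝ ∞ (X t)) (i : Fin d) (x : Pt d) :
    pd i (fun z => ∑ t, c t z • X t z) x = ∑ t, c t x • pd i (X t) x + ∑ t, pd i (c t) x • X t x := by
  rw [pd_sum (f := fun t z => c t z • X t z) _ fun t _ => (((hc t).smul (hX t)).differentiable (by simp)) x,
    ← Finset.sum_add_distrib]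
  exact Finset.sum_congr rfl fun t _ => pd_smul ((hc t).differentiable (by simp) x)
    ((hX t).differentiable (by simp) x) i

lemma pd_sum_sum_smul {E : Type*} [NormedAddCommGroup E] [NormedSpace ℝ E]
    {c : Fin d → Fin d → Pt d → ℝ} {X : Fin d → Fin d → Pt d → E}
    (hc : ∀ j k, ContDiff ℝ ∞ (c j k)) (hX : ∀ j k, ContDiff ℝ ∞ (X j k)) (i : Fin d) (x : Pt d) :
    pd i (fun z => ∑ j, ∑ k, c j k z • X j k z) x
      = ∑ j, ∑ k, c j k x • pd i (X j k) x + ∑ j, ∑ k, pd i (c j k) x • X j k x := by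
  have h := pd_sum_smul (c := fun t : Fin d × Fin d => c t.1 t.2) (X := fun t => X t.1 t.2)
    (fun t => hc _ _) (fun t => hX _ _) i x
  simpa only [Fintype.sum_prod_type] using h

lemma pd_sum_sum_sum_smul {E : Type*} [NormedAddCommGroup E] [NormedSpace ℝ E]
    {c : Fin d → Fin d → Fin d → Pt d → ℝ} {X : Fin d → Fin d → Fin d → Pt d → E}
    (hc : ∀ j k l, ContDiff ℝ ∞ (c j k l)) (hX : ∀ j k l, ContDiff ℝ ∞ (X j k l))
    (i : Fin d) (x : Pt d) :
    pd i (fun z => ∑ j, ∑ k, ∑ l, c j k l z • X j k l z) x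
      = ∑ j, ∑ k, ∑ l, c j k l x • pd i (X j k l) x
        + ∑ j, ∑ k, ∑ l, pd i (c j k l) x • X j k l x := by
  have h := pd_sum_smul (c := fun t : Fin d × Fin d × Fin d => c t.1 t.2.1 t.2.2)
    (X := fun t => X t.1 t.2.1 t.2.2) (fun t => hc _ _ _) (fun t => hX _ _ _) i x
  simpa only [Fintype.sum_prod_type] using h

namespace CellFunctions

variable {M : Medium d} (C : CellFunctions M)

/-- `P · ∇v`. -/
def corr1 (v : Pt d → ℝ) (x : Pt d) : H1per M.ℓ := ∑ j, pd j v x • C.P j x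

/-- `Q : ∇∇v + P̃ · ∇v`. -/
def corr2 (v : Pt d → ℝ) (x : Pt d) : H1per M.ℓ :=
  ∑ j, ∑ k, pd j (pd k v) x • C.Q j k x + ∑ j, pd j v x • C.Ptil j x

/-- `R : ∇∇∇v + Q̃ : ∇∇v + R̃ · ∇v`. -/
def corr3 (v : Pt d → ℝ) (x : Pt d) : H1per M.ℓ :=
  ∑ j, ∑ k, ∑ l, pd j (pd k (pd l v)) x • C.R j k l x
    + ∑ j, ∑ k, pd j (pd k v) x • C.Qtil j k x + ∑ j, pd j v x • C.Rtil j x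

/-- The first-order flux generated by `v`. -/
def flux1 (v : Pt d → ℝ) (i : Fin d) (x : Pt d) : L2 M.ℓ := ∑ j, pd j v x • C.fieldP i j x

/-- The second-order flux generated by `v`. -/
def flux2 (v : Pt d → ℝ) (i : Fin d) (x : Pt d) : L2 M.ℓ :=
  ∑ j, ∑ k, pd j (pd k v) x • C.fieldQ i j k x + ∑ j, pd j v x • C.fieldPt i j x

/-- The third-order flux generated by `v`. -/
def flux3 (v : Pt d → ℝ) (i : Fin d) (x : Pt d) : L2 M.ℓ :=
  ∑ j, ∑ k, ∑ l, pd j (pd k (pd l v)) x • C.fieldR i j k l x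
    + ∑ j, ∑ k, pd j (pd k v) x • C.fieldQt i j k x + ∑ j, pd j v x • C.fieldRt i j x

/-- The slow divergence of the first-order flux. -/
def div1 (v : Pt d → ℝ) (x : Pt d) : L2 M.ℓ := ∑ i, pd i (C.flux1 v i) x

/-- The slow divergence of the second-order flux. -/
def div2 (v : Pt d → ℝ) (x : Pt d) : L2 M.ℓ := ∑ i, pd i (C.flux2 v i) x

/-- The slow divergence of the third-order flux. -/
def div3 (v : Pt d → ℝ) (x : Pt d) : L2 M.ℓ := ∑ i, pd i (C.flux3 v i) x

variable {C}

lemma contDiff_corr1 (h : C.SolvesL2) {v : Pt d → ℝ} (hv : ContDiff ℝ ∞ v) :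
    ContDiff ℝ ∞ (C.corr1 v) :=
  ContDiff.sum fun j _ => (contDiff_pd hv j).smul (h.smooth_P j)

lemma contDiff_corr2 (h : C.SolvesL2) {v : Pt d → ℝ} (hv : ContDiff ℝ ∞ v) :
    ContDiff ℝ ∞ (C.corr2 v) :=
  (ContDiff.sum fun j _ => ContDiff.sum fun k _ =>
    (contDiff_pd (contDiff_pd hv k) j).smul (h.smooth_Q j k)).add
    (ContDiff.sum fun j _ => (contDiff_pd hv j).smul (h.smooth_Pt j))

lemma contDiff_flux1 (h : C.SolvesL2) {v : Pt d → ℝ} (hv : ContDiff ℝ ∞ v) (i : Fin d) :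
    ContDiff ℝ ∞ (C.flux1 v i) :=
  ContDiff.sum fun j _ => (contDiff_pd hv j).smul (contDiff_fieldP h.smooth_P i j)

lemma contDiff_flux2 (h : C.SolvesL2) {v : Pt d → ℝ} (hv : ContDiff ℝ ∞ v) (i : Fin d) :
    ContDiff ℝ ∞ (C.flux2 v i) :=
  (ContDiff.sum fun j _ => ContDiff.sum fun k _ =>
    (contDiff_pd (contDiff_pd hv k) j).smul (contDiff_fieldQ h.smooth_P h.smooth_Q i j k)).add
    (ContDiff.sum fun j _ => (contDiff_pd hv j).smul (contDiff_fieldPt h.smooth_P h.smooth_Pt i j))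

lemma contDiff_flux3 (h : C.SolvesL2) {v : Pt d → ℝ} (hv : ContDiff ℝ ∞ v) (i : Fin d) :
    ContDiff ℝ ∞ (C.flux3 v i) :=
  ((ContDiff.sum fun j _ => ContDiff.sum fun k _ => ContDiff.sum fun l _ =>
    (contDiff_pd (contDiff_pd (contDiff_pd hv l) k) j).smul
      (contDiff_fieldR h.smooth_Q h.smooth_R i j k l)).add
    (ContDiff.sum fun j _ => ContDiff.sum fun k _ => (contDiff_pd (contDiff_pd hv k) j).smul
      (contDiff_fieldQt h.smooth_Q h.smooth_Pt h.smooth_Qt i j k))).add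
    (ContDiff.sum fun j _ => (contDiff_pd hv j).smul
      (contDiff_fieldRt h.smooth_Pt h.smooth_Rt i j))

lemma meanL_corr1 (h : C.SolvesL2) (v : Pt d → ℝ) (x : Pt d) :
    meanL M.ℓ (valL (C.corr1 v x)) = 0 := by
  simp [corr1, map_sum, h.mean_P]

lemma meanL_corr2 (h : C.SolvesL2) (v : Pt d → ℝ) (x : Pt d) :
    meanL M.ℓ (valL (C.corr2 v x)) = 0 := by
  simp [corr2, map_sum, h.mean_Q, h.mean_Pt]

lemma meanL_corr3 (h : C.SolvesL2) (v : Pt d → ℝ) (x : Pt d) :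
    meanL M.ℓ (valL (C.corr3 v x)) = 0 := by
  simp [corr3, map_sum, h.mean_R, h.mean_Qt, h.mean_Rt]

lemma pd_smul_one {v : Pt d → ℝ} (hv : ContDiff ℝ ∞ v) (i : Fin d) (x : Pt d) :
    pd i (fun z => v z • M.one) x = pd i v x • M.one := by
  rw [pd_smul (hv.differentiable (by simp) x) (differentiableAt_const _), pd_const, smul_zero,
    zero_add]

lemma pd_corr1 (h : C.SolvesL2) {v : Pt d → ℝ} (hv : ContDiff ℝ ∞ v) (i : Fin d) (x : Pt d) :
    pd i (C.corr1 v) x = ∑ j, pd j v x • pd i (C.P j) x + ∑ j, pd i (pd j v) x • C.P j x :=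
  pd_sum_smul (fun j => contDiff_pd hv j) h.smooth_P i x

lemma pd_corr2 (h : C.SolvesL2) {v : Pt d → ℝ} (hv : ContDiff ℝ ∞ v) (i : Fin d) (x : Pt d) :
    pd i (C.corr2 v) x = ∑ j, ∑ k, pd j (pd k v) x • pd i (C.Q j k) x
      + ∑ j, ∑ k, pd i (pd j (pd k v)) x • C.Q j k x
      + (∑ j, pd j v x • pd i (C.Ptil j) x + ∑ j, pd i (pd j v) x • C.Ptil j x) := by
  rw [← pd_sum_smul (fun j => contDiff_pd hv j) h.smooth_Pt i x,
    ← pd_sum_sum_smul (fun j k => contDiff_pd (contDiff_pd hv k) j) h.smooth_Q i x]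
  refine pd_add (ContDiff.differentiable (n := ∞) ?_ (by simp) x)
    (ContDiff.differentiable (n := ∞) ?_ (by simp) x) i
  · exact ContDiff.sum fun j _ => ContDiff.sum fun k _ =>
      (contDiff_pd (contDiff_pd hv k) j).smul (h.smooth_Q j k)
  · exact ContDiff.sum fun j _ => (contDiff_pd hv j).smul (h.smooth_Pt j)

/-- This and the two analogues below express that `G(∇_y corr_n + ∇_x corr_{n-1})` is the `n`-th
flux, with `v • 1` as the corrector of order zero. By Leibniz, a slow derivative falling on `v`
yields the Kronecker-delta terms of the fluxes, and one falling on a cell function yields the terms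
with `∇_x`. -/
lemma mulG_corr1 {v : Pt d → ℝ} (hv : ContDiff ℝ ∞ v) (i : Fin d) (x : Pt d) :
    M.mulG x (dyL i (C.corr1 v x) + valL (pd i (fun z => v z • M.one) x)) = C.flux1 v i x := by
  have e : pd i v x • M.mulG x (oneL2 M.ℓ) = ∑ j, pd j v x • δ i j • M.mulG x (oneL2 M.ℓ) := by
    rw [← sum_delta_smul i fun j => pd j v x • M.mulG x (oneL2 M.ℓ)]
    exact Finset.sum_congr rfl fun j _ => smul_comm _ _ _
  rw [pd_smul_one hv]
  simp only [corr1, flux1, fieldP, map_add, map_sum, map_smul, valL_oneH1, smul_add,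
    Finset.sum_add_distrib, e]
  abel

lemma mulG_corr2 (h : C.SolvesL2) {v : Pt d → ℝ} (hv : ContDiff ℝ ∞ v) (i : Fin d) (x : Pt d) :
    M.mulG x (dyL i (C.corr2 v x) + valL (pd i (C.corr1 v) x)) = C.flux2 v i x := by
  have e : ∑ k, pd i (pd k v) x • M.mulG x (valL (C.P k x))
      = ∑ j, ∑ k, pd j (pd k v) x • δ i j • M.mulG x (valL (C.P k x)) := by
    rw [← sum_delta_smul i fun j => ∑ k, pd j (pd k v) x • M.mulG x (valL (C.P k x))]
    refine Finset.sum_congr rfl fun j _ => ?_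
    rw [Finset.smul_sum]
    exact Finset.sum_congr rfl fun k _ => smul_comm _ _ _
  rw [pd_corr1 h hv]
  simp only [corr2, flux2, fieldQ, fieldPt, map_add, map_sum, map_smul, smul_add,
    Finset.sum_add_distrib, e]
  abel

lemma mulG_corr3 (h : C.SolvesL2) {v : Pt d → ℝ} (hv : ContDiff ℝ ∞ v) (i : Fin d) (x : Pt d) :
    M.mulG x (dyL i (C.corr3 v x) + valL (pd i (C.corr2 v) x)) = C.flux3 v i x := by
  have e1 : ∑ k, pd i (pd k v) x • M.mulG x (valL (C.Ptil k x))
      = ∑ j, ∑ k, pd j (pd k v) x • δ i j • M.mulG x (valL (C.Ptil k x)) := by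
    rw [← sum_delta_smul i fun j => ∑ k, pd j (pd k v) x • M.mulG x (valL (C.Ptil k x))]
    refine Finset.sum_congr rfl fun j _ => ?_
    rw [Finset.smul_sum]
    exact Finset.sum_congr rfl fun k _ => smul_comm _ _ _
  have e2 : ∑ k, ∑ l, pd i (pd k (pd l v)) x • M.mulG x (valL (C.Q k l x))
      = ∑ j, ∑ k, ∑ l, pd j (pd k (pd l v)) x • δ i j • M.mulG x (valL (C.Q k l x)) := by
    rw [← sum_delta_smul i fun j =>
      ∑ k, ∑ l, pd j (pd k (pd l v)) x • M.mulG x (valL (C.Q k l x))]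
    refine Finset.sum_congr rfl fun j _ => ?_
    rw [Finset.smul_sum]
    refine Finset.sum_congr rfl fun k _ => ?_
    rw [Finset.smul_sum]
    exact Finset.sum_congr rfl fun l _ => smul_comm _ _ _
  rw [pd_corr2 h hv]
  simp only [corr3, flux3, fieldR, fieldQt, fieldRt, map_add, map_sum, map_smul, smul_add,
    Finset.sum_add_distrib, e1, e2]
  abel

/-! ### The weak equations of the fluxes -/

lemma weakDiv_flux1 (h : C.SolvesL2) (v : Pt d → ℝ) (x : Pt d) :
    WeakDiv (fun i => C.flux1 v i x) 0 := by
  refine (WeakDiv.sum Finset.univ fun j _ => (h.eq_P j x).smul (pd j v x)).congr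
    (fun i => rfl) ?_
  simp

/-- The source in the weak equation of the second-order flux. -/
def source2 (C : CellFunctions M) (v : Pt d → ℝ) (x : Pt d) : L2 M.ℓ :=
  ∑ j, ∑ k, pd j (pd k v) x • C.rhsQ j k x + ∑ j, pd j v x • C.rhsPt j x

/-- The source in the weak equation of the third-order flux. -/
def source3 (C : CellFunctions M) (v : Pt d → ℝ) (x : Pt d) : L2 M.ℓ :=
  ∑ j, ∑ k, ∑ l, pd j (pd k (pd l v)) x • C.rhsR j k l x
    + ∑ j, ∑ k, pd j (pd k v) x • C.rhsQt j k x + ∑ j, pd j v x • C.rhsRt j x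

lemma weakDiv_flux2 (h : C.SolvesL2) (v : Pt d → ℝ) (x : Pt d) :
    WeakDiv (fun i => C.flux2 v i x) (C.source2 v x) :=
  (WeakDiv.sum _ fun j _ => WeakDiv.sum _ fun k _ => (h.eq_Q j k x).smul _).add
    (WeakDiv.sum _ fun j _ => (h.eq_Pt j x).smul _)

lemma weakDiv_flux3 (h : C.SolvesL2) (v : Pt d → ℝ) (x : Pt d) :
    WeakDiv (fun i => C.flux3 v i x) (C.source3 v x) :=
  ((WeakDiv.sum _ fun j _ => WeakDiv.sum _ fun k _ => WeakDiv.sum _ fun l _ =>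
    (h.eq_R j k l x).smul _).add
    (WeakDiv.sum _ fun j _ => WeakDiv.sum _ fun k _ => (h.eq_Qt j k x).smul _)).add
    (WeakDiv.sum _ fun j _ => (h.eq_Rt j x).smul _)

/-! ### The slow divergences of the fluxes -/

lemma sum_sum_smul_comm {E : Type*} [AddCommGroup E] [Module ℝ E] (a : Fin d → ℝ)
    (X : Fin d → Fin d → E) : ∑ i, ∑ j, a j • X i j = ∑ j, a j • ∑ i, X i j := by
  rw [Finset.sum_comm]
  exact Finset.sum_congr rfl fun j _ => Finset.smul_sum.symm

lemma sum_sum_sum_smul_comm {E : Type*} [AddCommGroup E] [Module ℝ E] (a : Fin d → Fin d → ℝ)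
    (X : Fin d → Fin d → Fin d → E) :
    ∑ i, ∑ j, ∑ k, a j k • X i j k = ∑ j, ∑ k, a j k • ∑ i, X i j k := by
  rw [Finset.sum_comm]
  exact Finset.sum_congr rfl fun j _ => sum_sum_smul_comm (a j) fun i k => X i j k

lemma sum_sum_sum_sum_smul_comm {E : Type*} [AddCommGroup E] [Module ℝ E]
    (a : Fin d → Fin d → Fin d → ℝ) (X : Fin d → Fin d → Fin d → Fin d → E) :
    ∑ i, ∑ j, ∑ k, ∑ l, a j k l • X i j k l = ∑ j, ∑ k, ∑ l, a j k l • ∑ i, X i j k l := by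
  rw [Finset.sum_comm]
  exact Finset.sum_congr rfl fun j _ => sum_sum_sum_smul_comm (a j) fun i k l => X i j k l

/-- Leibniz, with terms grouped by the order of differentiation of `v`. Taking means of this
expansion and its analogues for `div2` and `div3` reads off the coefficients of the effective
operators. -/
lemma div1_eq (h : C.SolvesL2) {v : Pt d → ℝ} (hv : ContDiff ℝ ∞ v) (x : Pt d) :
    C.div1 v x = ∑ j, pd j v x • ∑ i, pd i (C.fieldP i j) x
      + ∑ j, ∑ k, pd j (pd k v) x • C.fieldP j k x := by
  rw [← sum_sum_smul_comm, ← Finset.sum_add_distrib]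
  exact Finset.sum_congr rfl fun i _ => pd_sum_smul (fun j => contDiff_pd hv j)
    (fun j => contDiff_fieldP h.smooth_P i j) i x

lemma div2_eq (h : C.SolvesL2) {v : Pt d → ℝ} (hv : ContDiff ℝ ∞ v) (x : Pt d) :
    C.div2 v x = ∑ j, pd j v x • ∑ i, pd i (C.fieldPt i j) x
      + ∑ j, ∑ k, pd j (pd k v) x • (C.fieldPt j k x + ∑ i, pd i (C.fieldQ i j k) x)
      + ∑ j, ∑ k, ∑ l, pd j (pd k (pd l v)) x • C.fieldQ j k l x := by
  simp only [smul_add, Finset.sum_add_distrib]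
  rw [← sum_sum_smul_comm, ← sum_sum_sum_smul_comm]
  have e : ∀ i, pd i (C.flux2 v i) x
      = (∑ j, ∑ k, pd j (pd k v) x • pd i (C.fieldQ i j k) x
          + ∑ j, ∑ k, pd i (pd j (pd k v)) x • C.fieldQ i j k x)
        + (∑ j, pd j v x • pd i (C.fieldPt i j) x + ∑ j, pd i (pd j v) x • C.fieldPt i j x) := by
    intro i
    have c1 := fun j k => contDiff_fieldQ h.smooth_P h.smooth_Q i j k
    have c2 := fun j => contDiff_fieldPt h.smooth_P h.smooth_Pt i j
    rw [← pd_sum_smul (fun j => contDiff_pd hv j) c2 i x,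
      ← pd_sum_sum_smul (fun j k => contDiff_pd (contDiff_pd hv k) j) c1 i x]
    refine pd_add (ContDiff.differentiable (n := ∞) ?_ (by simp) x)
      (ContDiff.differentiable (n := ∞) ?_ (by simp) x) i
    · exact ContDiff.sum fun j _ => ContDiff.sum fun k _ =>
        (contDiff_pd (contDiff_pd hv k) j).smul (c1 j k)
    · exact ContDiff.sum fun j _ => (contDiff_pd hv j).smul (c2 j)
  rw [div2, Finset.sum_congr rfl fun i _ => e i]
  simp only [Finset.sum_add_distrib]
  abel

lemma div3_eq (h : C.SolvesL2) {v : Pt d → ℝ} (hv : ContDiff ℝ ∞ v) (x : Pt d) :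
    C.div3 v x = ∑ j, pd j v x • ∑ i, pd i (C.fieldRt i j) x
      + ∑ j, ∑ k, pd j (pd k v) x • (C.fieldRt j k x + ∑ i, pd i (C.fieldQt i j k) x)
      + ∑ j, ∑ k, ∑ l, pd j (pd k (pd l v)) x
          • (C.fieldQt j k l x + ∑ i, pd i (C.fieldR i j k l) x)
      + ∑ j, ∑ k, ∑ l, ∑ m, pd j (pd k (pd l (pd m v))) x • C.fieldR j k l m x := by
  simp only [smul_add, Finset.sum_add_distrib]
  rw [← sum_sum_smul_comm, ← sum_sum_sum_smul_comm, ← sum_sum_sum_sum_smul_comm]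
  have e : ∀ i, pd i (C.flux3 v i) x
      = (∑ j, ∑ k, ∑ l, pd j (pd k (pd l v)) x • pd i (C.fieldR i j k l) x
          + ∑ j, ∑ k, ∑ l, pd i (pd j (pd k (pd l v))) x • C.fieldR i j k l x)
        + (∑ j, ∑ k, pd j (pd k v) x • pd i (C.fieldQt i j k) x
          + ∑ j, ∑ k, pd i (pd j (pd k v)) x • C.fieldQt i j k x)
        + (∑ j, pd j v x • pd i (C.fieldRt i j) x + ∑ j, pd i (pd j v) x • C.fieldRt i j x) := by
    intro i
    have c1 := fun j k l => contDiff_fieldR h.smooth_Q h.smooth_R i j k l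
    have c2 := fun j k => contDiff_fieldQt h.smooth_Q h.smooth_Pt h.smooth_Qt i j k
    have c3 := fun j => contDiff_fieldRt h.smooth_Pt h.smooth_Rt i j
    have d1 := fun j k l => contDiff_pd (contDiff_pd (contDiff_pd hv l) k) j
    have d2 := fun j k => contDiff_pd (contDiff_pd hv k) j
    have d3 := fun j => contDiff_pd hv j
    have s1 : ContDiff ℝ ∞ fun z => ∑ j, ∑ k, ∑ l, pd j (pd k (pd l v)) z • C.fieldR i j k l z :=
      ContDiff.sum fun j _ => ContDiff.sum fun k _ => ContDiff.sum fun l _ =>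
        (d1 j k l).smul (c1 j k l)
    have s2 : ContDiff ℝ ∞ fun z => ∑ j, ∑ k, pd j (pd k v) z • C.fieldQt i j k z :=
      ContDiff.sum fun j _ => ContDiff.sum fun k _ => (d2 j k).smul (c2 j k)
    have s3 : ContDiff ℝ ∞ fun z => ∑ j, pd j v z • C.fieldRt i j z :=
      ContDiff.sum fun j _ => (d3 j).smul (c3 j)
    rw [← pd_sum_smul d3 c3 i x, ← pd_sum_sum_smul d2 c2 i x, ← pd_sum_sum_sum_smul d1 c1 i x,
      ← pd_add (s1.differentiable (by simp) x) (s2.differentiable (by simp) x)]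
    exact pd_add ((s1.add s2).differentiable (by simp) x) (s3.differentiable (by simp) x) i
  rw [div3, Finset.sum_congr rfl fun i _ => e i]
  simp only [Finset.sum_add_distrib]
  abel

end CellFunctions

namespace CellFunctions

variable {M : Medium d} {C : CellFunctions M}

/-! ### The mean of the slow divergences -/

lemma meanL_sum_pd_fieldP (h : C.SolvesL2) (j : Fin d) (x : Pt d) :
    meanL M.ℓ (∑ i, pd i (C.fieldP i j) x) = C.divMu0 j x := by
  rw [map_sum, divMu0]
  exact Finset.sum_congr rfl fun i _ => by
    rw [meanL_pd (contDiff_fieldP h.smooth_P i j), mu0_eq]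

lemma meanL_sum_pd_fieldQ (h : C.SolvesL2) (j k : Fin d) (x : Pt d) :
    meanL M.ℓ (∑ i, pd i (C.fieldQ i j k) x) = C.divMu1 j k x := by
  rw [map_sum, divMu1]
  exact Finset.sum_congr rfl fun i _ => by
    rw [meanL_pd (contDiff_fieldQ h.smooth_P h.smooth_Q i j k), mu1_eq]

lemma meanL_sum_pd_fieldPt (h : C.SolvesL2) (j : Fin d) (x : Pt d) :
    meanL M.ℓ (∑ i, pd i (C.fieldPt i j) x) = C.divEta j x := by
  rw [map_sum, divEta]
  exact Finset.sum_congr rfl fun i _ => by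
    rw [meanL_pd (contDiff_fieldPt h.smooth_P h.smooth_Pt i j), eta_eq]

lemma meanL_sum_pd_fieldR (h : C.SolvesL2) (j k l : Fin d) (x : Pt d) :
    meanL M.ℓ (∑ i, pd i (C.fieldR i j k l) x) = C.divMu2 j k l x := by
  rw [map_sum, divMu2]
  exact Finset.sum_congr rfl fun i _ => by
    rw [meanL_pd (contDiff_fieldR h.smooth_Q h.smooth_R i j k l), mu2_eq]

lemma meanL_sum_pd_fieldQt (h : C.SolvesL2) (j k : Fin d) (x : Pt d) :
    meanL M.ℓ (∑ i, pd i (C.fieldQt i j k) x) = C.divPsi j k x := by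
  rw [map_sum, divPsi]
  exact Finset.sum_congr rfl fun i _ => by
    rw [meanL_pd (contDiff_fieldQt h.smooth_Q h.smooth_Pt h.smooth_Qt i j k), psi_eq]

lemma meanL_sum_pd_fieldRt (h : C.SolvesL2) (j : Fin d) (x : Pt d) :
    meanL M.ℓ (∑ i, pd i (C.fieldRt i j) x) = C.divPhi j x := by
  rw [map_sum, divPhi]
  exact Finset.sum_congr rfl fun i _ => by
    rw [meanL_pd (contDiff_fieldRt h.smooth_Pt h.smooth_Rt i j), phi_eq]

lemma meanL_div1 (h : C.SolvesL2) {v : Pt d → ℝ} (hv : ContDiff ℝ ∞ v) (x : Pt d) :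
    meanL M.ℓ (C.div1 v x) = ∑ j, pd j v x * C.divMu0 j x
      + ∑ j, ∑ k, pd j (pd k v) x * C.mu0 j k x := by
  rw [div1_eq h hv]
  simp only [map_add, map_sum (meanL M.ℓ) (fun j => _ • _), map_sum (meanL M.ℓ) (fun j => ∑ k, _),
    map_smul, meanL_sum_pd_fieldP h, mu0_eq, smul_eq_mul]

lemma meanL_div2 (h : C.SolvesL2) {v : Pt d → ℝ} (hv : ContDiff ℝ ∞ v) (x : Pt d) :
    meanL M.ℓ (C.div2 v x) = ∑ j, pd j v x * C.divEta j x
      + ∑ j, ∑ k, pd j (pd k v) x * (C.eta j k x + C.divMu1 j k x)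
      + ∑ j, ∑ k, ∑ l, pd j (pd k (pd l v)) x * C.mu1 j k l x := by
  rw [div2_eq h hv, map_add, map_add, map_sum, map_sum, map_sum]
  congr 1
  · congr 1
    · exact Finset.sum_congr rfl fun j _ => by
        rw [map_smul, meanL_sum_pd_fieldPt h, smul_eq_mul]
    · refine Finset.sum_congr rfl fun j _ => ?_
      rw [map_sum]
      exact Finset.sum_congr rfl fun k _ => by
        rw [map_smul, map_add, meanL_sum_pd_fieldQ h, eta_eq, smul_eq_mul]
  · refine Finset.sum_congr rfl fun j _ => ?_
    simp only [map_sum, map_smul, mu1_eq, smul_eq_mul]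

lemma meanL_div3 (h : C.SolvesL2) {v : Pt d → ℝ} (hv : ContDiff ℝ ∞ v) (x : Pt d) :
    meanL M.ℓ (C.div3 v x) = ∑ j, pd j v x * C.divPhi j x
      + ∑ j, ∑ k, pd j (pd k v) x * (C.phi j k x + C.divPsi j k x)
      + ∑ j, ∑ k, ∑ l, pd j (pd k (pd l v)) x * (C.psi j k l x + C.divMu2 j k l x)
      + ∑ j, ∑ k, ∑ l, ∑ m, pd j (pd k (pd l (pd m v))) x * C.mu2 j k l m x := by
  rw [div3_eq h hv, map_add, map_add, map_add, map_sum, map_sum, map_sum, map_sum]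
  congr 1
  · congr 1
    · congr 1
      · exact Finset.sum_congr rfl fun j _ => by
          rw [map_smul, meanL_sum_pd_fieldRt h, smul_eq_mul]
      · refine Finset.sum_congr rfl fun j _ => ?_
        rw [map_sum]
        exact Finset.sum_congr rfl fun k _ => by
          rw [map_smul, map_add, meanL_sum_pd_fieldQt h, phi_eq, smul_eq_mul]
    · refine Finset.sum_congr rfl fun j _ => ?_
      rw [map_sum]
      refine Finset.sum_congr rfl fun k _ => ?_
      rw [map_sum]
      exact Finset.sum_congr rfl fun l _ => by
        rw [map_smul, map_add, meanL_sum_pd_fieldR h, psi_eq, smul_eq_mul]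
  · refine Finset.sum_congr rfl fun j _ => ?_
    simp only [map_sum, map_smul, mu2_eq, smul_eq_mul]

lemma meanL_mulρ_corr1 (v : Pt d → ℝ) (x : Pt d) :
    meanL M.ℓ (M.mulρ x (valL (C.corr1 v x))) = ∑ j, pd j v x * C.rho1 j x := by
  simp only [corr1, map_sum, map_smul, rho1_eq, smul_eq_mul]

lemma meanL_mulρ_corr2 (v : Pt d → ℝ) (x : Pt d) :
    meanL M.ℓ (M.mulρ x (valL (C.corr2 v x))) = ∑ j, ∑ k, pd j (pd k v) x * C.rho2 j k x
      + ∑ j, pd j v x * C.rho2t j x := by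
  simp only [corr2, map_add, map_sum, map_smul, rho2_eq, rho2t_eq, smul_eq_mul]

/-- Together with `op1_eq` and `op2_eq`, this shows that each effective operator is the mean of a
slow divergence of flux plus the mean inertia of the corrector one order below. The solvability
conditions appear in exactly this form. -/
lemma op0_eq (h : C.SolvesL2) (om : ℝ) {v : Pt d → ℝ} (hv : ContDiff ℝ ∞ v) (x : Pt d) :
    C.op0 om v x = meanL M.ℓ (C.div1 v x) + M.rho0 x * om ^ 2 * v x := by
  rw [op0, div1, map_sum]
  congr 1
  refine Finset.sum_congr rfl fun i _ => ?_
  rw [meanL_pd (contDiff_flux1 h hv i)]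
  congr 1
  funext z
  simp only [flux1, map_sum, map_smul, mu0_eq, smul_eq_mul, mul_comm]

lemma op1_eq (h : C.SolvesL2) (om : ℝ) {v : Pt d → ℝ} (hv : ContDiff ℝ ∞ v) (x : Pt d) :
    C.op1 om v x = meanL M.ℓ (C.div2 v x)
      + om ^ 2 * meanL M.ℓ (M.mulρ x (valL (C.corr1 v x))) := by
  rw [op1, meanL_div2 h hv, meanL_mulρ_corr1]
  simp only [mul_comm _ (pd _ _ x), mul_add, Finset.sum_add_distrib, Finset.mul_sum]
  simp only [mul_comm (om ^ 2), mul_assoc]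
  ring

lemma op2_eq (h : C.SolvesL2) (om : ℝ) {v : Pt d → ℝ} (hv : ContDiff ℝ ∞ v) (x : Pt d) :
    C.op2 om v x = meanL M.ℓ (C.div3 v x)
      + om ^ 2 * meanL M.ℓ (M.mulρ x (valL (C.corr2 v x))) := by
  rw [op2, meanL_div3 h hv, meanL_mulρ_corr2]
  simp only [mul_comm _ (pd _ _ x), mul_add, Finset.sum_add_distrib, Finset.mul_sum]
  simp only [mul_comm (om ^ 2), mul_assoc]
  ring

/-! ### The sources in terms of the slow divergences -/

/-- The right-hand sides for `Q` and `P̃` assemble, after contraction with the derivatives of `v`,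
into one slow divergence made compatible by a multiple of `ρ`. -/
lemma source2_eq (h : C.SolvesL2) {v : Pt d → ℝ} (hv : ContDiff ℝ ∞ v) (x : Pt d) :
    C.source2 v x = (meanL M.ℓ (C.div1 v x) / M.rho0 x) • M.ρField x - C.div1 v x := by
  rw [meanL_div1 h hv, div1_eq h hv]
  simp only [source2, rhsQ, rhsPt, smul_sub, Finset.sum_sub_distrib, add_div, add_smul,
    Finset.sum_div, Finset.sum_smul, mul_div_assoc, mul_smul]
  abel

lemma pd_meanL_div1_div (h : C.SolvesL2) {v : Pt d → ℝ} (hv : ContDiff ℝ ∞ v) (m : Fin d)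
    (x : Pt d) : pd m (fun z => meanL M.ℓ (C.div1 v z) / M.rho0 z) x
      = ∑ j, pd j v x * pd m (fun z => C.divMu0 j z / M.rho0 z) x
        + ∑ j, pd m (pd j v) x * (C.divMu0 j x / M.rho0 x)
        + (∑ j, ∑ k, pd j (pd k v) x * pd m (fun z => C.mu0 j k z / M.rho0 z) x
        + ∑ j, ∑ k, pd m (pd j (pd k v)) x * (C.mu0 j k x / M.rho0 x)) := by
  have c1 := fun j => contDiff_div (contDiff_divMu0 h.smooth_P j) M.contDiff_rho0 M.rho0_ne
  have c2 := fun j k => contDiff_div (contDiff_mu0 h.smooth_P j k) M.contDiff_rho0 M.rho0_ne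
  have d1 := fun j => contDiff_pd hv j
  have d2 := fun j k => contDiff_pd (contDiff_pd hv k) j
  have e : (fun z => meanL M.ℓ (C.div1 v z) / M.rho0 z)
      = fun z => (∑ j, pd j v z • (C.divMu0 j z / M.rho0 z))
        + ∑ j, ∑ k, pd j (pd k v) z • (C.mu0 j k z / M.rho0 z) := by
    funext z
    simp only [meanL_div1 h hv, add_div, Finset.sum_div, mul_div_assoc, smul_eq_mul]
  have s1 : ContDiff ℝ ∞ fun z => ∑ j, pd j v z • (C.divMu0 j z / M.rho0 z) :=
    ContDiff.sum fun j _ => (d1 j).smul (c1 j)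
  have s2 : ContDiff ℝ ∞ fun z => ∑ j, ∑ k, pd j (pd k v) z • (C.mu0 j k z / M.rho0 z) :=
    ContDiff.sum fun j _ => ContDiff.sum fun k _ => (d2 j k).smul (c2 j k)
  rw [e, pd_add (s1.differentiable (by simp) x) (s2.differentiable (by simp) x),
    pd_sum_smul d1 c1, pd_sum_sum_smul d2 c2]
  rfl

/-- The terms with `s` in the problems for `Q̃`, `R` and `R̃` are the four products in the Leibniz
expansion of `∇(⟨div1 v⟩/ϱ⁽⁰⁾)`. This explains their form. -/
lemma source3_eq (h : C.SolvesL2) {v : Pt d → ℝ} (hv : ContDiff ℝ ∞ v) (x : Pt d) :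
    C.source3 v x = (meanL M.ℓ (C.div2 v x) / M.rho0 x) • M.ρField x - C.div2 v x
      + ∑ m, pd m (fun z => meanL M.ℓ (C.div1 v z) / M.rho0 z) x • C.sourceField m x := by
  -- Leibniz puts the index of `s` on the outermost derivative, the problem for `R` on the innermost
  -- one.
  have hcomm : ∀ j k l, pd j (pd k (pd l v)) = pd l (pd j (pd k v)) := fun j k l => by
    rw [pd_comm (contDiff_infty.1 hv 2) k l, pd_comm (contDiff_infty.1 (contDiff_pd hv k) 2) j l]
  have e1 : ∑ m, (∑ j, ∑ k, pd m (pd j (pd k v)) x * (C.mu0 j k x / M.rho0 x)) • C.sourceField m x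
      = ∑ j, ∑ k, ∑ l, pd j (pd k (pd l v)) x • (C.mu0 j k x / M.rho0 x) • C.sourceField l x := by
    simp only [Finset.sum_smul, mul_smul]
    rw [Finset.sum_comm]
    refine Finset.sum_congr rfl fun j _ => ?_
    rw [Finset.sum_comm]
    exact Finset.sum_congr rfl fun k _ => Finset.sum_congr rfl fun l _ => by rw [hcomm j k l]
  have e2 : ∑ m, (∑ j, ∑ k, pd j (pd k v) x * pd m (fun z => C.mu0 j k z / M.rho0 z) x)
        • C.sourceField m x
      = ∑ j, ∑ k, pd j (pd k v) x
        • ∑ m, pd m (fun z => C.mu0 j k z / M.rho0 z) x • C.sourceField m x := by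
    simp only [Finset.sum_smul, mul_smul]
    exact sum_sum_sum_smul_comm (fun j k => pd j (pd k v) x)
      fun m j k => pd m (fun z => C.mu0 j k z / M.rho0 z) x • C.sourceField m x
  have e3 : ∑ m, (∑ j, pd m (pd j v) x * (C.divMu0 j x / M.rho0 x)) • C.sourceField m x
      = ∑ j, ∑ k, pd j (pd k v) x • (C.divMu0 k x / M.rho0 x) • C.sourceField j x := by
    simp only [Finset.sum_smul, mul_smul]
  have e4 : ∑ m, (∑ j, pd j v x * pd m (fun z => C.divMu0 j z / M.rho0 z) x) • C.sourceField m x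
      = ∑ j, pd j v x • ∑ m, pd m (fun z => C.divMu0 j z / M.rho0 z) x • C.sourceField m x := by
    simp only [Finset.sum_smul, mul_smul]
    exact sum_sum_smul_comm (fun j => pd j v x)
      fun m j => pd m (fun z => C.divMu0 j z / M.rho0 z) x • C.sourceField m x
  simp only [pd_meanL_div1_div h hv, add_smul, Finset.sum_add_distrib, e1, e2, e3, e4]
  rw [meanL_div2 h hv, div2_eq h hv]
  simp only [source3, rhsR, rhsQt, rhsRt, smul_sub, smul_add, Finset.sum_sub_distrib,
    Finset.sum_add_distrib, add_div, add_smul, Finset.sum_div, Finset.sum_smul, mul_div_assoc,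
    mul_smul, mul_add]
  abel

end CellFunctions

/-! ### The orders of the two-scale wave equation -/

section Orders

variable {M : Medium d}

/-- The flux `G (∇_y w + ∇_x v)`. -/
def twoScaleFlux (M : Medium d) (v w : TwoScale M.ℓ) (i : Fin d) (x : Pt d) : L2 M.ℓ :=
  M.mulG x (dyL i (w x) + valL (pd i v x))

lemma contDiff_mulG_dyL {u : TwoScale M.ℓ} (hu : ContDiff ℝ ∞ u) (i : Fin d) :
    ContDiff ℝ ∞ fun x => M.mulG x (dyL i (u x)) :=
  M.contDiff_mulG.clm_apply (CellFunctions.contDiff_dyL hu i)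

lemma contDiff_mulG_pd {u : TwoScale M.ℓ} (hu : ContDiff ℝ ∞ u) (i : Fin d) :
    ContDiff ℝ ∞ fun x => M.mulG x (valL (pd i u x)) :=
  M.contDiff_mulG.clm_apply (CellFunctions.contDiff_valL (contDiff_pd hu i))

lemma opYY_eq (u : TwoScale M.ℓ) {φ : Pt d → ℝ} (hφ : IsTest M.ℓ φ) (x : Pt d) :
    opYY M u φ x = -∑ i, ⟪toL2 M.ℓ (pd i φ), M.mulG x (dyL i (u x))⟫ :=
  IsField.divY_eq (fun i => M.isField_mulG (M.isField_dy i u)) hφ x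

lemma opXY_eq {u : TwoScale M.ℓ} (hu : ContDiff ℝ ∞ u) {φ : Pt d → ℝ} (hφ : IsTest M.ℓ φ)
    (x : Pt d) : opXY M u φ x
      = ⟪toL2 M.ℓ φ, ∑ i, pd i (fun z => M.mulG z (dyL i (u z))) x⟫
        - ∑ i, ⟪toL2 M.ℓ (pd i φ), M.mulG x (valL (pd i u x))⟫ := by
  rw [opXY, IsField.divX_eq (fun i => M.isField_mulG (M.isField_dy i u))
    (contDiff_mulG_dyL hu) hφ,
    IsField.divY_eq (fun i => M.isField_mulG (M.isField_val (pd i u))) hφ, ← sub_eq_add_neg]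

lemma opXX_eq (om : ℝ) {u : TwoScale M.ℓ} (hu : ContDiff ℝ ∞ u) {φ : Pt d → ℝ}
    (hφ : IsTest M.ℓ φ) (x : Pt d) : opXX M om u φ x
      = ⟪toL2 M.ℓ φ, om ^ 2 • M.mulρ x (valL (u x))
        + ∑ i, pd i (fun z => M.mulG z (valL (pd i u z))) x⟫ := by
  rw [opXX, IsField.divX_eq (fun i => M.isField_mulG (M.isField_val (pd i u)))
    (contDiff_mulG_pd hu) hφ,
    (M.isField_mulρ (M.isField_val u)).pair_eq hφ.smooth.continuous, inner_add_right,
    inner_smul_right]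

variable {om : ℝ} {u : ℕ → TwoScale M.ℓ}

namespace IsExpansion

lemma weakDiv_zero (h : IsExpansion M om u) (x : Pt d) :
    WeakDiv (fun i => M.mulG x (dyL i (u 0 x))) 0 := by
  intro φ hφ
  have h1 := h.order_eq 0 (by norm_num) φ hφ x
  simp only [orderCoeff, opYY_eq _ hφ] at h1
  rw [inner_zero_right]
  simpa using h1

lemma weakDiv_one (h : IsExpansion M om u) (x : Pt d) :
    WeakDiv (fun i => twoScaleFlux M (u 0) (u 1) i x)
      (-∑ i, pd i (fun z => M.mulG z (dyL i (u 0 z))) x) := by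
  intro φ hφ
  have h1 := h.order_eq 1 (by norm_num) φ hφ x
  simp only [orderCoeff, opYY_eq _ hφ, opXY_eq (h.smooth 0 (by norm_num)) hφ, le_refl, if_true,
    tsub_self, show ¬ (2 ≤ 1) by norm_num, if_false, add_zero] at h1
  simp only [twoScaleFlux, map_add, inner_add_right, Finset.sum_add_distrib, inner_neg_right]
  linarith

/-- The fast divergences of order `n + 2` combine into that of the flux of `(u_{n+1}, u_{n+2})`, and
the slow ones into that of the preceding flux. Thus each flux drives the next equation. -/
lemma weakDiv_add_two (h : IsExpansion M om u) {n : ℕ} (hn : n + 2 ≤ 4) (x : Pt d) :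
    WeakDiv (fun i => twoScaleFlux M (u (n + 1)) (u (n + 2)) i x)
      (-∑ i, pd i (twoScaleFlux M (u n) (u (n + 1)) i) x - om ^ 2 • M.mulρ x (valL (u n x))) := by
  intro φ hφ
  have h1 := h.order_eq (n + 2) hn φ hφ x
  have s0 := h.smooth n (by omega)
  have s1 := h.smooth (n + 1) (by omega)
  simp only [orderCoeff, opYY_eq _ hφ, show n + 2 - 1 = n + 1 by omega, show n + 2 - 2 = n by omega,
    opXY_eq s1 hφ, opXX_eq om s0 hφ, show 1 ≤ n + 2 by omega, show 2 ≤ n + 2 by omega,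
    if_true] at h1
  have e : ∀ i, pd i (twoScaleFlux M (u n) (u (n + 1)) i) x
      = pd i (fun z => M.mulG z (dyL i (u (n + 1) z))) x
        + pd i (fun z => M.mulG z (valL (pd i (u n) z))) x := by
    intro i
    rw [← pd_add ((contDiff_mulG_dyL s1 i).differentiable (by simp) x)
      ((contDiff_mulG_pd s0 i).differentiable (by simp) x)]
    congr 1
    funext z
    rw [twoScaleFlux, map_add]
  rw [Finset.sum_congr rfl fun i _ => e i, Finset.sum_add_distrib]
  simp only [twoScaleFlux, map_add, inner_add_right, Finset.sum_add_distrib, inner_neg_right,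
    inner_sub_right, inner_add_right] at h1 ⊢
  linarith

end IsExpansion

/-- A field is determined by its flux problem up to its mean. -/
lemma eq_mean_add_of_weakDiv {v w : TwoScale M.ℓ} {x : Pt d} {g : L2 M.ℓ} {r : H1per M.ℓ}
    (h : WeakDiv (fun i => twoScaleFlux M v w i x) g)
    (h' : WeakDiv (fun i => M.mulG x (dyL i r + valL (pd i v x))) g)
    (hr : meanL M.ℓ (valL r) = 0) : w x = meanL M.ℓ (valL (w x)) • M.one + r := by
  refine M.eq_of_weakDiv (x := x) (f := fun i => valL (pd i v x)) (g := g)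
    (h.congr (fun i => ?_) rfl) (h'.congr (fun i => ?_) rfl) ?_
  · rw [twoScaleFlux, add_comm]
  · rw [map_add (dyL i), map_smul, dyL_oneH1, smul_zero, zero_add, add_comm]
  · rw [map_add, map_add, map_smul, map_smul, valL_oneH1, M.meanL_oneL2, hr]
    simp

lemma twoScaleFlux_of_eq {v w : TwoScale M.ℓ} {x : Pt d} {c : ℝ} {r : H1per M.ℓ}
    (h : w x = c • M.one + r) (i : Fin d) :
    twoScaleFlux M v w i x = M.mulG x (dyL i r + valL (pd i v x)) := by
  rw [twoScaleFlux, h, map_add (dyL i), map_smul, dyL_oneH1, smul_zero, zero_add]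

lemma mulρ_valL_smul_one (c : ℝ) (x : Pt d) : M.mulρ x (valL (c • M.one)) = c • M.ρField x := by
  rw [map_smul, map_smul, valL_oneH1]
  rfl

end Orders

/-! ### The mean-field equations -/

lemma meanField_eq (M : Medium d) (u : TwoScale M.ℓ) :
    meanField M u = fun x => meanL M.ℓ (valL (u x)) :=
  funext fun x => mean_eq (u x)

lemma contDiff_meanField {M : Medium d} {u : TwoScale M.ℓ} (hu : ContDiff ℝ ∞ u) :
    ContDiff ℝ ∞ (meanField M u) := by
  rw [meanField_eq]
  exact (meanL M.ℓ).contDiff.comp (CellFunctions.contDiff_valL hu)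

namespace CellFunctions

variable {M : Medium d} {C : CellFunctions M} {om : ℝ} {u : ℕ → TwoScale M.ℓ}

/-- The leading equation is homogeneous, so `u₀` does not oscillate in `y`. -/
lemma expansion_zero (hu : IsExpansion M om u) :
    u 0 = fun x => meanField M (u 0) x • M.one := by
  funext x
  rw [meanField_eq]
  exact M.eq_mean_smul_one (hu.weakDiv_zero x)

lemma flux_zero (hu : IsExpansion M om u) (i : Fin d) :
    (fun z => M.mulG z (dyL i (u 0 z))) = fun _ => 0 := by
  funext z
  rw [expansion_zero hu, map_smul, dyL_oneH1, smul_zero, map_zero]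

lemma mulG_one (hu : IsExpansion M om u) (i : Fin d) (x : Pt d) :
    M.mulG x (dyL i (C.corr1 (meanField M (u 0)) x) + valL (pd i (u 0) x))
      = C.flux1 (meanField M (u 0)) i x := by
  have e := mulG_corr1 (C := C) (contDiff_meanField (hu.smooth 0 (by norm_num))) i x
  rwa [← expansion_zero hu] at e

lemma expansion_one (h : C.SolvesL2) (hu : IsExpansion M om u) :
    u 1 = fun x => meanField M (u 1) x • M.one + C.corr1 (meanField M (u 0)) x := by
  funext x
  rw [meanField_eq M (u 1)]
  refine eq_mean_add_of_weakDiv (hu.weakDiv_one x) ?_ (meanL_corr1 h _ x)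
  refine (weakDiv_flux1 h (meanField M (u 0)) x).congr (fun i => (mulG_one hu i x).symm) ?_
  simp [flux_zero hu, pd_const]

lemma flux_one (h : C.SolvesL2) (hu : IsExpansion M om u) (i : Fin d) :
    twoScaleFlux M (u 0) (u 1) i = C.flux1 (meanField M (u 0)) i := by
  funext x
  rw [twoScaleFlux_of_eq (congrFun (expansion_one h hu) x), mulG_one hu]

lemma rhs_two (h : C.SolvesL2) (hu : IsExpansion M om u) (x : Pt d) :
    -∑ i, pd i (twoScaleFlux M (u 0) (u 1) i) x - om ^ 2 • M.mulρ x (valL (u 0 x))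
      = -C.div1 (meanField M (u 0)) x - (om ^ 2 * meanField M (u 0) x) • M.ρField x := by
  simp only [flux_one h hu]
  conv_lhs => rw [congrFun (expansion_zero hu) x]
  rw [mulρ_valL_smul_one, smul_smul, div1]

/-- Solvability of the problem for `u₂`. -/
lemma mean_two (h : C.SolvesL2) (hu : IsExpansion M om u) (x : Pt d) :
    meanL M.ℓ (C.div1 (meanField M (u 0)) x) + M.rho0 x * om ^ 2 * meanField M (u 0) x = 0 := by
  have h1 := (hu.weakDiv_add_two (n := 0) (by norm_num) x).meanL_eq_zero
  rw [zero_add, rhs_two h hu, map_sub, map_neg, map_smul, M.meanL_ρField, smul_eq_mul] at h1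
  linarith

lemma mulG_two (h : C.SolvesL2) (hu : IsExpansion M om u) (i : Fin d) (x : Pt d) :
    M.mulG x (dyL i (C.corr1 (meanField M (u 1)) x + C.corr2 (meanField M (u 0)) x)
        + valL (pd i (u 1) x))
      = C.flux1 (meanField M (u 1)) i x + C.flux2 (meanField M (u 0)) i x := by
  have h0 := contDiff_meanField (hu.smooth 0 (by norm_num))
  have h1 := contDiff_meanField (hu.smooth 1 (by norm_num))
  have e : pd i (u 1) x = pd i (fun z => meanField M (u 1) z • M.one) x
      + pd i (C.corr1 (meanField M (u 0))) x := by
    rw [← pd_add (f := fun z => meanField M (u 1) z • M.one)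
      ((h1.smul contDiff_const).differentiable (by simp) x)
      ((contDiff_corr1 h h0).differentiable (by simp) x), ← expansion_one h hu]
  rw [e, ← mulG_corr1 h1, ← mulG_corr2 h h0]
  simp only [map_add]
  abel

/-- `P·∇⟨u₁⟩` contributes a divergence-free flux, and `Q:∇∇⟨u₀⟩ + P̃·∇⟨u₀⟩` carries the source. The
sources match because `mean_two` replaces `-ω²⟨u₀⟩` by `⟨div1⟩/ϱ⁽⁰⁾`. -/
lemma expansion_two (h : C.SolvesL2) (hu : IsExpansion M om u) :
    u 2 = fun x => meanField M (u 2) x • M.one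
      + (C.corr1 (meanField M (u 1)) x + C.corr2 (meanField M (u 0)) x) := by
  have h0 := contDiff_meanField (hu.smooth 0 (by norm_num))
  funext x
  rw [meanField_eq M (u 2)]
  refine eq_mean_add_of_weakDiv (hu.weakDiv_add_two (n := 0) (by norm_num) x) ?_ ?_
  · refine ((weakDiv_flux1 h (meanField M (u 1)) x).add
      (weakDiv_flux2 h (meanField M (u 0)) x)).congr (fun i => (mulG_two h hu i x).symm) ?_
    rw [zero_add, rhs_two h hu, source2_eq h h0, neg_sub_left, sub_eq_add_neg, add_comm, neg_add,
      ← neg_smul, add_comm (-_)]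
    congr 2
    rw [div_eq_iff (M.rho0_ne x)]
    linarith [mean_two h hu x]
  · rw [map_add, map_add, meanL_corr1 h, meanL_corr2 h, add_zero]

lemma flux_two (h : C.SolvesL2) (hu : IsExpansion M om u) (i : Fin d) :
    twoScaleFlux M (u 1) (u 2) i
      = fun x => C.flux1 (meanField M (u 1)) i x + C.flux2 (meanField M (u 0)) i x := by
  funext x
  rw [twoScaleFlux_of_eq (congrFun (expansion_two h hu) x), mulG_two h hu]

lemma rhs_three (h : C.SolvesL2) (hu : IsExpansion M om u) (x : Pt d) :
    -∑ i, pd i (twoScaleFlux M (u 1) (u 2) i) x - om ^ 2 • M.mulρ x (valL (u 1 x))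
      = -C.div1 (meanField M (u 1)) x - C.div2 (meanField M (u 0)) x
        - (om ^ 2 * meanField M (u 1) x) • M.ρField x
        - om ^ 2 • M.mulρ x (valL (C.corr1 (meanField M (u 0)) x)) := by
  have h0 := contDiff_meanField (hu.smooth 0 (by norm_num))
  have h1 := contDiff_meanField (hu.smooth 1 (by norm_num))
  have e : ∀ i, pd i (twoScaleFlux M (u 1) (u 2) i) x
      = pd i (C.flux1 (meanField M (u 1)) i) x + pd i (C.flux2 (meanField M (u 0)) i) x := by
    intro i
    rw [flux_two h hu, ← pd_add ((contDiff_flux1 h h1 i).differentiable (by simp) x)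
      ((contDiff_flux2 h h0 i).differentiable (by simp) x)]
  rw [Finset.sum_congr rfl fun i _ => e i, Finset.sum_add_distrib]
  conv_lhs => rw [congrFun (expansion_one h hu) x]
  rw [map_add valL, map_add (M.mulρ x), mulρ_valL_smul_one, smul_add, smul_smul, div1, div2]
  abel

lemma mean_three (h : C.SolvesL2) (hu : IsExpansion M om u) (x : Pt d) :
    meanL M.ℓ (C.div1 (meanField M (u 1)) x) + M.rho0 x * om ^ 2 * meanField M (u 1) x
      = -(meanL M.ℓ (C.div2 (meanField M (u 0)) x)
        + om ^ 2 * meanL M.ℓ (M.mulρ x (valL (C.corr1 (meanField M (u 0)) x)))) := by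
  have h1 := (hu.weakDiv_add_two (n := 1) (by norm_num) x).meanL_eq_zero
  norm_num only at h1
  rw [rhs_three h hu] at h1
  simp only [map_sub, map_neg, map_smul, M.meanL_ρField, smul_eq_mul] at h1
  linarith

lemma mulG_three (h : C.SolvesL2) (hu : IsExpansion M om u) (i : Fin d) (x : Pt d) :
    M.mulG x (dyL i (C.corr1 (meanField M (u 2)) x + (C.corr2 (meanField M (u 1)) x
        + C.corr3 (meanField M (u 0)) x)) + valL (pd i (u 2) x))
      = C.flux1 (meanField M (u 2)) i x + (C.flux2 (meanField M (u 1)) i x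
        + C.flux3 (meanField M (u 0)) i x) := by
  have h0 := contDiff_meanField (hu.smooth 0 (by norm_num))
  have h1 := contDiff_meanField (hu.smooth 1 (by norm_num))
  have h2 := contDiff_meanField (hu.smooth 2 (by norm_num))
  have c1 := contDiff_corr1 h h1
  have c2 := contDiff_corr2 h h0
  have e : pd i (u 2) x = pd i (fun z => meanField M (u 2) z • M.one) x
      + (pd i (C.corr1 (meanField M (u 1))) x + pd i (C.corr2 (meanField M (u 0))) x) := by
    rw [← pd_add (c1.differentiable (by simp) x) (c2.differentiable (by simp) x),
      ← pd_add (f := fun z => meanField M (u 2) z • M.one)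
      ((h2.smul contDiff_const).differentiable (by simp) x)
      ((c1.add c2).differentiable (by simp) x), ← expansion_two h hu]
  rw [e, ← mulG_corr1 h2, ← mulG_corr2 h h1, ← mulG_corr3 h h0]
  simp only [map_add]
  abel

/-- The cell problems know nothing of `ω`, whereas the third-order equation contains the inertia of
`u₁`. The lower mean-field equations convert one into the other. -/
lemma source_three (h : C.SolvesL2) (hu : IsExpansion M om u) (x : Pt d) :
    C.source2 (meanField M (u 1)) x + C.source3 (meanField M (u 0)) x
      = -C.div1 (meanField M (u 1)) x - C.div2 (meanField M (u 0)) x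
        - (om ^ 2 * meanField M (u 1) x) • M.ρField x
        - om ^ 2 • M.mulρ x (valL (C.corr1 (meanField M (u 0)) x)) := by
  have h0 := contDiff_meanField (hu.smooth 0 (by norm_num))
  have h1 := contDiff_meanField (hu.smooth 1 (by norm_num))
  -- The equation for `⟨u₀⟩` holds at every point, so its consequence may be differentiated in `x`.
  have e0 : (fun z => meanL M.ℓ (C.div1 (meanField M (u 0)) z) / M.rho0 z)
      = fun z => (-om ^ 2) * meanField M (u 0) z := by
    funext z
    rw [div_eq_iff (M.rho0_ne z)]
    linarith [mean_two h hu z]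
  have e1 : ∀ m, pd m (fun z => meanL M.ℓ (C.div1 (meanField M (u 0)) z) / M.rho0 z) x
      = (-om ^ 2) * pd m (meanField M (u 0)) x := by
    intro m
    rw [e0, pd_const_mul _ (h0.differentiable (by simp) x)]
  -- Contraction of `s` with `-ω²∇⟨u₀⟩` gives the inertia of the first corrector plus a multiple of
  -- `ρ` that compensates its mean.
  have e2 : ∑ m, (-om ^ 2 * pd m (meanField M (u 0)) x) • C.sourceField m x
      = -(om ^ 2 • M.mulρ x (valL (C.corr1 (meanField M (u 0)) x)))
        + (om ^ 2 * meanL M.ℓ (M.mulρ x (valL (C.corr1 (meanField M (u 0)) x))) / M.rho0 x)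
          • M.ρField x := by
    rw [meanL_mulρ_corr1]
    simp only [corr1, sourceField, map_sum, map_smul, smul_sub, neg_mul, neg_smul,
      Finset.smul_sum, smul_smul, Finset.mul_sum, Finset.sum_div, Finset.sum_smul, sub_neg_eq_add,
      mul_assoc, mul_div_assoc, ← Finset.sum_neg_distrib, ← Finset.sum_add_distrib]
  -- `mean_three` divided by `ϱ⁽⁰⁾`; its last term cancels the compensating multiple of `ρ` from
  -- `e2`.
  have e3 : meanL M.ℓ (C.div1 (meanField M (u 1)) x) / M.rho0 x
      + meanL M.ℓ (C.div2 (meanField M (u 0)) x) / M.rho0 x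
      = -(om ^ 2 * meanField M (u 1) x)
        - om ^ 2 * meanL M.ℓ (M.mulρ x (valL (C.corr1 (meanField M (u 0)) x))) / M.rho0 x := by
    have := mean_three h hu x
    have := M.rho0_ne x
    field_simp
    linarith
  rw [source2_eq h h1, source3_eq h h0, Finset.sum_congr rfl fun m _ => by rw [e1 m], e2]
  rw [← eq_sub_iff_add_eq] at e3
  rw [e3]
  module

lemma expansion_three (h : C.SolvesL2) (hu : IsExpansion M om u) :
    u 3 = fun x => meanField M (u 3) x • M.one + (C.corr1 (meanField M (u 2)) x
      + (C.corr2 (meanField M (u 1)) x + C.corr3 (meanField M (u 0)) x)) := by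
  funext x
  rw [meanField_eq M (u 3)]
  refine eq_mean_add_of_weakDiv (hu.weakDiv_add_two (n := 1) (by norm_num) x) ?_ ?_
  · refine ((weakDiv_flux1 h (meanField M (u 2)) x).add
      ((weakDiv_flux2 h (meanField M (u 1)) x).add
        (weakDiv_flux3 h (meanField M (u 0)) x))).congr (fun i => (mulG_three h hu i x).symm) ?_
    rw [zero_add, source_three h hu, ← rhs_three h hu]
  · simp only [map_add, meanL_corr1 h, meanL_corr2 h, meanL_corr3 h, add_zero]

lemma flux_three (h : C.SolvesL2) (hu : IsExpansion M om u) (i : Fin d) :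
    twoScaleFlux M (u 2) (u 3) i = fun x => C.flux1 (meanField M (u 2)) i x
      + (C.flux2 (meanField M (u 1)) i x + C.flux3 (meanField M (u 0)) i x) := by
  funext x
  rw [twoScaleFlux_of_eq (congrFun (expansion_three h hu) x), mulG_three h hu]

/-- Solvability at order four. Both `u₄` and `∇_x u₃` occur only under the fast divergence and
disappear on averaging, so the flux of `(u₂, u₃)` and the field `u₂` suffice. -/
lemma mean_four (h : C.SolvesL2) (hu : IsExpansion M om u) (x : Pt d) :
    meanL M.ℓ (C.div1 (meanField M (u 2)) x) + M.rho0 x * om ^ 2 * meanField M (u 2) x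
      = -(meanL M.ℓ (C.div2 (meanField M (u 1)) x)
        + om ^ 2 * meanL M.ℓ (M.mulρ x (valL (C.corr1 (meanField M (u 1)) x))))
        - (meanL M.ℓ (C.div3 (meanField M (u 0)) x)
        + om ^ 2 * meanL M.ℓ (M.mulρ x (valL (C.corr2 (meanField M (u 0)) x)))) := by
  have h0 := contDiff_meanField (hu.smooth 0 (by norm_num))
  have h1 := contDiff_meanField (hu.smooth 1 (by norm_num))
  have h2 := contDiff_meanField (hu.smooth 2 (by norm_num))
  have e : ∀ i, pd i (twoScaleFlux M (u 2) (u 3) i) x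
      = pd i (C.flux1 (meanField M (u 2)) i) x + (pd i (C.flux2 (meanField M (u 1)) i) x
        + pd i (C.flux3 (meanField M (u 0)) i) x) := by
    intro i
    have c2 := contDiff_flux2 h h1 i
    have c3 := contDiff_flux3 h h0 i
    rw [flux_three h hu, ← pd_add (c2.differentiable (by simp) x) (c3.differentiable (by simp) x),
      ← pd_add ((contDiff_flux1 h h2 i).differentiable (by simp) x)
      ((c2.add c3).differentiable (by simp) x)]
  have h4 := (hu.weakDiv_add_two (n := 2) (by norm_num) x).meanL_eq_zero
  norm_num only at h4
  rw [Finset.sum_congr rfl fun i _ => e i, Finset.sum_add_distrib, Finset.sum_add_distrib,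
    congrFun (expansion_two h hu) x, map_add valL, map_add (M.mulρ x), mulρ_valL_smul_one] at h4
  simp only [map_sub, map_neg, map_smul, map_add, M.meanL_ρField, smul_eq_mul] at h4
  simp only [div1, div2, div3]
  linarith

lemma mean_field_equations (h : C.SolvesL2) (hu : IsExpansion M om u) :
    (∀ x, C.op0 om (meanField M (u 0)) x = 0) ∧
    (∀ x, C.op0 om (meanField M (u 1)) x = -C.op1 om (meanField M (u 0)) x) ∧
    ∀ x, C.op0 om (meanField M (u 2)) x = -C.op1 om (meanField M (u 1)) x
      - C.op2 om (meanField M (u 0)) x := by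
  have h0 := contDiff_meanField (hu.smooth 0 (by norm_num))
  have h1 := contDiff_meanField (hu.smooth 1 (by norm_num))
  have h2 := contDiff_meanField (hu.smooth 2 (by norm_num))
  refine ⟨fun x => ?_, fun x => ?_, fun x => ?_⟩
  · rw [op0_eq h om h0, mean_two h hu]
  · rw [op0_eq h om h1, op1_eq h om h0, mean_three h hu]
  · rw [op0_eq h om h2, op1_eq h om h1, op2_eq h om h0, mean_four h hu]

/-! ### The representation of the terms of the expansion -/

/-- Passage from identities in `L²(Y)` to identities for almost every `y`, as the representation
formulas require. -/
lemma coeFn_sum_smul {ι : Type*} (s : Finset ι) (a : ι → ℝ) (f : ι → L2 ℓ) :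
    (∑ t ∈ s, a t • f t : L2 ℓ) =ᵐ[cellMeasure ℓ] fun y => ∑ t ∈ s, f t y * a t := by
  classical
  induction s using Finset.induction_on with
  | empty =>
    filter_upwards [Lp.coeFn_zero ℝ 2 (cellMeasure ℓ)] with y hy
    simpa using hy
  | insert t s ht ih =>
    rw [Finset.sum_insert ht]
    filter_upwards [ih, Lp.coeFn_add (a t • f t) (∑ t ∈ s, a t • f t), Lp.coeFn_smul (a t) (f t)]
      with y h1 h2 h3
    rw [h2, Pi.add_apply, h3, h1, Finset.sum_insert ht, Pi.smul_apply, smul_eq_mul, mul_comm]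

lemma coeFn_sum_sum_smul (a : Fin d → Fin d → ℝ) (f : Fin d → Fin d → L2 ℓ) :
    (∑ j, ∑ k, a j k • f j k : L2 ℓ) =ᵐ[cellMeasure ℓ] fun y => ∑ j, ∑ k, f j k y * a j k := by
  have h := coeFn_sum_smul Finset.univ (fun t : Fin d × Fin d => a t.1 t.2) fun t => f t.1 t.2
  simpa only [Fintype.sum_prod_type] using h

lemma coeFn_sum_sum_sum_smul (a : Fin d → Fin d → Fin d → ℝ)
    (f : Fin d → Fin d → Fin d → L2 ℓ) :
    (∑ j, ∑ k, ∑ l, a j k l • f j k l : L2 ℓ)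
      =ᵐ[cellMeasure ℓ] fun y => ∑ j, ∑ k, ∑ l, f j k l y * a j k l := by
  have h := coeFn_sum_smul Finset.univ (fun t : Fin d × Fin d × Fin d => a t.1 t.2.1 t.2.2)
    fun t => f t.1 t.2.1 t.2.2
  simpa only [Fintype.sum_prod_type] using h

lemma coeFn_smul_one (M : Medium d) (c : ℝ) :
    valL (c • M.one) =ᵐ[cellMeasure M.ℓ] fun _ => c := by
  rw [map_smul, valL_oneH1]
  exact (M.isField_const c 0).symm

lemma coeFn_corr1 (v : Pt d → ℝ) (x : Pt d) : valL (C.corr1 v x) =ᵐ[cellMeasure M.ℓ]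
    fun y => ∑ j, val (C.P j x) y * pd j v x := by
  simp only [corr1, map_sum, map_smul]
  exact coeFn_sum_smul _ _ _

lemma coeFn_corr2 (v : Pt d → ℝ) (x : Pt d) : valL (C.corr2 v x) =ᵐ[cellMeasure M.ℓ]
    fun y => ∑ j, ∑ k, val (C.Q j k x) y * pd j (pd k v) x
      + ∑ j, val (C.Ptil j x) y * pd j v x := by
  simp only [corr2, map_add, map_sum, map_smul]
  exact (Lp.coeFn_add _ _).trans ((coeFn_sum_sum_smul _ _).add (coeFn_sum_smul _ _ _))

lemma coeFn_corr3 (v : Pt d → ℝ) (x : Pt d) : valL (C.corr3 v x) =ᵐ[cellMeasure M.ℓ]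
    fun y => ∑ j, ∑ k, ∑ l, val (C.R j k l x) y * pd j (pd k (pd l v)) x
      + ∑ j, ∑ k, val (C.Qtil j k x) y * pd j (pd k v) x
      + ∑ j, val (C.Rtil j x) y * pd j v x := by
  simp only [corr3, map_add, map_sum, map_smul]
  exact (Lp.coeFn_add _ _).trans (((Lp.coeFn_add _ _).trans
    ((coeFn_sum_sum_sum_smul _ _).add (coeFn_sum_sum_smul _ _))).add (coeFn_sum_smul _ _ _))

lemma represents (h : C.SolvesL2) (hu : IsExpansion M om u) : C.Represents u where
  repr0 x := by
    have e := congrArg valL (congrFun (expansion_zero hu) x)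
    rw [← valL_apply, e]
    exact coeFn_smul_one M _
  repr1 x := by
    have e := congrArg valL (congrFun (expansion_one h hu) x)
    rw [map_add] at e
    rw [← valL_apply, e]
    filter_upwards [Lp.coeFn_add (valL (meanField M (u 1) x • M.one))
      (valL (C.corr1 (meanField M (u 0)) x)), coeFn_smul_one M (meanField M (u 1) x),
      coeFn_corr1 (C := C) (meanField M (u 0)) x] with y h1 h2 h3
    rw [h1, Pi.add_apply, h2, h3]
  repr2 x := by
    have e := congrArg valL (congrFun (expansion_two h hu) x)
    rw [map_add, map_add] at e
    rw [← valL_apply, e]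
    filter_upwards [Lp.coeFn_add (valL (meanField M (u 2) x • M.one))
      (valL (C.corr1 (meanField M (u 1)) x) + valL (C.corr2 (meanField M (u 0)) x)),
      Lp.coeFn_add (valL (C.corr1 (meanField M (u 1)) x)) (valL (C.corr2 (meanField M (u 0)) x)),
      coeFn_smul_one M (meanField M (u 2) x), coeFn_corr1 (C := C) (meanField M (u 1)) x,
      coeFn_corr2 (C := C) (meanField M (u 0)) x] with y h1 h2 h3 h4 h5
    rw [h1, Pi.add_apply, h2, Pi.add_apply, h3, h4, h5]
    ring
  repr3 x := by
    have e := congrArg valL (congrFun (expansion_three h hu) x)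
    rw [map_add, map_add, map_add] at e
    rw [← valL_apply, e]
    filter_upwards [Lp.coeFn_add (valL (meanField M (u 3) x • M.one))
      (valL (C.corr1 (meanField M (u 2)) x) + (valL (C.corr2 (meanField M (u 1)) x)
        + valL (C.corr3 (meanField M (u 0)) x))),
      Lp.coeFn_add (valL (C.corr1 (meanField M (u 2)) x)) (valL (C.corr2 (meanField M (u 1)) x)
        + valL (C.corr3 (meanField M (u 0)) x)),
      Lp.coeFn_add (valL (C.corr2 (meanField M (u 1)) x)) (valL (C.corr3 (meanField M (u 0)) x)),
      coeFn_smul_one M (meanField M (u 3) x), coeFn_corr1 (C := C) (meanField M (u 2)) x,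
      coeFn_corr2 (C := C) (meanField M (u 1)) x, coeFn_corr3 (C := C) (meanField M (u 0)) x]
      with y h1 h2 h3 h4 h5 h6 h7
    rw [h1, Pi.add_apply, h2, Pi.add_apply, h3, Pi.add_apply, h4, h5, h6, h7]
    ring

end CellFunctions

/-! ### The effective equation -/

section Jets

/-- A partial derivative is the Fréchet derivative followed by evaluation at a unit vector, a
functional of norm at most one. -/
lemma norm_iteratedFDeriv_pd_le {f : Pt d → ℝ} {n m : ℕ} (hf : ContDiff ℝ n f) (hm : m + 1 ≤ n)
    (i : Fin d) (x : Pt d) :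
    ‖iteratedFDeriv ℝ m (pd i f) x‖ ≤ ‖iteratedFDeriv ℝ (m + 1) f x‖ := by
  have h1 : ContDiff ℝ m (fderiv ℝ f) := hf.fderiv_right (by exact_mod_cast hm)
  have h2 := (ContinuousLinearMap.apply ℝ ℝ
    (EuclideanSpace.single i (1 : ℝ) : Pt d)).norm_iteratedFDeriv_comp_left (n := m)
    h1.contDiffAt (x := x) le_rfl
  have h3 : ‖ContinuousLinearMap.apply ℝ ℝ (EuclideanSpace.single i (1 : ℝ) : Pt d)‖ ≤ 1 := by
    refine ContinuousLinearMap.opNorm_le_bound _ zero_le_one fun L => ?_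
    have := L.le_opNorm (EuclideanSpace.single i (1 : ℝ) : Pt d)
    simpa using this
  rw [norm_iteratedFDeriv_fderiv] at h2
  exact h2.trans (mul_le_of_le_one_left (norm_nonneg _) h3)

/-- All partial derivatives of `w` at `x` up to the fourth order are at most `b`. -/
structure JetBound (w : Pt d → ℝ) (x : Pt d) (b : ℝ) : Prop where
  zero : |w x| ≤ b
  one : ∀ i, |pd i w x| ≤ b
  two : ∀ i j, |pd i (pd j w) x| ≤ b
  three : ∀ i j k, |pd i (pd j (pd k w)) x| ≤ b
  four : ∀ i j k l, |pd i (pd j (pd k (pd l w))) x| ≤ b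

lemma JetBound.of_iteratedFDeriv {w : Pt d → ℝ} {x : Pt d} {b : ℝ} (hw : ContDiff ℝ 4 w)
    (h : ∀ m ≤ 4, ‖iteratedFDeriv ℝ m w x‖ ≤ b) : JetBound w x b := by
  have c3 : ∀ i, ContDiff ℝ (3 : ℕ) (pd i w) := fun i => contDiff_pd_of_le hw (by norm_num) i
  have c2 : ∀ i j, ContDiff ℝ (2 : ℕ) (pd i (pd j w)) := fun i j =>
    contDiff_pd_of_le (c3 j) (by norm_num) i
  have c1 : ∀ i j k, ContDiff ℝ (1 : ℕ) (pd i (pd j (pd k w))) := fun i j k =>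
    contDiff_pd_of_le (c2 j k) (by norm_num) i
  have b1 : ∀ m ≤ 3, ∀ i, ‖iteratedFDeriv ℝ m (pd i w) x‖ ≤ b := fun m hm i =>
    (norm_iteratedFDeriv_pd_le (n := 4) hw (by omega) i x).trans (h _ (by omega))
  have b2 : ∀ m ≤ 2, ∀ i j, ‖iteratedFDeriv ℝ m (pd i (pd j w)) x‖ ≤ b := fun m hm i j =>
    (norm_iteratedFDeriv_pd_le (c3 j) (by omega) i x).trans (b1 _ (by omega) j)
  have b3 : ∀ m ≤ 1, ∀ i j k, ‖iteratedFDeriv ℝ m (pd i (pd j (pd k w))) x‖ ≤ b :=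
    fun m hm i j k => (norm_iteratedFDeriv_pd_le (c2 j k) (by omega) i x).trans
      (b2 _ (by omega) j k)
  have b4 : ∀ i j k l, ‖iteratedFDeriv ℝ 0 (pd i (pd j (pd k (pd l w)))) x‖ ≤ b :=
    fun i j k l => (norm_iteratedFDeriv_pd_le (c1 j k l) (by omega) i x).trans
      (b3 _ (by omega) j k l)
  have e : ∀ f : Pt d → ℝ, |f x| = ‖iteratedFDeriv ℝ 0 f x‖ := fun f => by
    rw [norm_iteratedFDeriv_zero, Real.norm_eq_abs]
  exact ⟨(e _).trans_le (h 0 (by norm_num)), fun i => (e _).trans_le (b1 0 (by norm_num) i),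
    fun i j => (e _).trans_le (b2 0 (by norm_num) i j),
    fun i j k => (e _).trans_le (b3 0 (by norm_num) i j k), fun i j k l => (e _).trans_le
      (b4 i j k l)⟩

end Jets

/-- An operator that is linear on `C⁴` functions, maps them to continuous functions, and is bounded
on compact sets by the derivatives up to the fourth order. -/
structure IsFourthOrder (T : (Pt d → ℝ) → Pt d → ℝ) : Prop where
  add_smul : ∀ v w : Pt d → ℝ, ContDiff ℝ 4 v → ContDiff ℝ 4 w → ∀ c x,
    T (fun z => v z + c * w z) x = T v x + c * T w x
  continuous : ∀ v : Pt d → ℝ, ContDiff ℝ 4 v → Continuous (T v)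
  bound : ∀ K : Set (Pt d), IsCompact K → ∃ B, 0 ≤ B ∧ ∀ w x b, x ∈ K → JetBound w x b →
    |T w x| ≤ B * b

lemma pd_add_const_mul {v w : Pt d → ℝ} {n : WithTop ℕ∞} (hv : ContDiff ℝ n v)
    (hw : ContDiff ℝ n w) (hn : n ≠ 0) (c : ℝ) (i : Fin d) :
    pd i (fun z => v z + c * w z) = fun z => pd i v z + c * pd i w z := by
  funext x
  rw [pd_add (g := fun z => c * w z) (hv.differentiable hn x)
    ((hw.differentiable hn x).const_mul c), pd_const_mul c (hw.differentiable hn x)]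

/-! ### Differential operators of order at most four -/

namespace IsFourthOrder

variable {T T' : (Pt d → ℝ) → Pt d → ℝ}

lemma of_pure (h : ∀ v w : Pt d → ℝ, ContDiff ℝ 4 v → ContDiff ℝ 4 w → ∀ c,
      T (fun z => v z + c * w z) = fun z => T v z + c * T w z)
    (hc : ∀ v : Pt d → ℝ, ContDiff ℝ 4 v → Continuous (T v))
    (hb : ∀ w x b, JetBound w x b → |T w x| ≤ b) : IsFourthOrder T :=
  ⟨fun v w hv hw c x => congrFun (h v w hv hw c) x, hc, fun _ _ => ⟨1, zero_le_one,
    fun w x b _ hw => (hb w x b hw).trans_eq (one_mul b).symm⟩⟩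

lemma id : IsFourthOrder fun v : Pt d → ℝ => v :=
  of_pure (fun _ _ _ _ _ => rfl) (fun _ hv => hv.continuous) fun _ _ _ h => h.zero

lemma pd1 (i : Fin d) : IsFourthOrder fun v => pd i v :=
  of_pure (fun _ _ hv hw c => pd_add_const_mul hv hw (by norm_num) c i)
    (fun _ hv => (contDiff_pd_of_le (m := 3) hv (by norm_num) i).continuous) fun _ _ _ h => h.one i

lemma pd2 (i j : Fin d) : IsFourthOrder fun v => pd i (pd j v) := by
  have c3 : ∀ {v : Pt d → ℝ}, ContDiff ℝ 4 v → ContDiff ℝ 3 (pd j v) := fun hv =>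
    contDiff_pd_of_le hv (by norm_num) j
  refine of_pure (fun v w hv hw c => ?_)
    (fun _ hv => (contDiff_pd_of_le (m := 2) (c3 hv) (by norm_num) i).continuous)
    fun _ _ _ h => h.two i j
  rw [pd_add_const_mul hv hw (by norm_num),
    pd_add_const_mul (c3 hv) (c3 hw) (by norm_num)]

lemma pd3 (i j k : Fin d) : IsFourthOrder fun v => pd i (pd j (pd k v)) := by
  have c3 : ∀ {v : Pt d → ℝ}, ContDiff ℝ 4 v → ContDiff ℝ 3 (pd k v) := fun hv =>
    contDiff_pd_of_le hv (by norm_num) k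
  have c2 : ∀ {v : Pt d → ℝ}, ContDiff ℝ 4 v → ContDiff ℝ 2 (pd j (pd k v)) := fun hv =>
    contDiff_pd_of_le (c3 hv) (by norm_num) j
  refine of_pure (fun v w hv hw c => ?_)
    (fun _ hv => (contDiff_pd_of_le (m := 1) (c2 hv) (by norm_num) i).continuous)
    fun _ _ _ h => h.three i j k
  rw [pd_add_const_mul hv hw (by norm_num), pd_add_const_mul (c3 hv) (c3 hw) (by norm_num),
    pd_add_const_mul (c2 hv) (c2 hw) (by norm_num)]

lemma pd4 (i j k l : Fin d) : IsFourthOrder fun v => pd i (pd j (pd k (pd l v))) := by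
  have c3 : ∀ {v : Pt d → ℝ}, ContDiff ℝ 4 v → ContDiff ℝ 3 (pd l v) := fun hv =>
    contDiff_pd_of_le hv (by norm_num) l
  have c2 : ∀ {v : Pt d → ℝ}, ContDiff ℝ 4 v → ContDiff ℝ 2 (pd k (pd l v)) := fun hv =>
    contDiff_pd_of_le (c3 hv) (by norm_num) k
  have c1 : ∀ {v : Pt d → ℝ}, ContDiff ℝ 4 v → ContDiff ℝ 1 (pd j (pd k (pd l v))) := fun hv =>
    contDiff_pd_of_le (c2 hv) (by norm_num) j
  refine of_pure (fun v w hv hw c => ?_)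
    (fun _ hv => (contDiff_pd_of_le (m := 0) (c1 hv) (by norm_num) i).continuous)
    fun _ _ _ h => h.four i j k l
  rw [pd_add_const_mul hv hw (by norm_num), pd_add_const_mul (c3 hv) (c3 hw) (by norm_num),
    pd_add_const_mul (c2 hv) (c2 hw) (by norm_num), pd_add_const_mul (c1 hv) (c1 hw) (by norm_num)]

lemma add (h : IsFourthOrder T) (h' : IsFourthOrder T') :
    IsFourthOrder fun v x => T v x + T' v x where
  add_smul v w hv hw c x := by
    rw [h.add_smul v w hv hw, h'.add_smul v w hv hw]
    ring
  continuous v hv := (h.continuous v hv).add (h'.continuous v hv)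
  bound K hK := by
    obtain ⟨B, hB, h1⟩ := h.bound K hK
    obtain ⟨B', hB', h2⟩ := h'.bound K hK
    refine ⟨B + B', add_nonneg hB hB', fun w x b hx hw => ?_⟩
    rw [add_mul]
    exact (abs_add_le _ _).trans (add_le_add (h1 w x b hx hw) (h2 w x b hx hw))

lemma zero : IsFourthOrder fun (_ : Pt d → ℝ) (_ : Pt d) => (0 : ℝ) where
  add_smul := by simp
  continuous _ _ := continuous_const
  bound _ _ := ⟨0, le_rfl, by simp⟩

lemma sum {ι : Type*} (s : Finset ι) {T : ι → (Pt d → ℝ) → Pt d → ℝ}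
    (h : ∀ t, IsFourthOrder (T t)) : IsFourthOrder fun v x => ∑ t ∈ s, T t v x := by
  classical
  induction s using Finset.induction_on with
  | empty => simpa using zero
  | insert t s ht ih => simpa only [Finset.sum_insert ht] using (h t).add ih

lemma coeff_mul {a : Pt d → ℝ} (ha : Continuous a) (h : IsFourthOrder T) :
    IsFourthOrder fun v x => a x * T v x where
  add_smul v w hv hw c x := by
    rw [h.add_smul v w hv hw]
    ring
  continuous v hv := ha.mul (h.continuous v hv)
  bound K hK := by
    obtain ⟨B, hB, h1⟩ := h.bound K hK
    obtain ⟨A, hA⟩ := hK.exists_bound_of_continuousOn ha.continuousOn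
    refine ⟨|A| * B, mul_nonneg (abs_nonneg A) hB, fun w x b hx hw => ?_⟩
    rw [abs_mul, mul_assoc]
    exact mul_le_mul ((hA x hx).trans (le_abs_self A)) (h1 w x b hx hw) (abs_nonneg _)
      (abs_nonneg A)

lemma apply_expansion (h : IsFourthOrder T) {v₀ v₁ v₂ U : Pt d → ℝ} (h₀ : ContDiff ℝ 4 v₀)
    (h₁ : ContDiff ℝ 4 v₁) (h₂ : ContDiff ℝ 4 v₂) (hU : ContDiff ℝ 4 U) (ε : ℝ) (x : Pt d) :
    T U x = T v₀ x + ε * T v₁ x + ε ^ 2 * T v₂ x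
      + T (fun z => U z - (v₀ z + ε * v₁ z + ε ^ 2 * v₂ z)) x := by
  have c1 : ContDiff ℝ 4 fun z => v₀ z + ε * v₁ z := h₀.add (contDiff_const.mul h₁)
  have c2 : ContDiff ℝ 4 fun z => v₀ z + ε * v₁ z + ε ^ 2 * v₂ z := c1.add (contDiff_const.mul h₂)
  -- `U` is written as the partial sum plus `1` times the remainder.
  have e := h.add_smul _ _ c2 (hU.sub c2) 1 x
  simp only [one_mul, add_sub_cancel] at e
  rw [e, h.add_smul _ _ c1 h₂, h.add_smul _ _ h₀ h₁]

end IsFourthOrder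

/-- If `v₀, v₁, v₂` solve the hierarchy of the operators `T₀, T₁, T₂`, a family with the expansion
`v₀ + ε v₁ + ε² v₂` solves the effective equation up to terms of third order. -/
theorem HasSecondOrderExpansion.effective_equation {T₀ T₁ T₂ : (Pt d → ℝ) → Pt d → ℝ}
    (t₀ : IsFourthOrder T₀) (t₁ : IsFourthOrder T₁) (t₂ : IsFourthOrder T₂)
    {v : ℕ → Pt d → ℝ} (hv : ∀ k ≤ 2, ContDiff ℝ 4 (v k))
    (e₀ : ∀ x, T₀ (v 0) x = 0) (e₁ : ∀ x, T₀ (v 1) x = -T₁ (v 0) x)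
    (e₂ : ∀ x, T₀ (v 2) x = -T₁ (v 1) x - T₂ (v 0) x)
    {K : Set (Pt d)} (hK : IsCompact K) {U : ℝ → Pt d → ℝ} (hU : HasSecondOrderExpansion K v U) :
    ∃ B : ℝ, ∀ᶠ ε in 𝓝[>] (0 : ℝ), ∀ x ∈ K,
      |T₀ (U ε) x - (-ε * T₁ (U ε) x - ε ^ 2 * T₂ (U ε) x)| ≤ B * ε ^ 3 := by
  have v₀ := hv 0 (by norm_num)
  have v₁ := hv 1 (by norm_num)
  have v₂ := hv 2 le_rfl
  obtain ⟨A, hA⟩ := hU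
  obtain ⟨B₀, _, b₀⟩ := t₀.bound K hK
  obtain ⟨B₁, _, b₁⟩ := t₁.bound K hK
  obtain ⟨B₂, _, b₂⟩ := t₂.bound K hK
  -- The three terms that the hierarchy does not cancel: `T₁ v₂` and `T₂ v₁` at order `ε³`, and `T₂
  -- v₂` at order `ε⁴`.
  obtain ⟨D₁, d₁⟩ := hK.exists_bound_of_continuousOn (t₁.continuous _ v₂).continuousOn
  obtain ⟨D₂, d₂⟩ := hK.exists_bound_of_continuousOn (t₂.continuous _ v₁).continuousOn
  obtain ⟨D₃, d₃⟩ := hK.exists_bound_of_continuousOn (t₂.continuous _ v₂).continuousOn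
  refine ⟨D₁ + D₂ + D₃ + (B₀ * A + B₁ * A + B₂ * A), ?_⟩
  -- Restricting to `ε < 1` absorbs surplus powers of `ε` into the constant.
  filter_upwards [hA, self_mem_nhdsWithin,
    mem_nhdsWithin_of_mem_nhds (Iio_mem_nhds (zero_lt_one' ℝ))] with ε hε hpos hlt x hx
  obtain ⟨hUε, hW⟩ := hε
  simp only [mem_Ioi, mem_Iio] at hpos hlt
  have hj := JetBound.of_iteratedFDeriv
    (hUε.sub (ContDiff.sum fun k hk => contDiff_const.mul (hv k (by grind)))) (hW x hx)
  simp only [Finset.sum_range_succ, Finset.sum_range_zero, zero_add, pow_zero, one_mul,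
    pow_one] at hj
  have w₀ := b₀ _ x _ hx hj
  have w₁ := b₁ _ x _ hx hj
  have w₂ := b₂ _ x _ hx hj
  rw [t₀.apply_expansion v₀ v₁ v₂ hUε ε, t₁.apply_expansion v₀ v₁ v₂ hUε ε,
    t₂.apply_expansion v₀ v₁ v₂ hUε ε, e₀, e₁, e₂]
  set W := fun z => U ε z - (v 0 z + ε * v 1 z + ε ^ 2 * v 2 z)
  -- After substitution of the hierarchy, the orders `ε` and `ε²` cancel identically.
  have e : 0 + ε * -T₁ (v 0) x + ε ^ 2 * (-T₁ (v 1) x - T₂ (v 0) x) + T₀ W x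
      - (-ε * (T₁ (v 0) x + ε * T₁ (v 1) x + ε ^ 2 * T₁ (v 2) x + T₁ W x)
        - ε ^ 2 * (T₂ (v 0) x + ε * T₂ (v 1) x + ε ^ 2 * T₂ (v 2) x + T₂ W x))
      = ε ^ 3 * (T₁ (v 2) x + T₂ (v 1) x + ε * T₂ (v 2) x)
        + (T₀ W x + ε * T₁ W x + ε ^ 2 * T₂ W x) := by ring
  have hmul : ∀ {a b c : ℝ}, 0 ≤ a → a ≤ 1 → |b| ≤ c → |a * b| ≤ c := fun h0 h1 hb => by
    rw [abs_mul, abs_of_nonneg h0]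
    exact (mul_le_of_le_one_left (abs_nonneg _) h1).trans hb
  have f1 := d₁ x hx
  have f2 := d₂ x hx
  have f3 := hmul hpos.le hlt.le (d₃ x hx)
  have f4 := hmul hpos.le hlt.le w₁
  have f5 := hmul (sq_nonneg ε) (pow_le_one₀ hpos.le hlt.le) w₂
  rw [Real.norm_eq_abs] at f1 f2
  rw [e]
  calc _ ≤ |ε ^ 3 * (T₁ (v 2) x + T₂ (v 1) x + ε * T₂ (v 2) x)|
        + |T₀ W x + ε * T₁ W x + ε ^ 2 * T₂ W x| := abs_add_le _ _
    _ ≤ ε ^ 3 * (D₁ + D₂ + D₃) + (B₀ * (A * ε ^ 3) + B₁ * (A * ε ^ 3) + B₂ * (A * ε ^ 3)) := by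
      refine add_le_add ?_ ?_
      · rw [abs_mul, abs_of_nonneg (pow_nonneg hpos.le 3)]
        refine mul_le_mul_of_nonneg_left ?_ (pow_nonneg hpos.le 3)
        exact (abs_add_three _ _ _).trans (add_le_add (add_le_add f1 f2) f3)
      · exact (abs_add_three _ _ _).trans (add_le_add (add_le_add w₀ f4) f5)
    _ = _ := by ring

/-! ### The effective operators as fourth-order operators -/

namespace CellFunctions

variable {M : Medium d} {C : CellFunctions M}

/-- The operator `L₀` in non-divergence form. -/
def op0Sum (C : CellFunctions M) (om : ℝ) (v : Pt d → ℝ) (x : Pt d) : ℝ :=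
  ∑ i, ∑ j, (C.mu0 i j x * pd i (pd j v) x + pd i (C.mu0 i j) x * pd j v x)
    + M.rho0 x * om ^ 2 * v x

/-- `IsFourthOrder` demands a bound by pointwise values of derivatives, without any
differentiability of the argument. The divergence form does not provide this; the expanded form
does, and the two agree on `C⁴` functions. -/
lemma op0_eq_sum (h : C.SmoothCoefficients) {om : ℝ} {v : Pt d → ℝ} (hv : ContDiff ℝ 4 v) (x : Pt d) :
    C.op0 om v x = C.op0Sum om v x := by
  have c3 : ∀ i, ContDiff ℝ 3 (pd i v) := fun i => contDiff_pd_of_le hv (by norm_num) i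
  rw [op0, op0Sum]
  congr 1
  refine Finset.sum_congr rfl fun i _ => ?_
  rw [pd_sum (f := fun j z => C.mu0 i j z * pd j v z) _ fun j _ => ((h.mu0 i j).differentiable (by simp) x).mul
    ((c3 j).differentiable (by simp) x)]
  exact Finset.sum_congr rfl fun j _ => pd_mul' ((h.mu0 i j).differentiable (by simp) x)
    ((c3 j).differentiable (by simp) x) i

namespace SmoothCoefficients

lemma isFourthOrder_op0Sum (h : C.SmoothCoefficients) (om : ℝ) : IsFourthOrder (C.op0Sum om) :=
  .add (.sum _ fun i => .sum _ fun j =>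
    .add (.coeff_mul (h.mu0 i j).continuous (.pd2 i j))
      (.coeff_mul (contDiff_pd (h.mu0 i j) i).continuous (.pd1 j)))
    (.coeff_mul (h.rho0.continuous.mul continuous_const) .id)

lemma isFourthOrder_op1 (h : C.SmoothCoefficients) (om : ℝ) : IsFourthOrder (C.op1 om) :=
  have hη : ∀ j, Continuous (C.divEta j) := fun j =>
    continuous_finsetSum _ fun i _ => (contDiff_pd (h.eta i j) i).continuous
  have hμ : ∀ j k, Continuous (C.divMu1 j k) := fun j k =>
    continuous_finsetSum _ fun i _ => (contDiff_pd (h.mu1 i j k) i).continuous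
  .add (.add
    (.sum _ fun j => .coeff_mul ((hη j).add ((h.rho1 j).continuous.mul continuous_const)) (.pd1 j))
    (.sum _ fun j => .sum _ fun k => .coeff_mul ((h.eta j k).continuous.add (hμ j k)) (.pd2 j k)))
    (.sum _ fun j => .sum _ fun k => .sum _ fun l =>
      .coeff_mul (h.mu1 j k l).continuous (.pd3 j k l))

lemma isFourthOrder_op2 (h : C.SmoothCoefficients) (om : ℝ) : IsFourthOrder (C.op2 om) :=
  have hφ : ∀ j, Continuous (C.divPhi j) := fun j =>
    continuous_finsetSum _ fun i _ => (contDiff_pd (h.phi i j) i).continuous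
  have hψ : ∀ j k, Continuous (C.divPsi j k) := fun j k =>
    continuous_finsetSum _ fun i _ => (contDiff_pd (h.psi i j k) i).continuous
  have hμ : ∀ j k l, Continuous (C.divMu2 j k l) := fun j k l =>
    continuous_finsetSum _ fun i _ => (contDiff_pd (h.mu2 i j k l) i).continuous
  .add (.add (.add
    (.sum _ fun j => .coeff_mul ((hφ j).add ((h.rho2t j).continuous.mul continuous_const)) (.pd1 j))
    (.sum _ fun j => .sum _ fun k => .coeff_mul (((hψ j k).add (h.phi j k).continuous).add
      ((h.rho2 j k).continuous.mul continuous_const)) (.pd2 j k)))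
    (.sum _ fun j => .sum _ fun k => .sum _ fun l =>
      .coeff_mul ((h.psi j k l).continuous.add (hμ j k l)) (.pd3 j k l)))
    (.sum _ fun j => .sum _ fun k => .sum _ fun l => .sum _ fun m =>
      .coeff_mul (h.mu2 j k l m).continuous (.pd4 j k l m))

end SmoothCoefficients

lemma effective_equation (h : C.SolvesL2) {om : ℝ} {u : ℕ → TwoScale M.ℓ}
    (hu : IsExpansion M om u) {K : Set (Pt d)} (hK : IsCompact K) {U : ℝ → Pt d → ℝ}
    (hU : HasSecondOrderExpansion K (fun k => meanField M (u k)) U) :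
    ∃ B : ℝ, ∀ᶠ ε in 𝓝[>] (0 : ℝ), ∀ x ∈ K,
      |C.op0 om (U ε) x - (-ε * C.op1 om (U ε) x - ε ^ 2 * C.op2 om (U ε) x)| ≤ B * ε ^ 3 := by
  have hs := h.smoothCoefficients
  obtain ⟨e₀, e₁, e₂⟩ := mean_field_equations h hu
  have hv : ∀ k ≤ 2, ContDiff ℝ 4 (meanField M (u k)) := fun k hk =>
    contDiff_infty.1 (contDiff_meanField (hu.smooth k (by omega))) 4
  have c : ∀ k ≤ 2, ∀ x, C.op0Sum om (meanField M (u k)) x = C.op0 om (meanField M (u k)) x :=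
    fun k hk x => (op0_eq_sum hs (hv k hk) x).symm
  obtain ⟨B, hB⟩ := hU.effective_equation (hs.isFourthOrder_op0Sum om) (hs.isFourthOrder_op1 om)
    (hs.isFourthOrder_op2 om) hv (fun x => (c 0 (by norm_num) x).trans (e₀ x))
    (fun x => (c 1 (by norm_num) x).trans (e₁ x)) (fun x => (c 2 le_rfl x).trans (e₂ x)) hK
  obtain ⟨A, hA⟩ := hU
  refine ⟨B, ?_⟩
  filter_upwards [hB, hA] with ε h1 h2 x hx
  rw [op0_eq_sum hs h2.1]
  exact h1 x hx

end CellFunctions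

end QuasiPeriodic

end

theorem mainTheorem2 (d : ℕ) (hd : 1 ≤ d) (M : QuasiPeriodic.Medium d) :
    (∃! C : QuasiPeriodic.CellFunctions M, C.Solves) ∧
    ∀ C : QuasiPeriodic.CellFunctions M, C.Solves →
      C.SmoothCoefficients ∧
      (∀ x, 0 < M.rho0 x) ∧
      ∀ (om : ℝ) (u : ℕ → QuasiPeriodic.TwoScale M.ℓ), QuasiPeriodic.IsExpansion M om u →
        (∀ n ≤ 4, ContDiff ℝ ∞ (QuasiPeriodic.meanField M (u n))) ∧
        C.Represents u ∧
        (∀ x, C.op0 om (QuasiPeriodic.meanField M (u 0)) x = 0) ∧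
        (∀ x, C.op0 om (QuasiPeriodic.meanField M (u 1)) x =
          -C.op1 om (QuasiPeriodic.meanField M (u 0)) x) ∧
        (∀ x, C.op0 om (QuasiPeriodic.meanField M (u 2)) x =
          -C.op1 om (QuasiPeriodic.meanField M (u 1)) x
            - C.op2 om (QuasiPeriodic.meanField M (u 0)) x) ∧
        ∀ (K : Set (QuasiPeriodic.Pt d)) (U : ℝ → QuasiPeriodic.Pt d → ℝ), IsCompact K →
          QuasiPeriodic.HasSecondOrderExpansion K
            (fun k => QuasiPeriodic.meanField M (u k)) U →
          ∃ B : ℝ, ∀ᶠ ε in 𝓝[>] (0 : ℝ), ∀ x ∈ K,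
            |C.op0 om (U ε) x - (-ε * C.op1 om (U ε) x - ε ^ 2 * C.op2 om (U ε) x)| ≤ B * ε ^ 3 := by
  refine ⟨QuasiPeriodic.CellFunctions.existsUnique_solves M, fun C hC => ?_⟩
  have h := (QuasiPeriodic.CellFunctions.solves_iff C).1 hC
  refine ⟨h.smoothCoefficients, M.rho0_pos, fun om u hu => ?_⟩
  obtain ⟨e₀, e₁, e₂⟩ := QuasiPeriodic.CellFunctions.mean_field_equations h hu
  exact ⟨fun n hn => QuasiPeriodic.contDiff_meanField (hu.smooth n hn),
    QuasiPeriodic.CellFunctions.represents h hu, e₀, e₁, e₂,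
    fun K U hK hU => QuasiPeriodic.CellFunctions.effective_equation h hu hK hU⟩
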